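/- **Definitions.** Let $\omega\in\mathbb{C}$. *Discrete filtered sets.* A discrete filtered set $\Omega_\star$ centred at $\omega$ is a family of finite sets $\Omega_L\subset D(\omega,L)$ ($L>0$), with $\Omega_{L_1}\subseteq\Omega_{L_2}$ whenever $L_1\le L_2$, and $\Omega_L=\{\omega\}$ for all sufficiently small $L>0$. The fine sum $\Omega_\star\ast\Omega'_\star$ of two discrete filtered sets centred at $\omega$ is the discrete filtered set centred at $\omega$ given by $$(\Omega_\star\ast\Omega'_\star)_L=\{-\omega+\omega_1+\omega_2 \mid \omega_1\in\Omega_{L_1},\ \omega_2\in\Omega'_{L_2},\ L_1,L_2>0,\ L_1+L_2=L\}.$$ *Allowed paths.* For $L>0$ let $\mathfrak{R}_{\Omega_\star}(L)$ be the set of piecewise $C^1$ paths $\lambda:[0,1]\to\mathbb{C}$ with $\lambda(0)=\omega$ and length $<L$ which either are constant or satisfy, for some $t_0\in[0,1)$, $\lambda([0,t_0])=\{\omega\}$ and $\lambda((t_0,1])\subset D(\omega,L)\setminus\Omega_L$. A path is $\Omega_\star$-allowed if it lies in $\mathfrak{R}_{\Omega_\star}(L)$ for some $L>0$. An $\Omega_\star$-homotopy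 is a continuous map $(s,t)\in[0,1]^2\mapsto H_t(s)\in\mathbb{C}$ such that every $H_t$ is $\Omega_\star$-allowed and, for some finite subdivision of $[0,1]$ into closed intervals $I$ in the variable $s$, $\partial H/\partial s$ exists and is continuous on each $I\times[0,1]$. Two allowed paths with the same end point are $\Omega_\star$-homotopic if an $\Omega_\star$-homotopy with fixed extremities joins them; $\mathrm{cl}(\lambda)$ denotes the class of $\lambda$. *The surface $\mathscr{R}_{\Omega_\star}$.* It is the set of classes $\mathrm{cl}(\lambda)$ of $\Omega_\star$-allowed paths, with the projection $\mathfrak{p}(\mathrm{cl}(\lambda))=\lambda(1)$ and as base point the class of the constant path $\omega$. Its topology is generated by the following sets: (i) $\{\mathrm{cl}([\omega,\xi])\mid\xi\in U\}$, where $U\subset D(\omega,L)\setminus(\Omega_L\setminus\{\omega\})$ is open and star-shaped with respect to $\omega$, $L>0$; (ii) $\{\mathrm{cl}(\lambda\cdot[\lambda(1),\xi])\mid\xi\in U\}$, where $\lambda\in\mathfrak{R}_{\Omega_\star}(L)$, $\lambda(1)\ne\omega$, $L_2>0$, $\mathrm{length}(\lambda)+L_2<L$, and $U\subset D(\lambda(1),L_2)\setminus\Omega_L$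 is open and star-shaped with respect to $\lambda(1)$. Here $[z,\xi]$ is the straight path from $z$ to $\xi$ and $\cdot$ is the product of paths. The complex structure is pulled back from $\mathbb{C}$ by $\mathfrak{p}$. *Endless continuability.* An endless Riemann surface is a connected Hausdorff space $\mathscr{R}$ with a local homeomorphism $\mathfrak{p}:\mathscr{R}\to\mathbb{C}$ (and the complex structure pulled back by $\mathfrak{p}$) such that for each $\zeta\in\mathscr{R}$ there is a discrete filtered set $\Omega_\star(\zeta)$ centred at $\mathfrak{p}(\zeta)$ all of whose allowed paths can be lifted by $\mathfrak{p}$ to $\mathscr{R}$ from $\zeta$. A holomorphic germ $\widehat\varphi$ at $\mathfrak{p}(x)$, $x\in\mathscr{R}$, continues analytically to $\mathscr{R}$ (from $x$) if there is a holomorphic function $\Phi$ on $\mathscr{R}$ with $\Phi=\widehat\varphi\circ\mathfrak{p}$ near $x$; the same definition is used for $\mathscr{R}_{\Omega_\star}$ with its base point. A holomorphic germ at $\omega$ is endlessly continuable if it continues analytically to some endless Riemann surface from some point above $\omega$, and $\widehat{\mathscr{R}}_{\Omega_\star}$ is the set of holomorphic germs at $\omega$ that continue analytically to $\mathscr{R}_{\Omega_\star}$.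 *Convolution.* For holomorphic germs $\widehat\varphi,\widehat\psi$ at $\omega$, $\displaystyle \widehat\varphi\ast\widehat\psi(\zeta)=\int_\omega^\zeta\widehat\varphi(\eta)\,\widehat\psi(\zeta+\omega-\eta)\,d\eta$ for $\zeta$ near $\omega$, the integral being taken over the segment. **Theorem.** Let $\widehat\varphi,\widehat\psi$ be two germs of holomorphic functions at $\omega\in\mathbb{C}$. 1. If $\widehat\varphi$ and $\widehat\psi$ are endlessly continuable, then so is $\widehat\varphi\ast\widehat\psi$. 2. More precisely, if $\Omega_\star$ and $\Omega'_\star$ are discrete filtered sets centred at $\omega$ with $\widehat\varphi\in\widehat{\mathscr{R}}_{\Omega_\star}$ and $\widehat\psi\in\widehat{\mathscr{R}}_{\Omega'_\star}$, then $\widehat\varphi\ast\widehat\psi\in\widehat{\mathscr{R}}_{\Omega_\star\ast\Omega'_\star}$. -/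

import Mathlib

open Set Filter Topology

namespace Endless

/-- A discrete filtered set centred at `ω`: an increasing family of finite sets `Ω_L`, `L > 0`
(the values at `L ≤ 0` are irrelevant and never used). -/
structure DiscreteFilteredSet (ω : ℂ) where
  /-- the set `Ω_L` -/
  pts : ℝ → Set ℂ
  finite_pts : ∀ L : ℝ, 0 < L → (pts L).Finite
  pts_subset_ball : ∀ L : ℝ, 0 < L → pts L ⊆ Metric.ball ω L
  pts_mono : ∀ L₁ L₂ : ℝ, 0 < L₁ → L₁ ≤ L₂ → pts L₁ ⊆ pts L₂
  pts_small : ∀ᶠ L : ℝ in 𝓝[>] 0, pts L = {ω}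

theorem DiscreteFilteredSet.center_mem {ω : ℂ} (Ω : DiscreteFilteredSet ω) {L : ℝ} (hL : 0 < L) :
    ω ∈ Ω.pts L := by
  have h := Ω.pts_small.and (Ioo_mem_nhdsGT hL)
  obtain ⟨l, hl, hl0, hlL⟩ := h.exists
  exact Ω.pts_mono l L hl0 hlL.le (by rw [hl]; rfl)

/-- The fine sum `Ω ∗ Ω'`:
`(Ω ∗ Ω')_L = {-ω + ω₁ + ω₂ | ω₁ ∈ Ω_{L₁}, ω₂ ∈ Ω'_{L₂}, L₁ + L₂ = L}`. -/
def DiscreteFilteredSet.fineSum {ω : ℂ} (Ω Ω' : DiscreteFilteredSet ω) :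
    DiscreteFilteredSet ω where
  pts L := {ζ | ∃ L₁ L₂ : ℝ, 0 < L₁ ∧ 0 < L₂ ∧ L₁ + L₂ = L ∧
    ∃ ω₁ ∈ Ω.pts L₁, ∃ ω₂ ∈ Ω'.pts L₂, ζ = -ω + ω₁ + ω₂}
  finite_pts L hL := by
    refine ((Ω.finite_pts L hL).image2 (fun a b => -ω + a + b) (Ω'.finite_pts L hL)).subset ?_
    rintro ζ ⟨L₁, L₂, h₁, h₂, h, a, ha, b, hb, rfl⟩
    exact ⟨a, Ω.pts_mono L₁ L h₁ (by linarith) ha, b, Ω'.pts_mono L₂ L h₂ (by linarith) hb, rfl⟩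
  pts_subset_ball L hL := by
    rintro ζ ⟨L₁, L₂, h₁, h₂, h, a, ha, b, hb, rfl⟩
    have ha' := Ω.pts_subset_ball L₁ h₁ ha
    have hb' := Ω'.pts_subset_ball L₂ h₂ hb
    rw [mem_ball_iff_norm] at ha' hb' ⊢
    calc ‖-ω + a + b - ω‖ = ‖(a - ω) + (b - ω)‖ := by congr 1; ring
      _ ≤ ‖a - ω‖ + ‖b - ω‖ := norm_add_le _ _
      _ < L := by linarith
  pts_mono L M hL hLM := by
    rintro ζ ⟨L₁, L₂, h₁, h₂, h, a, ha, b, hb, rfl⟩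
    exact ⟨L₁ + (M - L), L₂, by linarith, h₂, by linarith, a,
      Ω.pts_mono L₁ _ h₁ (by linarith) ha, b, hb, rfl⟩
  pts_small := by
    have h := Ω.pts_small.and Ω'.pts_small
    rw [eventually_nhdsWithin_iff, Metric.eventually_nhds_iff] at h
    obtain ⟨ε, hε, h⟩ := h
    have hs : ∀ l : ℝ, 0 < l → l < ε → Ω.pts l = {ω} ∧ Ω'.pts l = {ω} := fun l h0 h1 =>
      h (by rw [Real.dist_eq, sub_zero, abs_of_pos h0]; exact h1) h0
    filter_upwards [Ioo_mem_nhdsGT hε] with L hL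
    ext ζ
    constructor
    · rintro ⟨L₁, L₂, h₁, h₂, h, a, ha, b, hb, rfl⟩
      rw [(hs L₁ h₁ (by linarith [hL.2])).1] at ha
      rw [(hs L₂ h₂ (by linarith [hL.2])).2] at hb
      rw [mem_singleton_iff] at ha hb
      subst ha hb
      simp
    · rintro rfl
      exact ⟨L / 2, L / 2, half_pos hL.1, half_pos hL.1, by ring, _,
        Ω.center_mem (half_pos hL.1), _, Ω'.center_mem (half_pos hL.1), by ring⟩

/-! Paths are standard paths, parametrised by `[0,1]`; they are functions on `ℝ` of which only the
values on `[0,1]` matter. -/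

/-- Piecewise `C¹` on `[0,1]`: there is a subdivision `0 = a 0 ≤ a 1 ≤ … ≤ a n = 1` such that the
path is `C¹` on each closed piece. -/
def PiecewiseC1 (γ : ℝ → ℂ) : Prop :=
  ∃ (n : ℕ) (a : ℕ → ℝ), Monotone a ∧ a 0 = 0 ∧ a n = 1 ∧
    ∀ i < n, ContDiffOn ℝ 1 γ (Icc (a i) (a (i + 1)))

/-- The length of a path. -/
noncomputable def pathLength (γ : ℝ → ℂ) : ENNReal := eVariationOn γ (Icc 0 1)

/-- The path `γ` belongs to `𝔯_Ω(L)`. -/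
structure IsAllowedAt {ω : ℂ} (Ω : DiscreteFilteredSet ω) (L : ℝ) (γ : ℝ → ℂ) : Prop where
  start : γ 0 = ω
  piecewiseC1 : PiecewiseC1 γ
  length_lt : pathLength γ < ENNReal.ofReal L
  avoids : (∀ s ∈ Icc (0 : ℝ) 1, γ s = ω) ∨
    ∃ t₀ ∈ Ico (0 : ℝ) 1, (∀ s ∈ Icc 0 t₀, γ s = ω) ∧
      ∀ s ∈ Ioc t₀ 1, γ s ∈ Metric.ball ω L \ Ω.pts L

/-- The path `γ` is `Ω`-allowed. -/
def IsAllowed {ω : ℂ} (Ω : DiscreteFilteredSet ω) (γ : ℝ → ℂ) : Prop :=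
  ∃ L : ℝ, 0 < L ∧ IsAllowedAt Ω L γ

/-- The type of `Ω`-allowed paths. -/
def AllowedPath {ω : ℂ} (Ω : DiscreteFilteredSet ω) : Type := {γ : ℝ → ℂ // IsAllowed Ω γ}

/-- `H : (s, t) ↦ H_t(s)` is an `Ω`-homotopy: `H` is continuous on `[0,1]²`, every `H_t` is
`Ω`-allowed, and, for some subdivision of `[0,1]` in the variable `s`, the partial derivative
`∂H/∂s` exists and is continuous on each piece `[a i, a (i+1)] × [0,1]`. -/
structure IsAllowedHomotopy {ω : ℂ} (Ω : DiscreteFilteredSet ω) (H : ℝ → ℝ → ℂ) : Prop where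
  continuousOn : ContinuousOn (fun q : ℝ × ℝ => H q.1 q.2) (Icc 0 1 ×ˢ Icc 0 1)
  deriv_continuous : ∃ (n : ℕ) (a : ℕ → ℝ), Monotone a ∧ a 0 = 0 ∧ a n = 1 ∧
    ∀ i < n, ∃ H' : ℝ × ℝ → ℂ, ContinuousOn H' (Icc (a i) (a (i + 1)) ×ˢ Icc 0 1) ∧
      ∀ s ∈ Icc (a i) (a (i + 1)), ∀ t ∈ Icc (0 : ℝ) 1,
        HasDerivWithinAt (fun σ => H σ t) (H' (s, t)) (Icc (a i) (a (i + 1))) s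
  allowed : ∀ t ∈ Icc (0 : ℝ) 1, IsAllowed Ω (fun s => H s t)

/-- Two `Ω`-allowed paths are `Ω`-homotopic (with fixed extremities; the initial point of an
allowed path is always the centre). -/
def AllowedHomotopic {ω : ℂ} (Ω : DiscreteFilteredSet ω) (γ₀ γ₁ : AllowedPath Ω) : Prop :=
  ∃ H : ℝ → ℝ → ℂ, IsAllowedHomotopy Ω H ∧
    (∀ s ∈ Icc (0 : ℝ) 1, H s 0 = γ₀.1 s) ∧ (∀ s ∈ Icc (0 : ℝ) 1, H s 1 = γ₁.1 s) ∧
    ∀ t ∈ Icc (0 : ℝ) 1, H 1 t = γ₀.1 1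

/-- The space `𝓡_Ω` of classes of `Ω`-allowed paths modulo `Ω`-homotopy. -/
def Surface {ω : ℂ} (Ω : DiscreteFilteredSet ω) : Type := Quot (AllowedHomotopic Ω)

/-- The class `cl(γ)`. -/
def Surface.cl {ω : ℂ} (Ω : DiscreteFilteredSet ω) (γ : AllowedPath Ω) : Surface Ω :=
  Quot.mk _ γ

/-- The projection `cl(γ) ↦ γ(1)`. -/
def Surface.proj {ω : ℂ} (Ω : DiscreteFilteredSet ω) : Surface Ω → ℂ :=
  Quot.lift (fun γ => γ.1 1) (by
    rintro γ₀ γ₁ ⟨H, -, -, h₁, h⟩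
    have h1 : (1 : ℝ) ∈ Icc (0 : ℝ) 1 := ⟨zero_le_one, le_rfl⟩
    exact (h 1 h1).symm.trans (h₁ 1 h1))

theorem isAllowed_const {ω : ℂ} (Ω : DiscreteFilteredSet ω) : IsAllowed Ω (fun _ => ω) := by
  refine ⟨1, one_pos, rfl, ⟨1, fun i => (i : ℝ), Nat.mono_cast, by simp, by simp,
    fun _ _ => contDiffOn_const⟩, ?_, Or.inl fun _ _ => rfl⟩
  have : pathLength (fun _ => ω) = 0 :=
    eVariationOn.constant_on (subsingleton_singleton.anti (by rintro _ ⟨_, _, rfl⟩; rfl))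
  rw [this]
  simp

/-- The base point of `𝓡_Ω`: the class of the constant path. -/
def Surface.base {ω : ℂ} (Ω : DiscreteFilteredSet ω) : Surface Ω :=
  Surface.cl Ω ⟨fun _ => ω, isAllowed_const Ω⟩

/-- The straight path from `z` to `w`. -/
noncomputable def segPath (z w : ℂ) : ℝ → ℂ := fun s => z + (s : ℂ) * (w - z)

/-- The (standardized) product path: first `γ₁`, then `γ₂`. -/
noncomputable def concat (γ₁ γ₂ : ℝ → ℂ) : ℝ → ℂ :=
  fun s => if s ≤ 1 / 2 then γ₁ (2 * s) else γ₂ (2 * s - 1)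

/-- `U` is a star-shaped domain with respect to `z`. -/
def IsStarDomain (z : ℂ) (U : Set ℂ) : Prop := IsOpen U ∧ z ∈ U ∧ StarConvex ℝ z U

/-- The basic neighbourhoods of the base point: the classes of the straight paths from `ω` to the
points of `U`, for `U` a domain star-shaped about `ω` in `D(ω, L) \ (Ω_L \ {ω})`. -/
def baseNhd {ω : ℂ} (Ω : DiscreteFilteredSet ω) (U : Set ℂ) : Set (Surface Ω) :=
  {x | ∃ ξ ∈ U, ∃ h : IsAllowed Ω (segPath ω ξ), x = Surface.cl Ω ⟨segPath ω ξ, h⟩}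

/-- The basic neighbourhoods of `cl(γ)`: the classes of the products of `γ` with the straight paths
from `γ(1)` to the points of `U`, for suitable `U` star-shaped about `γ(1)`. -/
def pathNhd {ω : ℂ} (Ω : DiscreteFilteredSet ω) (γ : ℝ → ℂ) (U : Set ℂ) : Set (Surface Ω) :=
  {x | ∃ ξ ∈ U, ∃ h : IsAllowed Ω (concat γ (segPath (γ 1) ξ)),
    x = Surface.cl Ω ⟨concat γ (segPath (γ 1) ξ), h⟩}

/-- The topology of `𝓡_Ω`. An allowed path has class different from the base point exactly when
its end point differs from `ω`. -/
instance Surface.instTopologicalSpace {ω : ℂ} (Ω : DiscreteFilteredSet ω) :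
    TopologicalSpace (Surface Ω) :=
  TopologicalSpace.generateFrom
    ({V | ∃ (L : ℝ) (U : Set ℂ), 0 < L ∧ IsStarDomain ω U ∧
        U ⊆ Metric.ball ω L \ (Ω.pts L \ {ω}) ∧ V = baseNhd Ω U} ∪
      {V | ∃ (γ : ℝ → ℂ) (L L₂ : ℝ) (U : Set ℂ), IsAllowedAt Ω L γ ∧ γ 1 ≠ ω ∧ 0 < L₂ ∧
        pathLength γ + ENNReal.ofReal L₂ < ENNReal.ofReal L ∧ IsStarDomain (γ 1) U ∧
        U ⊆ Metric.ball (γ 1) L₂ \ Ω.pts L ∧ V = pathNhd Ω γ U})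

/-- A function `Φ` on a space `R` étalé over `ℂ` by `p` is holomorphic for the complex structure
pulled back by `p`. -/
def IsHolomorphicOver {R : Type} [TopologicalSpace R] (p : R → ℂ) (Φ : R → ℂ) : Prop :=
  ∀ ζ : R, ∃ f : ℂ → ℂ, AnalyticAt ℂ f (p ζ) ∧ ∀ᶠ ξ in 𝓝 ζ, Φ ξ = f (p ξ)

/-- The germ at `p x` of the function `φ` is holomorphic and can be analytically continued to `R`
from the point `x`. -/
def ContinuesTo {R : Type} [TopologicalSpace R] (p : R → ℂ) (x : R) (φ : ℂ → ℂ) : Prop :=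
  AnalyticAt ℂ φ (p x) ∧
    ∃ Φ : R → ℂ, IsHolomorphicOver p Φ ∧ ∀ᶠ ξ in 𝓝 x, Φ ξ = φ (p ξ)

/-- The germ of `φ` at `ω` belongs to `𝓡̂_Ω`: it can be analytically continued to `𝓡_Ω`. -/
def ContinuesToSurface {ω : ℂ} (Ω : DiscreteFilteredSet ω) (φ : ℂ → ℂ) : Prop :=
  ContinuesTo (Surface.proj Ω) (Surface.base Ω) φ

/-- `(R, p)` is an endless Riemann surface: a connected Hausdorff space étalé over `ℂ` by `p` such
that for every `ζ` there is a discrete filtered set centred at `p ζ` all of whose allowed paths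
can be lifted to `R` from `ζ`. -/
structure IsEndlessRiemannSurface {R : Type} [TopologicalSpace R] (p : R → ℂ) : Prop where
  t2 : T2Space R
  connected : ConnectedSpace R
  isLocalHomeomorph : IsLocalHomeomorph p
  endless : ∀ ζ : R, ∃ Ω : DiscreteFilteredSet (p ζ), ∀ γ : ℝ → ℂ, IsAllowed Ω γ →
    ∃ Λ : ℝ → R, ContinuousOn Λ (Icc 0 1) ∧ Λ 0 = ζ ∧ ∀ s ∈ Icc (0 : ℝ) 1, p (Λ s) = γ s

/-- The germ of `φ` at `ω` is holomorphic and endlessly continuable. (A connected Hausdorff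
surface étalé over `ℂ` has the cardinality of the continuum, so surfaces in `Type` suffice.) -/
def EndlesslyContinuable (ω : ℂ) (φ : ℂ → ℂ) : Prop :=
  ∃ (R : Type) (_ : TopologicalSpace R) (p : R → ℂ) (x : R),
    IsEndlessRiemannSurface p ∧ p x = ω ∧ ContinuesTo p x φ

/-- The convolution product at `ω`, `ζ ↦ ∫_ω^ζ φ(η) ψ(ζ + ω - η) dη`, the integral being taken
over the segment `η = ω + s (ζ - ω)`, `0 ≤ s ≤ 1`. Its germ at `ω` depends only on the germs of
`φ` and `ψ` at `ω`. -/
noncomputable def convolution (ω : ℂ) (φ ψ : ℂ → ℂ) : ℂ → ℂ := fun ζ =>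
  ∫ s in (0 : ℝ)..1, φ (segPath ω ζ s) * ψ (ζ + ω - segPath ω ζ s) * (ζ - ω)

end Endless

/-! Translate `ω` to `0` and record lengths: a path `γ` with running length `m` becomes the curve `q
= (m, γ)` in `ℝ × ℂ`, and a filtered set `Ω` becomes the set `S(Ω)` of the pairs `(L, a - ω)` with
`a ∈ Ω_L`. Let `margin Ω` be the distance to `S(Ω)`. The fine sum is made so that `S(Ω) + S(Ω') =
S(Ω ∗ Ω')`, whence `margin (Ω ∗ Ω') (x + y) ≤ margin Ω x + margin Ω' y` (`margin_fineSum_le`). If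
`q` keeps a distance `δ` from `S(Ω ∗ Ω')`, then `x` and `q - x` are never both close to their
singular sets.

The convolution is continued along `γ` by deforming the path of integration. Each point `x` of the
initial segment from `0` to `q(0)` moves according to `x' = margin Ω x / (margin Ω x + margin Ω' (q
- x)) · q'`. The denominator is at least `δ`; the point `0` is at rest, the other end follows `q`,
and `x ↦ q - x` exchanges `Ω` and `Ω'` (`sub_eulerFlow`). The speed is controlled by `margin Ω x`,
so by a Gronwall estimate a trajectory never reaches `S(Ω)`, and its first coordinate bounds its
length. Hence `φ` continues along `x` and `ψ` along `q - x`, and integrating their product over the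
deformed path continues `φ ∗ ψ`. Trajectories issued from points near `0` have a small margin, but
the same exponential bounds keep them in the disc where the germ is analytic; this gives estimates
uniform over the initial segment (`chainContinues_eulerFlow`). Only the Euler scheme of the flow is
used: continuation takes place along chains of discs of a fixed radius, and Cauchy's theorem in
small quadrilaterals compares successive paths of integration (`chainContinues_convZero`).

Two bridges link chains and surfaces. A germ that continues to `𝓡_Ω` continues along chains
(`chainContinues_of_surface`), because the class of `γ · [γ(1), w]` depends continuously on `w`.
Conversely, the germs reached from the convolution along clocked paths form an open connected part
of the Hausdorff space of germs; it is endless and all allowed paths of the fine sum lift to it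
(`exists_isEndlessRiemannSurface`). Lifting of homotopies then gives a continuous map from `𝓡_{Ω ∗
Ω'}` to it (`exists_continuous_surface_lift`). The same map shows that an endlessly continuable germ
continues to some `𝓡_Ω`, so both statements follow from the case of filtered sets. -/

namespace Endless

/-! ### Piecewise `C¹` families of paths -/

/-- The family of paths `t ↦ (s ↦ H s t)`, `t ∈ [0,1]`, is piecewise `C¹` in `s ∈ [a,b]`, with
breakpoints that do not depend on `t` and derivative jointly continuous in `(s, t)`. -/
def PiecewiseC1Family (a b : ℝ) (H : ℝ → ℝ → ℂ) : Prop :=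
  ∃ (n : ℕ) (c : ℕ → ℝ), Monotone c ∧ c 0 = a ∧ c n = b ∧
    ∀ i < n, ∃ H' : ℝ × ℝ → ℂ, ContinuousOn H' (Icc (c i) (c (i + 1)) ×ˢ Icc 0 1) ∧
      ∀ s ∈ Icc (c i) (c (i + 1)), ∀ t ∈ Icc (0 : ℝ) 1,
        HasDerivWithinAt (fun σ => H σ t) (H' (s, t)) (Icc (c i) (c (i + 1))) s

theorem PiecewiseC1Family.congr {a b : ℝ} {H G : ℝ → ℝ → ℂ} (h : PiecewiseC1Family a b H)
    (hG : ∀ s ∈ Icc a b, ∀ t ∈ Icc (0 : ℝ) 1, G s t = H s t) : PiecewiseC1Family a b G := by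
  obtain ⟨n, c, hc, rfl, rfl, h⟩ := h
  refine ⟨n, c, hc, rfl, rfl, fun i hi => ?_⟩
  obtain ⟨H', h1, h2⟩ := h i hi
  have hsub : Icc (c i) (c (i + 1)) ⊆ Icc (c 0) (c n) :=
    Icc_subset_Icc (hc (Nat.zero_le i)) (hc hi)
  exact ⟨H', h1, fun s hs t ht =>
    (h2 s hs t ht).congr (fun σ hσ => hG σ (hsub hσ) t ht) (hG s (hsub hs) t ht)⟩

theorem PiecewiseC1Family.append {a b d : ℝ} {H : ℝ → ℝ → ℂ} (h₁ : PiecewiseC1Family a b H)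
    (h₂ : PiecewiseC1Family b d H) : PiecewiseC1Family a d H := by
  obtain ⟨n, c, hc, rfl, rfl, h⟩ := h₁
  obtain ⟨m, e, he, h0, rfl, h'⟩ := h₂
  have key : ∀ i, n ≤ i → (if i ≤ n then c i else e (i - n)) = e (i - n) := by
    intro i hi
    rcases hi.eq_or_lt with rfl | hi
    · simp [h0]
    · rw [if_neg (not_le.2 hi)]
  refine ⟨n + m, fun i => if i ≤ n then c i else e (i - n), ?_, by simp, ?_, ?_⟩
  · refine monotone_nat_of_le_succ fun i => ?_
    rcases lt_or_ge i n with hi | hi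
    · rw [if_pos hi.le, if_pos (Nat.succ_le_of_lt hi)]
      exact hc (Nat.le_succ i)
    · rw [key i hi, key (i + 1) (hi.trans (Nat.le_succ i))]
      exact he (by omega)
  · exact (key _ (Nat.le_add_right n m)).trans (by simp)
  · intro i hi
    rcases lt_or_ge i n with h1 | h1
    · simp only [if_pos h1.le, if_pos (Nat.succ_le_of_lt h1)]
      exact h i h1
    · simp only [key i h1, key (i + 1) (h1.trans (Nat.le_succ i))]
      have : i + 1 - n = i - n + 1 := by omega
      rw [this]
      exact h' (i - n) (by omega)

theorem PiecewiseC1Family.comp_affine {a b : ℝ} {H : ℝ → ℝ → ℂ} (h : PiecewiseC1Family a b H)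
    {p : ℝ} (hp : 0 < p) (q : ℝ) :
    PiecewiseC1Family ((a - q) / p) ((b - q) / p) (fun s t => H (p * s + q) t) := by
  obtain ⟨n, c, hc, rfl, rfl, h⟩ := h
  refine ⟨n, fun i => (c i - q) / p, fun i j hij => by
    have := hc hij
    dsimp only
    gcongr, rfl, rfl, fun i hi => ?_⟩
  obtain ⟨H', h1, h2⟩ := h i hi
  have hm : ∀ s ∈ Icc ((c i - q) / p) ((c (i + 1) - q) / p),
      p * s + q ∈ Icc (c i) (c (i + 1)) := by
    rintro s ⟨hs1, hs2⟩
    rw [div_le_iff₀ hp] at hs1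
    rw [le_div_iff₀ hp] at hs2
    constructor <;> linarith
  refine ⟨fun x => p • H' (p * x.1 + q, x.2), ?_, fun s hs t ht => ?_⟩
  · refine ContinuousOn.const_smul (h1.comp (f := fun x : ℝ × ℝ => (p * x.1 + q, x.2))
      (by fun_prop) ?_) p
    rintro ⟨s, t⟩ ⟨hs, ht⟩
    exact ⟨hm s hs, ht⟩
  · have hd : HasDerivWithinAt (fun s : ℝ => p * s + q) p
        (Icc ((c i - q) / p) ((c (i + 1) - q) / p)) s := by
      simpa using (((hasDerivAt_id s).const_mul p).add_const q).hasDerivWithinAt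
    exact (h2 _ (hm s hs) t ht).scomp s hd hm

theorem concat_of_le {γ₁ γ₂ : ℝ → ℂ} {s : ℝ} (hs : s ≤ 1 / 2) : concat γ₁ γ₂ s = γ₁ (2 * s) :=
  if_pos hs

theorem concat_of_ge {γ₁ γ₂ : ℝ → ℂ} (h : γ₁ 1 = γ₂ 0) {s : ℝ} (hs : 1 / 2 ≤ s) :
    concat γ₁ γ₂ s = γ₂ (2 * s - 1) := by
  rcases hs.eq_or_lt with rfl | hs
  · rw [concat_of_le le_rfl]
    norm_num [h]
  · exact if_neg (not_le.2 hs)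

theorem PiecewiseC1Family.concat {H G : ℝ → ℝ → ℂ} (hH : PiecewiseC1Family 0 1 H)
    (hG : PiecewiseC1Family 0 1 G) (h : ∀ t ∈ Icc (0 : ℝ) 1, H 1 t = G 0 t) :
    PiecewiseC1Family 0 1 (fun s t => concat (fun σ => H σ t) (fun σ => G σ t) s) := by
  have h1 := hH.comp_affine two_pos 0
  have h2 := hG.comp_affine two_pos (-1)
  norm_num at h1 h2
  refine (h1.congr fun s hs t _ => ?_).append (h2.congr fun s hs t ht => ?_)
  · exact concat_of_le hs.2
  · exact concat_of_ge (h t ht) hs.1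

theorem PiecewiseC1.family {γ : ℝ → ℂ} (h : PiecewiseC1 γ) :
    PiecewiseC1Family 0 1 (fun s _ => γ s) := by
  obtain ⟨n, a, ha, h0, h1, h⟩ := h
  refine ⟨n, a, ha, h0, h1, fun i hi => ?_⟩
  rcases (ha (Nat.le_succ i)).eq_or_lt with he | hlt
  -- On a one-point piece every value is a derivative, so `0` will do.
  · refine ⟨fun _ => 0, continuousOn_const, fun s hs t _ => ?_⟩
    rw [Nat.succ_eq_add_one] at he
    rw [he, Icc_self] at hs ⊢
    rw [mem_singleton_iff.1 hs]
    exact (hasFDerivWithinAt_singleton _ _).hasDerivWithinAt.congr_deriv (by simp)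
  · obtain ⟨hd, hc⟩ := (contDiffOn_one_iff_derivWithin (uniqueDiffOn_Icc hlt)).1 (h i hi)
    refine ⟨fun x => derivWithin γ (Icc (a i) (a (i + 1))) x.1, ?_, fun s hs t _ => ?_⟩
    · exact hc.comp continuousOn_fst fun x hx => hx.1
    · exact (hd s hs).hasDerivWithinAt

theorem PiecewiseC1Family.piecewiseC1 {H : ℝ → ℝ → ℂ} (h : PiecewiseC1Family 0 1 H) {t : ℝ}
    (ht : t ∈ Icc (0 : ℝ) 1) : PiecewiseC1 (fun s => H s t) := by
  obtain ⟨n, a, ha, h0, h1, h⟩ := h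
  refine ⟨n, a, ha, h0, h1, fun i hi => ?_⟩
  obtain ⟨H', hc, hd⟩ := h i hi
  rcases (ha (Nat.le_succ i)).eq_or_lt with he | hlt
  · rw [Nat.succ_eq_add_one] at he
    rw [he, Icc_self]
    intro s hs
    rw [mem_singleton_iff.1 hs]
    exact contDiffWithinAt_singleton
  · rw [contDiffOn_one_iff_derivWithin (uniqueDiffOn_Icc hlt)]
    refine ⟨fun s hs => (hd s hs t ht).differentiableWithinAt, ?_⟩
    refine (hc.comp (f := fun s : ℝ => (s, t)) (by fun_prop) fun s hs => ⟨hs, ht⟩).congr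
      fun s hs => ?_
    exact (hd s hs t ht).derivWithin (uniqueDiffOn_Icc hlt s hs)

theorem piecewiseC1Family_of_hasDerivAt {H : ℝ → ℝ → ℂ} {H' : ℝ × ℝ → ℂ} {a b : ℝ} (hab : a ≤ b)
    (hc : ContinuousOn H' (Icc a b ×ˢ Icc 0 1))
    (hd : ∀ s ∈ Icc a b, ∀ t ∈ Icc (0 : ℝ) 1,
      HasDerivWithinAt (fun σ => H σ t) (H' (s, t)) (Icc a b) s) :
    PiecewiseC1Family a b H := by
  refine ⟨1, fun i => if i = 0 then a else b, ?_, by simp, by simp, ?_⟩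
  · refine monotone_nat_of_le_succ fun i => ?_
    by_cases hi : i = 0 <;> simp [hi, hab]
  · intro i hi
    obtain rfl : i = 0 := by omega
    simp only [zero_add, if_neg one_ne_zero]
    exact ⟨H', hc, hd⟩

theorem hasDerivAt_segPath (z w : ℂ) (s : ℝ) : HasDerivAt (segPath z w) (w - z) s := by
  have h : HasDerivAt (fun s : ℝ => (s : ℂ)) 1 s := Complex.ofRealCLM.hasDerivAt
  exact ((h.mul_const (w - z)).const_add z).congr_deriv (one_mul _)

theorem piecewiseC1Family_segPath {z w : ℝ → ℂ} (hz : Continuous z) (hw : Continuous w) :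
    PiecewiseC1Family 0 1 (fun s t => segPath (z t) (w t) s) :=
  piecewiseC1Family_of_hasDerivAt (H' := fun x => w x.2 - z x.2) zero_le_one (by fun_prop)
    fun s _ t _ => (hasDerivAt_segPath (z t) (w t) s).hasDerivWithinAt

theorem segPath_zero (z w : ℂ) : segPath z w 0 = z := by simp [segPath]

theorem segPath_one (z w : ℂ) : segPath z w 1 = w := by simp [segPath]

theorem segPath_self (z : ℂ) (s : ℝ) : segPath z z s = z := by simp [segPath]

theorem continuous_segPath (z w : ℂ) : Continuous (segPath z w) := by
  unfold segPath
  fun_prop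

theorem segPath_mem_segment (z w : ℂ) {s : ℝ} (hs : s ∈ Icc (0 : ℝ) 1) :
    segPath z w s ∈ segment ℝ z w := by
  rw [segment_eq_image']
  exact ⟨s, hs, by simp [segPath]⟩

theorem segPath_eq_center {z w : ℂ} (h : z ≠ w) {s : ℝ} : segPath z w s = z ↔ s = 0 := by
  simp [segPath, sub_eq_zero, h.symm]

theorem piecewiseC1_segPath (z w : ℂ) : PiecewiseC1 (segPath z w) :=
  (piecewiseC1Family_segPath continuous_const continuous_const).piecewiseC1
    (t := 0) ⟨le_rfl, zero_le_one⟩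

theorem PiecewiseC1.concat {γ₁ γ₂ : ℝ → ℂ} (h₁ : PiecewiseC1 γ₁) (h₂ : PiecewiseC1 γ₂)
    (h : γ₁ 1 = γ₂ 0) : PiecewiseC1 (Endless.concat γ₁ γ₂) :=
  (h₁.family.concat h₂.family fun _ _ => h).piecewiseC1 (t := 0) ⟨le_rfl, zero_le_one⟩

/-! ### Lipschitz bounds and lengths -/

/-- A path with breakpoints `c` whose derivative is bounded by `K` on every piece is
`K`-Lipschitz. -/
theorem lipschitzOnWith_of_pieces {f : ℝ → ℂ} {n : ℕ} {c : ℕ → ℝ} (hc : Monotone c) {K : NNReal}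
    (h : ∀ i < n, LipschitzOnWith K f (Icc (c i) (c (i + 1)))) :
    LipschitzOnWith K f (Icc (c 0) (c n)) := by
  induction n with
  | zero => simp [LipschitzOnWith]
  | succ n ih =>
    have h1 := ih fun i hi => h i (hi.trans (Nat.lt_succ_self n))
    have h2 := h n (Nat.lt_succ_self n)
    have key : ∀ x ∈ Icc (c 0) (c (n + 1)), ∀ y ∈ Icc (c 0) (c (n + 1)), x ≤ y →
        dist (f x) (f y) ≤ K * dist x y := by
      intro x hx y hy hxy
      rcases le_total y (c n) with hyn | hyn
      · exact h1.dist_le_mul x ⟨hx.1, hxy.trans hyn⟩ y ⟨hy.1, hyn⟩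
      rcases le_total x (c n) with hxn | hxn
      · have e1 := h1.dist_le_mul x ⟨hx.1, hxn⟩ (c n) ⟨hc (Nat.zero_le n), le_rfl⟩
        have e2 := h2.dist_le_mul (c n) ⟨le_rfl, hc (Nat.le_succ n)⟩ y ⟨hyn, hy.2⟩
        have e3 : dist x y = dist x (c n) + dist (c n) y := by
          rw [Real.dist_eq, Real.dist_eq, Real.dist_eq, abs_of_nonpos (by linarith),
            abs_of_nonpos (by linarith), abs_of_nonpos (by linarith)]
          ring
        rw [e3, mul_add]
        exact (dist_triangle _ (f (c n)) _).trans (add_le_add e1 e2)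
      · exact h2.dist_le_mul x ⟨hxn, hx.2⟩ y ⟨hyn, hy.2⟩
    refine LipschitzOnWith.of_dist_le_mul fun x hx y hy => ?_
    rcases le_total x y with hxy | hxy
    · exact key x hx y hy hxy
    · rw [dist_comm (f x), dist_comm x]
      exact key y hy x hx hxy

theorem lipschitzOnWith_of_hasDerivWithinAt {f f' : ℝ → ℂ} {a b : ℝ} {K : NNReal}
    (hd : ∀ s ∈ Icc a b, HasDerivWithinAt f (f' s) (Icc a b) s)
    (hK : ∀ s ∈ Icc a b, ‖f' s‖ ≤ K) : LipschitzOnWith K f (Icc a b) :=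
  (convex_Icc a b).lipschitzOnWith_of_nnnorm_hasDerivWithin_le hd fun s hs => by
    exact_mod_cast hK s hs

theorem PiecewiseC1.exists_lipschitzOnWith {γ : ℝ → ℂ} (h : PiecewiseC1 γ) :
    ∃ K : NNReal, LipschitzOnWith K γ (Icc 0 1) := by
  obtain ⟨n, c, hc, h0, h1, h⟩ := h.family
  have hp : ∀ i, ∃ K : NNReal, i < n → LipschitzOnWith K γ (Icc (c i) (c (i + 1))) := by
    intro i
    by_cases hi : i < n
    · obtain ⟨H', hcH, hd⟩ := h i hi
      have h00 : (0 : ℝ) ∈ Icc (0 : ℝ) 1 := ⟨le_rfl, zero_le_one⟩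
      have hcc : ContinuousOn (fun s : ℝ => H' (s, 0)) (Icc (c i) (c (i + 1))) :=
        hcH.comp (f := fun s : ℝ => (s, (0 : ℝ))) (by fun_prop) fun s hs => ⟨hs, h00⟩
      obtain ⟨C, hC⟩ := isCompact_Icc.exists_bound_of_continuousOn hcc
      refine ⟨C.toNNReal, fun _ => lipschitzOnWith_of_hasDerivWithinAt
        (fun s hs => hd s hs 0 h00) fun s hs => (hC s hs).trans (Real.le_coe_toNNReal C)⟩
    · exact ⟨0, fun h => absurd h hi⟩
  choose K hK using hp
  refine ⟨∑ i ∈ Finset.range n, K i, ?_⟩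
  rw [← h0, ← h1]
  exact lipschitzOnWith_of_pieces hc fun i hi =>
    (hK i hi).weaken (Finset.single_le_sum (f := K) (fun _ _ => zero_le) (Finset.mem_range.2 hi))

theorem PiecewiseC1.continuousOn {γ : ℝ → ℂ} (h : PiecewiseC1 γ) : ContinuousOn γ (Icc 0 1) :=
  h.exists_lipschitzOnWith.choose_spec.continuousOn

theorem eVariationOn_le_of_lipschitzOnWith {f : ℝ → ℂ} {a b : ℝ} {K : NNReal}
    (h : LipschitzOnWith K f (Icc a b)) : eVariationOn f (Icc a b) ≤ K * ENNReal.ofReal (b - a) := by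
  have := h.comp_eVariationOn_le (f := f) (g := id) (s := Icc a b) (mapsTo_id _)
  rwa [eVariationOn_id_Icc] at this

theorem pathLength_concat {γ₁ γ₂ : ℝ → ℂ} (h : γ₁ 1 = γ₂ 0) :
    pathLength (concat γ₁ γ₂) = pathLength γ₁ + pathLength γ₂ := by
  have e := eVariationOn.Icc_add_Icc (concat γ₁ γ₂) (s := univ) (a := 0) (b := 1 / 2) (c := 1)
    (by norm_num) (by norm_num) (mem_univ _)
  simp only [univ_inter] at e
  unfold pathLength
  rw [← e]
  congr 1
  · have := eVariationOn.comp_eq_of_monotoneOn γ₁ (t := Icc (0 : ℝ) (1 / 2)) (fun s => 2 * s)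
      (fun x _ y _ hxy => by dsimp only; linarith)
    rw [image_mul_left_Icc two_pos.le (by norm_num)] at this
    norm_num at this
    norm_num
    rw [← this]
    exact eVariationOn.congr fun s hs => concat_of_le (by norm_num; exact hs.2)
  · have := eVariationOn.comp_eq_of_monotoneOn γ₂ (t := Icc (1 / 2 : ℝ) 1) (fun s => 2 * s - 1)
      (fun x _ y _ hxy => by dsimp only; linarith)
    have im : (fun s : ℝ => 2 * s - 1) '' Icc (1 / 2 : ℝ) 1 = Icc 0 1 := by
      ext x
      constructor
      · rintro ⟨y, hy, rfl⟩
        constructor <;> dsimp only <;> linarith [hy.1, hy.2]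
      · intro hx
        exact ⟨(x + 1) / 2, ⟨by linarith [hx.1], by linarith [hx.2]⟩, by ring⟩
    rw [im] at this
    rw [← this]
    exact eVariationOn.congr fun s hs => concat_of_ge h hs.1

theorem pathLength_segPath (z w : ℂ) : pathLength (segPath z w) ≤ ENNReal.ofReal ‖w - z‖ := by
  have : LipschitzOnWith ‖w - z‖₊ (segPath z w) (Icc 0 1) :=
    lipschitzOnWith_of_hasDerivWithinAt (f' := fun _ => w - z)
      (fun s _ => (hasDerivAt_segPath z w s).hasDerivWithinAt) fun _ _ => le_rfl
  refine (eVariationOn_le_of_lipschitzOnWith this).trans ?_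
  simp [ofReal_norm, enorm_eq_nnnorm]

end Endless

namespace Endless

/-! ### Allowed paths -/

variable {ω : ℂ} {Ω : DiscreteFilteredSet ω}

theorem edist_le_pathLength (γ : ℝ → ℂ) {s t : ℝ} (hs : s ∈ Icc (0 : ℝ) 1)
    (ht : t ∈ Icc (0 : ℝ) 1) : edist (γ s) (γ t) ≤ pathLength γ :=
  eVariationOn.edist_le γ hs ht

theorem mem_ball_of_pathLength_lt {γ : ℝ → ℂ} {L : ℝ} (h0 : γ 0 = ω)
    (h : pathLength γ < ENNReal.ofReal L) {s : ℝ} (hs : s ∈ Icc (0 : ℝ) 1) :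
    γ s ∈ Metric.ball ω L := by
  have h1 := (edist_le_pathLength γ hs ⟨le_rfl, zero_le_one⟩).trans_lt h
  rw [h0, edist_dist] at h1
  exact (ENNReal.ofReal_lt_ofReal_iff_of_nonneg dist_nonneg).1 h1

theorem IsAllowedAt.pos {L : ℝ} {γ : ℝ → ℂ} (h : IsAllowedAt Ω L γ) : 0 < L := by
  by_contra hL
  have := h.length_lt
  rw [ENNReal.ofReal_of_nonpos (not_lt.1 hL)] at this
  exact not_lt_zero this

theorem isAllowedAt_of_notMem {L : ℝ} {γ : ℝ → ℂ} (h0 : γ 0 = ω) (hp : PiecewiseC1 γ)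
    (hl : pathLength γ < ENNReal.ofReal L) {t₀ : ℝ} (ht : t₀ ∈ Ico (0 : ℝ) 1)
    (h1 : ∀ s ∈ Icc 0 t₀, γ s = ω) (h2 : ∀ s ∈ Ioc t₀ 1, γ s ∉ Ω.pts L) : IsAllowedAt Ω L γ :=
  ⟨h0, hp, hl, Or.inr ⟨t₀, ht, h1, fun s hs =>
    ⟨mem_ball_of_pathLength_lt h0 hl ⟨ht.1.trans hs.1.le, hs.2⟩, h2 s hs⟩⟩⟩

theorem IsAllowedAt.exists_of_ne {L : ℝ} {γ : ℝ → ℂ} (h : IsAllowedAt Ω L γ) (hne : γ 1 ≠ ω) :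
    ∃ t₀ ∈ Ico (0 : ℝ) 1, (∀ s ∈ Icc 0 t₀, γ s = ω) ∧ ∀ s ∈ Ioc t₀ 1, γ s ∉ Ω.pts L := by
  rcases h.avoids with h | ⟨t₀, ht, h1, h2⟩
  · exact absurd (h 1 ⟨zero_le_one, le_rfl⟩) hne
  · exact ⟨t₀, ht, h1, fun s hs => (h2 s hs).2⟩

/-- Since `ω` belongs to every `Ω_L`, a path that has left `ω` never comes back to it. -/
theorem IsAllowedAt.eq_center {L : ℝ} {γ : ℝ → ℂ} (h : IsAllowedAt Ω L γ) (he : γ 1 = ω) :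
    ∀ s ∈ Icc (0 : ℝ) 1, γ s = ω := by
  rcases h.avoids with h' | ⟨t₀, ht, h1, h2⟩
  · exact h'
  · exact absurd (he ▸ Ω.center_mem h.pos) (h2 1 ⟨ht.2, le_rfl⟩).2

theorem PiecewiseC1.congr {γ γ' : ℝ → ℂ} (h : PiecewiseC1 γ) (he : EqOn γ' γ (Icc 0 1)) :
    PiecewiseC1 γ' :=
  (h.family.congr (G := fun s _ => γ' s) fun _ hs _ _ => he hs).piecewiseC1
    (t := 0) ⟨le_rfl, zero_le_one⟩

theorem IsAllowedAt.congr {L : ℝ} {γ γ' : ℝ → ℂ} (h : IsAllowedAt Ω L γ)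
    (he : EqOn γ' γ (Icc 0 1)) : IsAllowedAt Ω L γ' := by
  refine ⟨(he ⟨le_rfl, zero_le_one⟩).trans h.start, h.piecewiseC1.congr he, ?_, ?_⟩
  · unfold pathLength
    rw [eVariationOn.congr he]
    exact h.length_lt
  · rcases h.avoids with h1 | ⟨t₀, ht, h1, h2⟩
    · exact Or.inl fun s hs => (he hs).trans (h1 s hs)
    · refine Or.inr ⟨t₀, ht, fun s hs => ?_, fun s hs => ?_⟩
      · rw [he ⟨hs.1, hs.2.trans ht.2.le⟩, h1 s hs]
      · rw [he ⟨ht.1.trans hs.1.le, hs.2⟩]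
        exact h2 s hs

theorem IsAllowed.congr {γ γ' : ℝ → ℂ} (h : IsAllowed Ω γ) (he : EqOn γ' γ (Icc 0 1)) :
    IsAllowed Ω γ' :=
  let ⟨L, hL, h⟩ := h
  ⟨L, hL, h.congr he⟩

theorem IsAllowedAt.comp {L : ℝ} {γ : ℝ → ℂ} (h : IsAllowedAt Ω L γ) {μ : ℝ → ℝ}
    (hc : ContinuousOn μ (Icc 0 1)) (hm : MonotoneOn μ (Icc 0 1)) (h0 : μ 0 = 0) (h1 : μ 1 = 1)
    (hp : PiecewiseC1 (γ ∘ μ)) : IsAllowedAt Ω L (γ ∘ μ) := by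
  have z : (0 : ℝ) ∈ Icc (0 : ℝ) 1 := ⟨le_rfl, zero_le_one⟩
  have o : (1 : ℝ) ∈ Icc (0 : ℝ) 1 := ⟨zero_le_one, le_rfl⟩
  have hmaps : MapsTo μ (Icc 0 1) (Icc 0 1) := fun s hs =>
    ⟨h0 ▸ hm z hs hs.1, h1 ▸ hm hs o hs.2⟩
  refine ⟨by simp [h0, h.start], hp,
    (eVariationOn.comp_le_of_monotoneOn γ μ hm hmaps).trans_lt h.length_lt, ?_⟩
  rcases h.avoids with h' | ⟨t₀, ht, h2, h3⟩
  · exact Or.inl fun s hs => h' _ (hmaps hs)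
  · have hcpt : IsCompact (Icc (0 : ℝ) 1 ∩ μ ⁻¹' Iic t₀) :=
      isCompact_Icc.of_isClosed_subset (hc.preimage_isClosed_of_isClosed isClosed_Icc isClosed_Iic)
        inter_subset_left
    -- The new departure time is the last instant with `μ ≤ t₀`; it is smaller than `1` because `μ 1
    -- = 1 > t₀`.
    obtain ⟨t₁, ⟨ht₁, hle⟩, hmax⟩ := hcpt.exists_isGreatest ⟨0, z, by simp [h0, ht.1]⟩
    refine Or.inr ⟨t₁, ⟨ht₁.1, lt_of_le_of_ne ht₁.2 ?_⟩, fun s hs => ?_, fun s hs => ?_⟩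
    · rintro rfl
      rw [mem_preimage, h1] at hle
      exact absurd ht.2 (not_lt.2 hle)
    · have hs' : s ∈ Icc (0 : ℝ) 1 := ⟨hs.1, hs.2.trans ht₁.2⟩
      exact h2 _ ⟨(hmaps hs').1, (hm hs' ht₁ hs.2).trans hle⟩
    · have hs' : s ∈ Icc (0 : ℝ) 1 := ⟨ht₁.1.trans hs.1.le, hs.2⟩
      refine h3 _ ⟨?_, (hmaps hs').2⟩
      by_contra hcon
      exact absurd (hmax ⟨hs', not_lt.1 hcon⟩) (not_le.2 hs.1)

theorem IsAllowedAt.concat_segPath {L : ℝ} {γ : ℝ → ℂ} (h : IsAllowedAt Ω L γ) (hne : γ 1 ≠ ω)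
    {w : ℂ} (hl : pathLength γ + ENNReal.ofReal ‖w - γ 1‖ < ENNReal.ofReal L)
    (hs : Disjoint (segment ℝ (γ 1) w) (Ω.pts L)) :
    IsAllowedAt Ω L (concat γ (segPath (γ 1) w)) := by
  have hj : γ 1 = segPath (γ 1) w 0 := (segPath_zero _ _).symm
  obtain ⟨t₀, ht, h1, h2⟩ := h.exists_of_ne hne
  refine isAllowedAt_of_notMem (t₀ := t₀ / 2) ?_ (h.piecewiseC1.concat (piecewiseC1_segPath _ _) hj)
    ?_ ⟨by linarith [ht.1], by linarith [ht.2]⟩ (fun s hs => ?_) fun s hs' => ?_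
  · rw [concat_of_le (by norm_num), mul_zero, h.start]
  · rw [pathLength_concat hj]
    exact lt_of_le_of_lt (by gcongr; exact pathLength_segPath _ _) hl
  · rw [concat_of_le (by linarith [hs.2, ht.2])]
    exact h1 _ ⟨by linarith [hs.1], by linarith [hs.2]⟩
  · rcases le_total s (1 / 2) with hs2 | hs2
    · rw [concat_of_le hs2]
      exact h2 _ ⟨by linarith [hs'.1], by linarith⟩
    · rw [concat_of_ge hj hs2]
      exact disjoint_left.1 hs (segPath_mem_segment _ _ ⟨by linarith, by linarith [hs'.2]⟩)

theorem isAllowedAt_segPath {L : ℝ} {w : ℂ} (hw : ‖w - ω‖ < L)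
    (hs : Disjoint (segment ℝ ω w) (Ω.pts L \ {ω})) : IsAllowedAt Ω L (segPath ω w) := by
  have hl : pathLength (segPath ω w) < ENNReal.ofReal L :=
    (pathLength_segPath _ _).trans_lt
      ((ENNReal.ofReal_lt_ofReal_iff_of_nonneg (norm_nonneg _)).2 hw)
  rcases eq_or_ne ω w with rfl | hne
  · exact ⟨segPath_zero _ _, piecewiseC1_segPath _ _, hl, Or.inl fun s _ => segPath_self _ _⟩
  · refine isAllowedAt_of_notMem (segPath_zero _ _) (piecewiseC1_segPath _ _) hl (t₀ := 0)
      ⟨le_rfl, zero_lt_one⟩ (fun s hs => ?_) fun s hs' hmem => ?_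
    · rw [Icc_self, mem_singleton_iff] at hs
      rw [hs, segPath_zero]
    · refine disjoint_left.1 hs (segPath_mem_segment ω w ⟨hs'.1.le, hs'.2⟩) ⟨hmem, fun he => ?_⟩
      exact hs'.1.ne' ((segPath_eq_center hne).1 he)

/-! ### Classes of allowed paths -/

open Classical in
/-- The class of `γ` if `γ` is allowed, and the base point otherwise. -/
noncomputable def clOf (Ω : DiscreteFilteredSet ω) (γ : ℝ → ℂ) : Surface Ω :=
  if h : IsAllowed Ω γ then Surface.cl Ω ⟨γ, h⟩ else Surface.base Ω

theorem clOf_of_isAllowed {γ : ℝ → ℂ} (h : IsAllowed Ω γ) : clOf Ω γ = Surface.cl Ω ⟨γ, h⟩ :=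
  dif_pos h

theorem proj_clOf {γ : ℝ → ℂ} (h : IsAllowed Ω γ) : Surface.proj Ω (clOf Ω γ) = γ 1 := by
  rw [clOf_of_isAllowed h]
  rfl

theorem clOf_eq_of_family {H : ℝ → ℝ → ℂ}
    (hc : ContinuousOn (fun q : ℝ × ℝ => H q.1 q.2) (Icc 0 1 ×ˢ Icc 0 1))
    (hp : PiecewiseC1Family 0 1 H) (ha : ∀ t ∈ Icc (0 : ℝ) 1, IsAllowed Ω (fun s => H s t))
    (h1 : ∀ t ∈ Icc (0 : ℝ) 1, H 1 t = H 1 0) {γ₀ γ₁ : ℝ → ℂ}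
    (e₀ : ∀ s ∈ Icc (0 : ℝ) 1, γ₀ s = H s 0) (e₁ : ∀ s ∈ Icc (0 : ℝ) 1, γ₁ s = H s 1) :
    clOf Ω γ₀ = clOf Ω γ₁ := by
  have a0 : IsAllowed Ω γ₀ := (ha 0 ⟨le_rfl, zero_le_one⟩).congr e₀
  have a1 : IsAllowed Ω γ₁ := (ha 1 ⟨zero_le_one, le_rfl⟩).congr e₁
  rw [clOf_of_isAllowed a0, clOf_of_isAllowed a1]
  refine Quot.sound ⟨H, ⟨hc, hp, ha⟩, fun s hs => (e₀ s hs).symm, fun s hs => (e₁ s hs).symm,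
    fun t ht => (h1 t ht).trans (e₀ 1 ⟨zero_le_one, le_rfl⟩).symm⟩

theorem clOf_congr {γ₀ γ₁ : ℝ → ℂ} (h : IsAllowed Ω γ₀) (he : EqOn γ₁ γ₀ (Icc 0 1)) :
    clOf Ω γ₀ = clOf Ω γ₁ := by
  obtain ⟨L, -, hL⟩ := id h
  exact clOf_eq_of_family (H := fun s _ => γ₀ s)
    (hL.piecewiseC1.continuousOn.comp continuousOn_fst fun x hx => hx.1)
    hL.piecewiseC1.family (fun _ _ => h) (fun _ _ => rfl) (fun _ _ => rfl) he

/-! ### Reparametrisation -/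

/-- The transition function of the piece `[a,b]`, locally constant outside of `(a,b)`. -/
noncomputable def pieceTransition (a b s : ℝ) : ℝ :=
  (b - a) * Real.smoothTransition (2 * ((s - a) / (b - a)) - 1 / 2)

theorem pieceTransition_eventuallyEq_left {a b s : ℝ} (hab : a ≤ b) (hs : s ≤ a) :
    ∀ᶠ x in 𝓝 s, pieceTransition a b x = 0 := by
  rcases hab.eq_or_lt with rfl | hab
  · simp [pieceTransition]
  · have : ∀ᶠ x in 𝓝 s, x < a + (b - a) / 4 := by
      apply Iio_mem_nhds
      linarith
    filter_upwards [this] with x hx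
    unfold pieceTransition
    rw [Real.smoothTransition.zero_of_nonpos, mul_zero]
    have : (x - a) / (b - a) ≤ 1 / 4 := by
      rw [div_le_iff₀ (by linarith)]
      linarith
    linarith

theorem pieceTransition_eventuallyEq_right {a b s : ℝ} (hab : a ≤ b) (hs : b ≤ s) :
    ∀ᶠ x in 𝓝 s, pieceTransition a b x = b - a := by
  rcases hab.eq_or_lt with rfl | hab
  · simp [pieceTransition]
  · have : ∀ᶠ x in 𝓝 s, b - (b - a) / 4 < x := by
      apply Ioi_mem_nhds
      linarith
    filter_upwards [this] with x hx
    unfold pieceTransition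
    rw [Real.smoothTransition.one_of_one_le, mul_one]
    have : 3 / 4 ≤ (x - a) / (b - a) := by
      rw [le_div_iff₀ (by linarith)]
      linarith
    linarith

theorem contDiff_pieceTransition (a b : ℝ) : ContDiff ℝ 1 (pieceTransition a b) := by
  have h : ContDiff ℝ 1 Real.smoothTransition := Real.smoothTransition.contDiff (n := 1)
  unfold pieceTransition
  refine contDiff_const.mul (h.comp ?_)
  fun_prop

theorem monotone_pieceTransition {a b : ℝ} (hab : a ≤ b) : Monotone (pieceTransition a b) := by
  intro x y hxy
  unfold pieceTransition
  have : 0 ≤ b - a := by linarith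
  refine mul_le_mul_of_nonneg_left (Real.smoothTransition.monotone ?_) this
  gcongr

theorem pieceTransition_mem (a b s : ℝ) (hab : a ≤ b) : pieceTransition a b s ∈ Icc 0 (b - a) := by
  have : 0 ≤ b - a := by linarith
  exact ⟨mul_nonneg this (Real.smoothTransition.nonneg _),
    mul_le_of_le_one_right this (Real.smoothTransition.le_one _)⟩

/-- A smooth reparametrisation of `[0,1]` that stops at the breakpoints `c 0, …, c n`. -/
noncomputable def flatten (c : ℕ → ℝ) (n : ℕ) (s : ℝ) : ℝ :=
  ∑ i ∈ Finset.range n, pieceTransition (c i) (c (i + 1)) s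

section flatten

variable {c : ℕ → ℝ} {n : ℕ}

theorem contDiff_flatten (c : ℕ → ℝ) (n : ℕ) : ContDiff ℝ 1 (flatten c n) :=
  ContDiff.sum fun i _ => contDiff_pieceTransition (c i) (c (i + 1))

theorem monotone_flatten (hc : Monotone c) : Monotone (flatten c n) := fun _ _ h =>
  Finset.sum_le_sum fun i _ => monotone_pieceTransition (hc (Nat.le_succ i)) h

theorem flatten_eq (hc : Monotone c) (h0 : c 0 = 0) {i : ℕ} (hi : i < n) {s : ℝ}
    (hs : s ∈ Icc (c i) (c (i + 1))) :
    flatten c n s = c i + pieceTransition (c i) (c (i + 1)) s := by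
  have hl : ∀ j < i, pieceTransition (c j) (c (j + 1)) s = c (j + 1) - c j := fun j hj =>
    (pieceTransition_eventuallyEq_right (hc (Nat.le_succ j)) ((hc hj).trans hs.1)).self_of_nhds
  have hr : ∀ j, i < j → pieceTransition (c j) (c (j + 1)) s = 0 := fun j hj =>
    (pieceTransition_eventuallyEq_left (hc (Nat.le_succ j)) (hs.2.trans (hc hj))).self_of_nhds
  unfold flatten
  rw [← Finset.sum_range_add_sum_Ico _ (Nat.succ_le_of_lt hi), Finset.sum_range_succ,
    Finset.sum_congr rfl fun j hj => hl j (Finset.mem_range.1 hj), Finset.sum_range_sub, h0,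
    Finset.sum_eq_zero fun j hj => hr j (Finset.mem_Ico.1 hj).1]
  ring

theorem flatten_mem (hc : Monotone c) (h0 : c 0 = 0) {i : ℕ} (hi : i < n) {s : ℝ}
    (hs : s ∈ Icc (c i) (c (i + 1))) : flatten c n s ∈ Icc (c i) (c (i + 1)) := by
  have := pieceTransition_mem (c i) (c (i + 1)) s (hc (Nat.le_succ i))
  rw [flatten_eq hc h0 hi hs]
  constructor <;> linarith [this.1, this.2]

theorem flatten_of_nonpos (hc : Monotone c) (h0 : c 0 = 0) {s : ℝ} (hs : s ≤ 0) :
    flatten c n s = 0 :=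
  Finset.sum_eq_zero fun i _ => (pieceTransition_eventuallyEq_left (hc (Nat.le_succ i))
    (hs.trans (h0 ▸ hc (Nat.zero_le i)))).self_of_nhds

theorem flatten_of_one_le (hc : Monotone c) (h0 : c 0 = 0) (h1 : c n = 1) {s : ℝ} (hs : 1 ≤ s) :
    flatten c n s = 1 := by
  unfold flatten
  rw [Finset.sum_congr rfl fun i hi => (pieceTransition_eventuallyEq_right (hc (Nat.le_succ i))
    ((hc (Finset.mem_range.1 hi)).trans (h1.le.trans hs))).self_of_nhds, Finset.sum_range_sub, h0,
    h1, sub_zero]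

theorem flatten_eventuallyEq (hc : Monotone c) {s : ℝ}
    (hs : ∀ i < n, s ∉ Ioo (c i) (c (i + 1))) : ∀ᶠ x in 𝓝 s, flatten c n x = flatten c n s := by
  have : ∀ᶠ x in 𝓝 s, ∀ i ∈ Finset.range n,
      pieceTransition (c i) (c (i + 1)) x = pieceTransition (c i) (c (i + 1)) s := by
    rw [Filter.eventually_all_finset]
    intro i hi
    have h := hs i (Finset.mem_range.1 hi)
    rw [mem_Ioo, not_and_or, not_lt, not_lt] at h
    rcases h with h | h
    · have e := pieceTransition_eventuallyEq_left (hc (Nat.le_succ i)) h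
      exact e.mono fun x hx => hx.trans e.self_of_nhds.symm
    · have e := pieceTransition_eventuallyEq_right (hc (Nat.le_succ i)) h
      exact e.mono fun x hx => hx.trans e.self_of_nhds.symm
  exact this.mono fun x hx => Finset.sum_congr rfl hx

/-- Inside a piece this is a composition of `C¹` maps; at a breakpoint `flatten` is locally
constant, so the corners of `γ` disappear. -/
theorem contDiff_comp_flatten (hc : Monotone c) (h0 : c 0 = 0) {γ : ℝ → ℂ}
    (h : ∀ i < n, ContDiffOn ℝ 1 γ (Icc (c i) (c (i + 1)))) :
    ContDiff ℝ 1 (γ ∘ flatten c n) := by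
  rw [contDiff_iff_contDiffAt]
  intro s
  by_cases hs : ∃ i < n, s ∈ Ioo (c i) (c (i + 1))
  · obtain ⟨i, hi, hs⟩ := hs
    exact ((h i hi).comp (contDiff_flatten c n).contDiffOn fun x hx =>
      flatten_mem hc h0 hi hx).contDiffAt (Icc_mem_nhds hs.1 hs.2)
  · push Not at hs
    refine (contDiffAt_const (c := γ (flatten c n s))).congr_of_eventuallyEq ?_
    filter_upwards [flatten_eventuallyEq hc hs] with x hx
    simp [hx]

end flatten

theorem IsAllowedAt.concat_const {L : ℝ} {γ : ℝ → ℂ} (h : IsAllowedAt Ω L γ) :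
    IsAllowedAt Ω L (concat γ (fun _ => γ 1)) := by
  have e : EqOn (concat γ (fun _ => γ 1)) (γ ∘ fun s => min (2 * s) 1) (Icc 0 1) := by
    intro s hs
    rcases le_total s (1 / 2) with h' | h'
    · rw [concat_of_le h', Function.comp, min_eq_left (by linarith)]
    · rw [concat_of_ge rfl h', Function.comp, min_eq_right (by linarith)]
  have hp : PiecewiseC1 (concat γ fun _ => γ 1) := by
    refine h.piecewiseC1.concat ?_ rfl
    exact (piecewiseC1_segPath (γ 1) (γ 1)).congr fun s _ => (segPath_self _ _).symm
  refine (h.comp (by fun_prop) (fun x _ y _ hxy => ?_) (by norm_num) (by norm_num)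
    (hp.congr e.symm)).congr e
  gcongr

/-- The breakpoints of an `Ω`-homotopy in `s` must not depend on `t`, whereas a linear change of
parameter would slide the corners of `γ`. So `γ` is first deformed, piece by piece, into the `C¹`
path `g = γ ∘ θ`; then `g` can be reparametrised without restriction, and the first deformation is
undone on the first half of the product. -/
theorem clOf_concat_const {γ : ℝ → ℂ} (h : IsAllowed Ω γ) :
    clOf Ω (concat γ (fun _ => γ 1)) = clOf Ω γ := by
  obtain ⟨L, hL, h⟩ := h
  obtain ⟨n, c, hc, h0, h1, hγ⟩ := id h.piecewiseC1
  obtain ⟨n', c', hc', h0', h1', hf⟩ := h.piecewiseC1.family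
  have hγc := h.piecewiseC1.continuousOn
  set θ := flatten c n with hθ
  have hθc : ContDiff ℝ 1 θ := contDiff_flatten c n
  have hθm : Monotone θ := monotone_flatten hc
  have hθ0 : ∀ s ≤ 0, θ s = 0 := fun s hs => flatten_of_nonpos hc h0 hs
  have hθ1 : ∀ s, 1 ≤ s → θ s = 1 := fun s hs => flatten_of_one_le hc h0 h1 hs
  have hmaps : ∀ s ∈ Icc (0 : ℝ) 1, θ s ∈ Icc (0 : ℝ) 1 := fun s hs =>
    ⟨hθ0 0 le_rfl ▸ hθm hs.1, hθ1 1 le_rfl ▸ hθm hs.2⟩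
  set g := γ ∘ θ with hg
  have hgc : ContDiff ℝ 1 g := contDiff_comp_flatten hc h0 hγ
  have hgd : Continuous (deriv g) := hgc.continuous_deriv le_rfl
  have hg1 : g 1 = γ 1 := by simp [hg, hθ1]
  let ν : ℝ → ℝ → ℝ := fun s t => (1 - t) * s + t * θ s
  have hν : ∀ t ∈ Icc (0 : ℝ) 1, Monotone fun s => ν s t := fun t ht x y hxy =>
    add_le_add (mul_le_mul_of_nonneg_left hxy (by linarith [ht.2]))
      (mul_le_mul_of_nonneg_left (hθm hxy) ht.1)
  have hν0 : ∀ t, ν 0 t = 0 := fun t => by simp [ν, hθ0]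
  have hν1 : ∀ t, ν 1 t = 1 := fun t => by simp [ν, hθ1]
  have hνc : Continuous fun q : ℝ × ℝ => ν q.1 q.2 := by
    have := hθc.continuous
    fun_prop
  let H₁ : ℝ → ℝ → ℂ := fun s t => γ (ν s t)
  have hH₁ : PiecewiseC1Family 0 1 H₁ := by
    refine ⟨n, c, hc, h0, h1, fun i hi => ?_⟩
    rcases (hc (Nat.le_succ i)).eq_or_lt with he | hlt
    · refine ⟨fun _ => 0, continuousOn_const, fun s hs t _ => ?_⟩
      rw [Nat.succ_eq_add_one] at he
      rw [he, Icc_self] at hs ⊢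
      rw [mem_singleton_iff.1 hs]
      exact (hasFDerivWithinAt_singleton _ _).hasDerivWithinAt.congr_deriv (by simp)
    · obtain ⟨hd, hcd⟩ := (contDiffOn_one_iff_derivWithin (uniqueDiffOn_Icc hlt)).1 (hγ i hi)
      have hm : ∀ s ∈ Icc (c i) (c (i + 1)), ∀ t ∈ Icc (0 : ℝ) 1,
          ν s t ∈ Icc (c i) (c (i + 1)) := fun s hs t ht =>
        convex_Icc _ _ hs (flatten_mem hc h0 hi hs) (by linarith [ht.2]) ht.1 (by ring)
      refine ⟨fun x => ((1 - x.2) + x.2 * deriv θ x.1) •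
        derivWithin γ (Icc (c i) (c (i + 1))) (ν x.1 x.2), ?_, fun s hs t ht => ?_⟩
      · have := hθc.continuous_deriv le_rfl
        refine ContinuousOn.smul (f := fun x : ℝ × ℝ => (1 - x.2) + x.2 * deriv θ x.1)
          (by fun_prop) (hcd.comp hνc.continuousOn ?_)
        rintro ⟨s, t⟩ ⟨hs, ht⟩
        exact hm s hs t ht
      · have hν' : HasDerivAt (fun s => ν s t) ((1 - t) + t * deriv θ s) s := by
          have := (((hasDerivAt_id s).const_mul (1 - t)).add
            (((hθc.differentiable one_ne_zero).differentiableAt (x := s)).hasDerivAt.const_mul t))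
          rw [mul_one] at this
          exact this
        exact (hd _ (hm s hs t ht)).hasDerivWithinAt.scomp s hν'.hasDerivWithinAt
          fun x hx => hm x hx t ht
  have hH₁a : ∀ t ∈ Icc (0 : ℝ) 1, IsAllowedAt Ω L fun s => H₁ s t := fun t ht =>
    h.comp (μ := fun s => ν s t)
      (hνc.comp (f := fun s : ℝ => (s, t)) (by fun_prop)).continuousOn
      ((hν t ht).monotoneOn _) (hν0 t) (hν1 t) (hH₁.piecewiseC1 ht)
  have hνmaps : ∀ t ∈ Icc (0 : ℝ) 1, ∀ s ∈ Icc (0 : ℝ) 1, ν s t ∈ Icc (0 : ℝ) 1 :=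
    fun t ht s hs => convex_Icc _ _ hs (hmaps s hs) (by linarith [ht.2]) ht.1 (by ring)
  have hH₁c : ContinuousOn (fun q : ℝ × ℝ => H₁ q.1 q.2) (Icc 0 1 ×ˢ Icc 0 1) :=
    hγc.comp hνc.continuousOn fun q hq => hνmaps _ hq.2 _ hq.1
  have e₁ : clOf Ω γ = clOf Ω g :=
    clOf_eq_of_family hH₁c hH₁ (fun t ht => ⟨L, hL, hH₁a t ht⟩)
      (fun t _ => by simp only [H₁, hν1]) (fun s _ => by simp [H₁, ν])
      (fun s _ => by simp [H₁, ν, hg])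
  have hgmaps : IsAllowedAt Ω L g := (hH₁a 1 ⟨zero_le_one, le_rfl⟩).congr
    fun s _ => by simp [H₁, ν, hg]
  -- This goes from the identity to `min (2 * s) 1`. As `g` is `C¹`, the only corner left is that of
  -- `μ` at `s = 1 / 2`, which does not move with `t`.
  let μ : ℝ → ℝ → ℝ := fun s t => (1 - t) * s + t * min (2 * s) 1
  have hμc : Continuous fun q : ℝ × ℝ => μ q.1 q.2 := by fun_prop
  have hH₂ : PiecewiseC1Family 0 1 fun s t => g (μ s t) := by
    have d : ∀ s, HasDerivAt g (deriv g s) s := fun s =>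
      ((hgc.differentiable one_ne_zero).differentiableAt (x := s)).hasDerivAt
    have f₁ : PiecewiseC1Family 0 (1 / 2) fun s t => g ((1 + t) * s) := by
      refine piecewiseC1Family_of_hasDerivAt
        (H' := fun x => (1 + x.2) • deriv g ((1 + x.2) * x.1)) (by norm_num)
        (by fun_prop) fun s _ t _ => ?_
      have : HasDerivAt (fun s : ℝ => (1 + t) * s) (1 + t) s := by
        simpa using (hasDerivAt_id s).const_mul (1 + t)
      exact ((d _).scomp s this).hasDerivWithinAt
    have f₂ : PiecewiseC1Family (1 / 2) 1 fun s t => g ((1 - t) * s + t) := by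
      refine piecewiseC1Family_of_hasDerivAt
        (H' := fun x => (1 - x.2) • deriv g ((1 - x.2) * x.1 + x.2)) (by norm_num)
        (by fun_prop) fun s _ t _ => ?_
      have : HasDerivAt (fun s : ℝ => (1 - t) * s + t) (1 - t) s := by
        simpa using ((hasDerivAt_id s).const_mul (1 - t)).add_const t
      exact ((d _).scomp s this).hasDerivWithinAt
    refine (f₁.congr fun s hs t _ => ?_).append (f₂.congr fun s hs t _ => ?_)
    · simp only [μ]
      rw [min_eq_left (by linarith [hs.2])]
      ring_nf
    · simp only [μ]
      rw [min_eq_right (by linarith [hs.1]), mul_one]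
  have e₂ : clOf Ω g = clOf Ω (concat g fun _ => γ 1) := by
    refine clOf_eq_of_family (H := fun s t => g (μ s t))
      (hgc.continuous.comp hμc).continuousOn hH₂ (fun t ht => ⟨L, hL, ?_⟩) (fun t _ => ?_)
      (fun s _ => by simp [μ]) fun s hs => ?_
    · refine hgmaps.comp (μ := fun s => μ s t)
        (hμc.comp (f := fun s : ℝ => (s, t)) (by fun_prop)).continuousOn
        (fun x _ y _ hxy => ?_) (by simp [μ]) (by simp [μ]) (hH₂.piecewiseC1 ht)
      refine add_le_add (mul_le_mul_of_nonneg_left hxy (by linarith [ht.2]))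
        (mul_le_mul_of_nonneg_left ?_ ht.1)
      gcongr
    · simp [μ]
    · rcases le_total s (1 / 2) with h' | h'
      · rw [concat_of_le h']
        simp [μ, min_eq_left (show 2 * s ≤ 1 by linarith)]
      · rw [concat_of_ge hg1 h']
        simp [μ, min_eq_right (show 1 ≤ 2 * s by linarith), hg1]
  have e₃ : clOf Ω (concat γ fun _ => γ 1) = clOf Ω (concat g fun _ => γ 1) := by
    have hconst : PiecewiseC1Family 0 1 fun _ _ => γ 1 :=
      (piecewiseC1Family_segPath (z := fun _ => γ 1) (w := fun _ => γ 1) continuous_const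
        continuous_const).congr fun s _ t _ => (segPath_self _ _).symm
    have hend : ∀ t, H₁ 1 t = γ 1 := fun t => by simp only [H₁, hν1]
    have hform : ∀ t, ∀ s, concat (fun σ => H₁ σ t) (fun _ => γ 1) s = H₁ (min (2 * s) 1) t := by
      intro t s
      rcases le_total s (1 / 2) with h' | h'
      · rw [concat_of_le h', min_eq_left (by linarith)]
      · rw [concat_of_ge (hend t) h', min_eq_right (by linarith), hend]
    refine clOf_eq_of_family (H := fun s t => concat (fun σ => H₁ σ t) (fun _ => γ 1) s) ?_
      (hH₁.concat hconst fun t _ => hend t) (fun t ht => ⟨L, hL, ?_⟩) (fun t _ => ?_)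
      (fun s _ => ?_) fun s _ => ?_
    · simp only [hform]
      refine hH₁c.comp (f := fun q : ℝ × ℝ => (min (2 * q.1) 1, q.2)) (by fun_prop) ?_
      rintro ⟨s, t⟩ ⟨hs, ht⟩
      exact ⟨⟨le_min (by linarith [hs.1]) zero_le_one, min_le_right _ _⟩, ht⟩
    · have := (hH₁a t ht).concat_const
      rwa [hend] at this
    · simp only [hform]
      norm_num [hend]
    · simp [H₁, ν]
    · simp [H₁, ν, hg, Function.comp_def]
  rw [e₃, ← e₂, ← e₁]

end Endless

namespace Endless

variable {ω : ℂ} {Ω : DiscreteFilteredSet ω}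

/-! ### Prolongation of homotopies by segments -/

theorem concat_zero (γ₁ γ₂ : ℝ → ℂ) : concat γ₁ γ₂ 0 = γ₁ 0 := by
  rw [concat_of_le (by norm_num), mul_zero]

theorem concat_one (γ₁ γ₂ : ℝ → ℂ) : concat γ₁ γ₂ 1 = γ₂ 1 := by
  rw [concat, if_neg (by norm_num)]
  norm_num

theorem continuousOn_concat {X : Type*} [TopologicalSpace X] {T : Set X} {H G : ℝ → X → ℂ}
    (hH : ContinuousOn (fun q : ℝ × X => H q.1 q.2) (Icc 0 1 ×ˢ T))
    (hG : ContinuousOn (fun q : ℝ × X => G q.1 q.2) (Icc 0 1 ×ˢ T))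
    (h : ∀ t ∈ T, H 1 t = G 0 t) :
    ContinuousOn (fun q : ℝ × X => concat (fun σ => H σ q.2) (fun σ => G σ q.2) q.1)
      (Icc 0 1 ×ˢ T) := by
  have h1 : ContinuousOn (fun q : ℝ × X => H (2 * q.1) q.2) (Icc 0 (1 / 2) ×ˢ T) :=
    hH.comp (f := fun q : ℝ × X => (2 * q.1, q.2)) (by fun_prop) fun q hq =>
      ⟨⟨by linarith [hq.1.1], by linarith [hq.1.2]⟩, hq.2⟩
  have h2 : ContinuousOn (fun q : ℝ × X => G (2 * q.1 - 1) q.2) (Icc (1 / 2) 1 ×ˢ T) :=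
    hG.comp (f := fun q : ℝ × X => (2 * q.1 - 1, q.2)) (by fun_prop) fun q hq =>
      ⟨⟨by linarith [hq.1.1], by linarith [hq.1.2]⟩, hq.2⟩
  have c1 : IsClosed {q : ℝ × X | q.1 ≤ 1 / 2} := isClosed_le continuous_fst continuous_const
  have c2 : IsClosed {q : ℝ × X | 1 / 2 ≤ q.1} := isClosed_le continuous_const continuous_fst
  rintro ⟨s, t⟩ ⟨hs, ht⟩
  have hcov : (Icc (0 : ℝ) 1 ×ˢ T) ⊆ (Icc 0 (1 / 2) ×ˢ T) ∪ (Icc (1 / 2) 1 ×ˢ T) := by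
    rintro ⟨x, y⟩ ⟨hx, hy⟩
    rcases le_total x (1 / 2) with h' | h'
    · exact Or.inl ⟨⟨hx.1, h'⟩, hy⟩
    · exact Or.inr ⟨⟨h', hx.2⟩, hy⟩
  refine ContinuousWithinAt.mono ?_ hcov
  refine ContinuousWithinAt.union ?_ ?_
  · by_cases hs2 : s ≤ 1 / 2
    · exact (h1 (s, t) ⟨⟨hs.1, hs2⟩, ht⟩).congr (fun q hq => concat_of_le hq.1.2)
        (concat_of_le hs2)
    · refine continuousWithinAt_of_notMem_closure fun hmem => hs2 ?_
      exact (closure_minimal (fun q hq => hq.1.2) c1 : _ ⊆ {q : ℝ × X | q.1 ≤ 1 / 2}) hmem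
  · by_cases hs2 : 1 / 2 ≤ s
    · exact (h2 (s, t) ⟨⟨hs2, hs.2⟩, ht⟩).congr (fun q hq => concat_of_ge (h _ hq.2) hq.1.1)
        (concat_of_ge (h _ ht) hs2)
    · refine continuousWithinAt_of_notMem_closure fun hmem => hs2 ?_
      exact (closure_minimal (fun q hq => hq.1.1) c2 : _ ⊆ {q : ℝ × X | 1 / 2 ≤ q.1}) hmem

theorem eventually_forall_dist_lt {F : ℝ × ℝ → ℂ} {K T : Set ℝ} (hK : IsCompact K)
    (hT : IsCompact T) (hF : ContinuousOn F (K ×ˢ T)) {ε : ℝ} (hε : 0 < ε) {t : ℝ} (ht : t ∈ T) :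
    ∀ᶠ t' in 𝓝[T] t, ∀ s ∈ K, dist (F (s, t')) (F (s, t)) < ε := by
  have hu := (hK.prod hT).uniformContinuousOn_of_continuous hF
  rw [Metric.uniformContinuousOn_iff] at hu
  obtain ⟨δ, hδ, hu⟩ := hu ε hε
  filter_upwards [self_mem_nhdsWithin, nhdsWithin_le_nhds (Metric.ball_mem_nhds t hδ)]
    with t' ht' hd s hs
  refine hu _ ⟨hs, ht'⟩ _ ⟨hs, ht⟩ ?_
  rw [Prod.dist_eq, dist_self]
  exact max_lt hδ hd

theorem eVariationOn_le_add (f g : ℝ → ℂ) (s : Set ℝ) :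
    eVariationOn f s ≤ eVariationOn g s + eVariationOn (fun x => f x - g x) s := by
  refine iSup_le fun ⟨n, u, hu, hs⟩ => ?_
  refine le_trans ?_ (add_le_add (eVariationOn.sum_le (n := n) hu hs)
    (eVariationOn.sum_le (n := n) hu hs))
  rw [← Finset.sum_add_distrib]
  refine Finset.sum_le_sum fun i _ => ?_
  have h := edist_add_add_le (g (u (i + 1))) (f (u (i + 1)) - g (u (i + 1))) (g (u i))
    (f (u i) - g (u i))
  rwa [add_sub_cancel, add_sub_cancel] at h

/-- The derivative in `s` is uniformly continuous on each compact piece, so the difference of two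
neighbouring paths is Lipschitz with a small constant and has a small length. -/
theorem PiecewiseC1Family.eventually_pathLength_le {H : ℝ → ℝ → ℂ} (h : PiecewiseC1Family 0 1 H)
    {ε : NNReal} (hε : 0 < ε) {t : ℝ} (ht : t ∈ Icc (0 : ℝ) 1) :
    ∀ᶠ t' in 𝓝[Icc 0 1] t,
      pathLength (fun s => H s t') ≤ pathLength (fun s => H s t) + ε := by
  obtain ⟨n, c, hc, h0, h1, h⟩ := h
  have key : ∀ i ∈ Finset.range n, ∀ᶠ t' in 𝓝[Icc 0 1] t,
      LipschitzOnWith ε (fun s => H s t' - H s t) (Icc (c i) (c (i + 1))) := by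
    intro i hi
    obtain ⟨H', hcH, hd⟩ := h i (Finset.mem_range.1 hi)
    filter_upwards [eventually_forall_dist_lt isCompact_Icc isCompact_Icc hcH
      (NNReal.coe_pos.2 hε) ht, self_mem_nhdsWithin] with t' ht' hI
    refine lipschitzOnWith_of_hasDerivWithinAt
      (fun s hs => (hd s hs t' hI).sub (hd s hs t ht)) fun s hs => ?_
    rw [← dist_eq_norm]
    exact (ht' s hs).le
  filter_upwards [(Filter.eventually_all_finset _).2 key] with t' ht'
  have hl := lipschitzOnWith_of_pieces hc fun i hi => ht' i (Finset.mem_range.2 hi)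
  rw [h0, h1] at hl
  refine (eVariationOn_le_add _ (fun s => H s t) _).trans ?_
  unfold pathLength
  gcongr
  simpa using eVariationOn_le_of_lipschitzOnWith hl

/-- One level `L` serves for all times close to `t` and leaves room for a prolongation by `r`: the
length is upper semicontinuous in time, and avoiding the finite set `Ω_L \ {ω}` is an open condition
on a compact path. -/
theorem IsAllowedHomotopy.eventually_isAllowedAt {H : ℝ → ℝ → ℂ} (h : IsAllowedHomotopy Ω H)
    {z : ℂ} (hz : z ≠ ω) (h1 : ∀ t ∈ Icc (0 : ℝ) 1, H 1 t = z) {t : ℝ}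
    (ht : t ∈ Icc (0 : ℝ) 1) :
    ∃ L r : ℝ, 0 < r ∧ Disjoint (Metric.ball z r) (Ω.pts L) ∧ ∀ᶠ t' in 𝓝[Icc 0 1] t,
      IsAllowedAt Ω L (fun s => H s t') ∧
        pathLength (fun s => H s t') + ENNReal.ofReal r < ENNReal.ofReal L := by
  obtain ⟨L, hL, hA⟩ := h.allowed t ht
  have hfam : PiecewiseC1Family 0 1 H := h.deriv_continuous
  have hfin := Ω.finite_pts L hL
  obtain ⟨t₀, ht₀, hc0, hav⟩ := hA.exists_of_ne (by rw [h1 t ht]; exact hz)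
  have hzL : z ∉ Ω.pts L := by
    have := hav 1 ⟨ht₀.2, le_rfl⟩
    rwa [h1 t ht] at this
  obtain ⟨r₁, hr₁, hb⟩ := Metric.mem_nhds_iff.1 (hfin.isClosed.isOpen_compl.mem_nhds hzL)
  obtain ⟨ε, hε, hlt⟩ : ∃ ε : NNReal, 0 < ε ∧
      pathLength (fun s => H s t) + ε + ε < ENNReal.ofReal L := by
    obtain ⟨ε, hε, h2⟩ := ENNReal.lt_iff_exists_add_pos_lt.1 hA.length_lt
    refine ⟨ε / 2, half_pos hε, ?_⟩
    rwa [add_assoc, ← ENNReal.coe_add, add_halves]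
  refine ⟨L, min r₁ ε, lt_min hr₁ hε, ?_, ?_⟩
  · exact disjoint_left.2 fun x hx => hb (Metric.ball_subset_ball (min_le_left _ _) hx)
  have him : IsCompact ((fun s => H s t) '' Icc 0 1) :=
    isCompact_Icc.image_of_continuousOn hA.piecewiseC1.continuousOn
  have hdis : Disjoint ((fun s => H s t) '' Icc 0 1) (Ω.pts L \ {ω}) := by
    rw [disjoint_left]
    rintro _ ⟨s, hs, rfl⟩ ⟨hm, hne⟩
    rcases le_or_gt s t₀ with h' | h'
    · exact hne (hc0 s ⟨hs.1, h'⟩)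
    · exact hav s ⟨h', hs.2⟩ hm
  obtain ⟨δ, hδ, hthick⟩ := hdis.exists_thickenings him (hfin.subset sdiff_subset).isClosed
  filter_upwards [hfam.eventually_pathLength_le hε ht, self_mem_nhdsWithin,
    eventually_forall_dist_lt isCompact_Icc isCompact_Icc h.continuousOn hδ ht] with t' hl hI hd
  have hlen : pathLength (fun s => H s t') + ENNReal.ofReal (min r₁ ε) < ENNReal.ofReal L := by
    refine lt_of_le_of_lt (add_le_add hl ?_) hlt
    rw [← ENNReal.ofReal_coe_nnreal]
    exact ENNReal.ofReal_le_ofReal (min_le_right _ _)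
  refine ⟨?_, hlen⟩
  -- Not returning to `ω` is no open condition. It is taken from the level `L'` at which the path at
  -- time `t'` is itself allowed.
  obtain ⟨L', hL', hA'⟩ := h.allowed t' hI
  obtain ⟨t₁, ht₁, hc1, hav1⟩ := hA'.exists_of_ne (by rw [h1 t' hI]; exact hz)
  refine isAllowedAt_of_notMem hA'.start hA'.piecewiseC1 (lt_of_le_of_lt le_self_add hlen) ht₁ hc1
    fun s hs hm => ?_
  have hsI : s ∈ Icc (0 : ℝ) 1 := ⟨ht₁.1.trans hs.1.le, hs.2⟩
  have hne : H s t' ≠ ω := fun he => hav1 s hs (he ▸ Ω.center_mem hL')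
  refine disjoint_left.1 hthick (Metric.mem_thickening_iff.2 ⟨H s t, ⟨s, hsI, rfl⟩, hd s hsI⟩)
    (Metric.self_subset_thickening hδ _ ⟨hm, hne⟩)

theorem segment_subset_ball {z w : ℂ} {r : ℝ} (hw : w ∈ Metric.ball z r) :
    segment ℝ z w ⊆ Metric.ball z r :=
  (convex_ball z r).segment_subset (Metric.mem_ball_self (Metric.pos_of_mem_ball hw)) hw

theorem IsAllowedAt.concat_segPath_of_mem_ball {L r : ℝ} {γ : ℝ → ℂ} (h : IsAllowedAt Ω L γ) {z : ℂ}
    (hγz : γ 1 = z) (hz : z ≠ ω) (hl : pathLength γ + ENNReal.ofReal r < ENNReal.ofReal L)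
    (hs : Disjoint (Metric.ball z r) (Ω.pts L)) {w : ℂ} (hw : w ∈ Metric.ball z r) :
    IsAllowedAt Ω L (concat γ (segPath z w)) := by
  subst hγz
  refine h.concat_segPath hz (lt_of_le_of_lt ?_ hl)
    (hs.mono_left (segment_subset_ball hw))
  gcongr
  exact (mem_ball_iff_norm.1 hw).le

/-- The whole homotopy is prolonged by the segment `[z, w]`. The radius within which this is allowed
is locally bounded below in `t`, so compactness of `[0,1]` provides a common one. -/
theorem AllowedHomotopic.eventually_clOf {α β : AllowedPath Ω} (h : AllowedHomotopic Ω α β)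
    (hz : α.1 1 ≠ ω) : ∀ᶠ w in 𝓝 (α.1 1), IsAllowed Ω (concat α.1 (segPath (α.1 1) w)) ∧
      IsAllowed Ω (concat β.1 (segPath (α.1 1) w)) ∧
      clOf Ω (concat α.1 (segPath (α.1 1) w)) = clOf Ω (concat β.1 (segPath (α.1 1) w)) := by
  obtain ⟨H, hH, e0, e1, h1⟩ := h
  set z := α.1 1 with hzdef
  have hloc : ∀ t ∈ Icc (0 : ℝ) 1, ∃ r : ℝ, 0 < r ∧ ∀ᶠ t' in 𝓝[Icc 0 1] t,
      ∀ w ∈ Metric.ball z r, IsAllowed Ω (concat (fun s => H s t') (segPath z w)) := by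
    intro t ht
    obtain ⟨L, r, hr, hd, hev⟩ := hH.eventually_isAllowedAt hz h1 ht
    refine ⟨r, hr, ?_⟩
    filter_upwards [hev, self_mem_nhdsWithin] with t' ht' hI w hw
    exact ⟨L, ht'.1.pos, ht'.1.concat_segPath_of_mem_ball (h1 t' hI) hz ht'.2 hd hw⟩
  obtain ⟨r, hr, hall⟩ : ∃ r : ℝ, 0 < r ∧ ∀ t ∈ Icc (0 : ℝ) 1, ∀ w ∈ Metric.ball z r,
      IsAllowed Ω (concat (fun s => H s t) (segPath z w)) := by
    refine isCompact_Icc.induction_on (p := fun S : Set ℝ => ∃ r : ℝ, 0 < r ∧ ∀ t ∈ S,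
      ∀ w ∈ Metric.ball z r, IsAllowed Ω (concat (fun s => H s t) (segPath z w))) ?_ ?_ ?_ ?_
    · exact ⟨1, one_pos, by simp⟩
    · rintro S S' hS ⟨r, hr, h⟩
      exact ⟨r, hr, fun t ht => h t (hS ht)⟩
    · rintro S S' ⟨r, hr, h⟩ ⟨r', hr', h'⟩
      refine ⟨min r r', lt_min hr hr', fun t ht w hw => ?_⟩
      rcases ht with ht | ht
      · exact h t ht w (Metric.ball_subset_ball (min_le_left _ _) hw)
      · exact h' t ht w (Metric.ball_subset_ball (min_le_right _ _) hw)
    · intro t ht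
      obtain ⟨r, hr, hev⟩ := hloc t ht
      exact ⟨_, hev, r, hr, fun t' ht' => ht'⟩
  filter_upwards [Metric.ball_mem_nhds z hr] with w hw
  have c0 : EqOn (concat α.1 (segPath z w)) (concat (fun s => H s 0) (segPath z w)) (Icc 0 1) := by
    intro s hs
    unfold concat
    split_ifs with h'
    · exact (e0 _ ⟨by linarith [hs.1], by linarith⟩).symm
    · rfl
  have c1 : EqOn (concat β.1 (segPath z w)) (concat (fun s => H s 1) (segPath z w)) (Icc 0 1) := by
    intro s hs
    unfold concat
    split_ifs with h'
    · exact (e1 _ ⟨by linarith [hs.1], by linarith⟩).symm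
    · rfl
  refine ⟨(hall 0 ⟨le_rfl, zero_le_one⟩ w hw).congr c0,
    (hall 1 ⟨zero_le_one, le_rfl⟩ w hw).congr c1, ?_⟩
  have hj : ∀ t ∈ Icc (0 : ℝ) 1, H 1 t = segPath z w 0 := fun t ht => by
    rw [h1 t ht, segPath_zero]
  refine clOf_eq_of_family (H := fun s t => concat (fun σ => H σ t) (segPath z w) s) ?_ ?_
    (fun t ht => hall t ht w hw) (fun t ht => ?_) c0 c1
  · exact continuousOn_concat (G := fun s _ => segPath z w s) hH.continuousOn
      ((continuous_segPath z w).comp continuous_fst).continuousOn hj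
  · exact PiecewiseC1Family.concat hH.deriv_continuous (piecewiseC1_segPath z w).family hj
  · simp only [concat_one]

/-- Equality of classes means a finite chain of homotopies in either direction. The conclusion is
local in `w`, so it passes through the chain by intersecting finitely many neighbourhoods. -/
theorem eventually_clOf_of_cl_eq {α β : AllowedPath Ω} (h : Surface.cl Ω α = Surface.cl Ω β)
    (hz : α.1 1 ≠ ω) : ∀ᶠ w in 𝓝 (α.1 1), IsAllowed Ω (concat α.1 (segPath (α.1 1) w)) ∧
      clOf Ω (concat α.1 (segPath (α.1 1) w)) = clOf Ω (concat β.1 (segPath (α.1 1) w)) := by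
  have key : ∀ α β : AllowedPath Ω, Relation.EqvGen (AllowedHomotopic Ω) α β →
      α.1 1 = β.1 1 ∧ (α.1 1 ≠ ω → ∀ᶠ w in 𝓝 (α.1 1),
        IsAllowed Ω (concat α.1 (segPath (α.1 1) w)) ∧
        IsAllowed Ω (concat β.1 (segPath (α.1 1) w)) ∧
        clOf Ω (concat α.1 (segPath (α.1 1) w)) =
          clOf Ω (concat β.1 (segPath (α.1 1) w))) := by
    intro α β h
    induction h with
    | rel x y h => exact ⟨congrArg (Surface.proj Ω) (Quot.sound h), h.eventually_clOf⟩
    | refl x =>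
      refine ⟨rfl, fun hz => ?_⟩
      obtain ⟨L, hL, hA⟩ := x.2
      have hx : x.1 1 ∉ Ω.pts L := by
        obtain ⟨t₀, ht₀, -, hav⟩ := hA.exists_of_ne hz
        exact hav 1 ⟨ht₀.2, le_rfl⟩
      obtain ⟨r₁, hr₁, hb⟩ := Metric.mem_nhds_iff.1
        ((Ω.finite_pts L hL).isClosed.isOpen_compl.mem_nhds hx)
      obtain ⟨ε, hε, h2⟩ := ENNReal.lt_iff_exists_add_pos_lt.1 hA.length_lt
      have hr : 0 < min r₁ ε := lt_min hr₁ hε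
      filter_upwards [Metric.ball_mem_nhds _ hr] with w hw
      have := hA.concat_segPath_of_mem_ball rfl hz (r := min r₁ ε)
        (lt_of_le_of_lt (by
          rw [← ENNReal.ofReal_coe_nnreal]
          gcongr
          exact min_le_right _ _) h2)
        (disjoint_left.2 fun x hx => hb (Metric.ball_subset_ball (min_le_left _ _) hx)) hw
      exact ⟨⟨L, hL, this⟩, ⟨L, hL, this⟩, rfl⟩
    | symm x y h ih =>
      refine ⟨ih.1.symm, fun hz => ?_⟩
      rw [← ih.1] at hz ⊢
      filter_upwards [ih.2 hz] with w hw
      exact ⟨hw.2.1, hw.1, hw.2.2.symm⟩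
    | trans x y z h h' ih ih' =>
      refine ⟨ih.1.trans ih'.1, fun hz => ?_⟩
      have := ih'.2 (ih.1 ▸ hz)
      rw [← ih.1] at this
      filter_upwards [ih.2 hz, this] with w hw hw'
      exact ⟨hw.1, hw'.2.1, hw.2.2.trans hw'.2.2⟩
  filter_upwards [(key α β (Quot.eqvGen_exact h)).2 hz] with w hw
  exact ⟨hw.1, hw.2.2⟩

/-! ### Triangles -/

theorem segPath_mem_ball {z w c : ℂ} {r : ℝ} (hz : z ∈ Metric.ball c r) (hw : w ∈ Metric.ball c r)
    {t : ℝ} (ht : t ∈ Icc (0 : ℝ) 1) : segPath z w t ∈ Metric.ball c r :=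
  (convex_ball c r).segment_subset hz hw (segPath_mem_segment z w ht)

/-- Slide the corner from `z` to `w`: following the path of index `t` by the rest of `[z, w]` leads
from the product with `[z, w]` to a product with a constant path, which `clOf_concat_const` removes.
-/
theorem clOf_triangle {γ : ℝ → ℝ → ℂ} {z w : ℂ}
    (hγc : ContinuousOn (fun q : ℝ × ℝ => γ q.1 q.2) (Icc 0 1 ×ˢ Icc 0 1))
    (hγp : PiecewiseC1Family 0 1 γ) (hγ1 : ∀ t ∈ Icc (0 : ℝ) 1, γ 1 t = segPath z w t)
    (ha : ∀ t ∈ Icc (0 : ℝ) 1,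
      IsAllowed Ω (concat (fun s => γ s t) (segPath (segPath z w t) w)))
    (ha1 : IsAllowed Ω (fun s => γ s 1)) :
    clOf Ω (concat (fun s => γ s 0) (segPath z w)) = clOf Ω (fun s => γ s 1) := by
  have hj : ∀ t ∈ Icc (0 : ℝ) 1, γ 1 t = segPath (segPath z w t) w 0 := fun t ht => by
    rw [hγ1 t ht, segPath_zero]
  have hw1 : γ 1 1 = w := by rw [hγ1 1 ⟨zero_le_one, le_rfl⟩, segPath_one]
  have hcs := continuous_segPath z w
  rw [← clOf_concat_const ha1, hw1]
  refine clOf_eq_of_family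
    (H := fun s t => concat (fun σ => γ σ t) (fun σ => segPath (segPath z w t) w σ) s) ?_ ?_
    ha (fun t _ => by simp only [concat_one, segPath_one]) (fun s _ => ?_) fun s _ => ?_
  · refine continuousOn_concat (G := fun s t => segPath (segPath z w t) w s) hγc ?_ hj
    unfold segPath
    fun_prop
  · exact hγp.concat (piecewiseC1Family_segPath hcs continuous_const) hj
  · simp only [segPath_zero]
  · simp only [segPath_one]
    congr 1
    funext σ
    rw [segPath_self]

theorem eventually_clOf_concat_segPath {L r : ℝ} {γ : ℝ → ℂ} {U : Set ℂ} (h : IsAllowedAt Ω L γ)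
    (hne : γ 1 ≠ ω) (hr : pathLength γ + ENNReal.ofReal r < ENNReal.ofReal L)
    (hU : IsStarDomain (γ 1) U) (hUs : U ⊆ Metric.ball (γ 1) r \ Ω.pts L) {z : ℂ} (hz : z ∈ U) :
    ∀ᶠ w in 𝓝 z, clOf Ω (concat (concat γ (segPath (γ 1) z)) (segPath z w)) =
      clOf Ω (concat γ (segPath (γ 1) w)) := by
  have hzr := mem_ball_iff_norm.1 (hUs hz).1
  obtain ⟨ε, hε, hb⟩ := Metric.mem_nhds_iff.1 (hU.1.mem_nhds hz)
  -- Going from `γ 1` to `w` through a point of the ball of radius `ε'` about `z` costs less than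
  -- `‖z - γ 1‖ + 3 * ε'`, which the factor `1 / 4` keeps below `r`.
  have hε' : 0 < min ε ((r - ‖z - γ 1‖) / 4) := lt_min hε (by linarith)
  set ε' := min ε ((r - ‖z - γ 1‖) / 4)
  have hεr : ε' ≤ (r - ‖z - γ 1‖) / 4 := min_le_right _ _
  have hball : Metric.ball z ε' ⊆ U := (Metric.ball_subset_ball (min_le_left _ _)).trans hb
  have hω : ∀ x ∈ U, x ≠ ω := fun x hx he => (hUs hx).2 (he ▸ Ω.center_mem h.pos)
  have hdis : Disjoint U (Ω.pts L) := disjoint_left.2 fun x hx => (hUs hx).2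
  filter_upwards [Metric.ball_mem_nhds z hε'] with w hw
  have hmem : ∀ t ∈ Icc (0 : ℝ) 1, segPath z w t ∈ Metric.ball z ε' := fun t ht =>
    segPath_mem_ball (Metric.mem_ball_self hε') hw ht
  have hγt : ∀ y ∈ Metric.ball z ε', IsAllowedAt Ω L (concat γ (segPath (γ 1) y)) := by
    intro y hy
    refine h.concat_segPath hne (lt_of_le_of_lt ?_ hr)
      (hdis.mono_left (hU.2.2.segment_subset (hball hy)))
    gcongr
    exact (mem_ball_iff_norm.1 (hUs (hball hy)).1).le
  have hj : ∀ t ∈ Icc (0 : ℝ) 1, γ 1 = segPath (γ 1) (segPath z w t) 0 := fun t _ =>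
    (segPath_zero _ _).symm
  have hcs := continuous_segPath z w
  have key := clOf_triangle (Ω := Ω) (z := z) (w := w)
    (γ := fun s t => concat γ (segPath (γ 1) (segPath z w t)) s) ?_ ?_ ?_ ?_ ?_
  · simpa only [segPath_zero, segPath_one] using key
  · refine continuousOn_concat (H := fun s _ => γ s)
      (G := fun s t => segPath (γ 1) (segPath z w t) s)
      (h.piecewiseC1.continuousOn.comp continuousOn_fst fun x hx => hx.1) ?_ hj
    unfold segPath
    fun_prop
  · exact h.piecewiseC1.family.concat (piecewiseC1Family_segPath continuous_const hcs) hj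
  · intro t _
    simp only [concat_one, segPath_one]
  · intro t ht
    have hy := hmem t ht
    refine ⟨L, h.pos, ?_⟩
    have := (hγt _ hy).concat_segPath (w := w) (by
        rw [concat_one, segPath_one]
        exact hω _ (hball hy)) ?_ ?_
    · simpa only [concat_one, segPath_one] using this
    · rw [pathLength_concat (segPath_zero _ _).symm, concat_one, segPath_one]
      refine lt_of_le_of_lt ?_ hr
      rw [add_assoc]
      gcongr
      refine (add_le_add (pathLength_segPath _ _) le_rfl).trans ?_
      rw [← ENNReal.ofReal_add (norm_nonneg _) (norm_nonneg _)]
      refine ENNReal.ofReal_le_ofReal ?_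
      have h1 := mem_ball_iff_norm.1 hy
      have h2 := mem_ball_iff_norm.1 hw
      have h3 := norm_add_le (segPath z w t - z) (z - γ 1)
      have h4 := norm_sub_le (w - z) (segPath z w t - z)
      rw [sub_add_sub_cancel] at h3
      rw [sub_sub_sub_cancel_right] at h4
      linarith
    · rw [concat_one, segPath_one]
      exact hdis.mono_left (((convex_ball z ε').segment_subset hy hw).trans hball)
  · refine ⟨L, h.pos, ?_⟩
    simpa only [segPath_one] using hγt w hw

theorem eventually_clOf_segPath {L : ℝ} (hL : 0 < L) {U : Set ℂ} (hU : IsStarDomain ω U)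
    (hUs : U ⊆ Metric.ball ω L \ (Ω.pts L \ {ω})) {z : ℂ} (hz : z ∈ U) (hzω : z ≠ ω) :
    ∀ᶠ w in 𝓝 z, clOf Ω (concat (segPath ω z) (segPath z w)) = clOf Ω (segPath ω w) := by
  have hzr := mem_ball_iff_norm.1 (hUs hz).1
  obtain ⟨ε, hε, hb⟩ := Metric.mem_nhds_iff.1
    ((hU.1.inter isOpen_compl_singleton).mem_nhds ⟨hz, hzω⟩)
  have hε' : 0 < min ε ((L - ‖z - ω‖) / 4) := lt_min hε (by linarith)
  set ε' := min ε ((L - ‖z - ω‖) / 4)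
  have hεr : ε' ≤ (L - ‖z - ω‖) / 4 := min_le_right _ _
  have hball : Metric.ball z ε' ⊆ U ∩ {ω}ᶜ := (Metric.ball_subset_ball (min_le_left _ _)).trans hb
  filter_upwards [Metric.ball_mem_nhds z hε'] with w hw
  have hmem : ∀ t ∈ Icc (0 : ℝ) 1, segPath z w t ∈ Metric.ball z ε' := fun t ht =>
    segPath_mem_ball (Metric.mem_ball_self hε') hw ht
  have hγt : ∀ y ∈ U, IsAllowedAt Ω L (segPath ω y) := fun y hy =>
    isAllowedAt_segPath (mem_ball_iff_norm.1 (hUs hy).1)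
      (disjoint_left.2 fun x hx => (hUs (hU.2.2.segment_subset hy hx)).2)
  have hcs := continuous_segPath z w
  have key := clOf_triangle (Ω := Ω) (z := z) (w := w)
    (γ := fun s t => segPath ω (segPath z w t) s) ?_ ?_ ?_ ?_ ?_
  · simpa only [segPath_zero, segPath_one] using key
  · unfold segPath
    fun_prop
  · exact piecewiseC1Family_segPath continuous_const hcs
  · intro t _
    simp only [segPath_one]
  · intro t ht
    have hy := hmem t ht
    refine ⟨L, hL, ?_⟩
    have := (hγt _ (hball hy).1).concat_segPath (w := w) (by
        rw [segPath_one]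
        exact (hball hy).2) ?_ ?_
    · simpa only [segPath_one] using this
    · rw [segPath_one]
      refine lt_of_le_of_lt (add_le_add (pathLength_segPath _ _) le_rfl) ?_
      rw [← ENNReal.ofReal_add (norm_nonneg _) (norm_nonneg _)]
      refine (ENNReal.ofReal_lt_ofReal_iff hL).2 ?_
      have h1 := mem_ball_iff_norm.1 hy
      have h2 := mem_ball_iff_norm.1 hw
      have h3 := norm_add_le (segPath z w t - z) (z - ω)
      have h4 := norm_sub_le (w - z) (segPath z w t - z)
      rw [sub_add_sub_cancel] at h3
      rw [sub_sub_sub_cancel_right] at h4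
      linarith
    · rw [segPath_one]
      refine disjoint_left.2 fun x hx hm => ?_
      have hx' := hball ((convex_ball z ε').segment_subset hy hw hx)
      exact (hUs hx'.1).2 ⟨hm, hx'.2⟩
  · exact ⟨L, hL, by simpa only [segPath_one] using hγt w (hball hw).1⟩

/-! ### Continuity of the straight sections -/

/-- The topology is only known through its generators, so each generating set containing `f z` is
tested. It contains `f z` as the class of another path with the same end point `z`; prolonging this
equality of classes to nearby `w` and applying a triangle homotopy puts `f w` into the same set. -/
theorem continuousAt_clOf_of_eventually {f : ℂ → Surface Ω} {α : ℝ → ℂ} (hα : IsAllowed Ω α)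
    {z : ℂ} (hz : α 1 = z) (hzω : z ≠ ω) (hfz : f z = clOf Ω α)
    (hf : ∀ᶠ w in 𝓝 z, f w = clOf Ω (concat α (segPath z w))) : ContinuousAt f z := by
  subst hz
  unfold ContinuousAt
  rw [TopologicalSpace.tendsto_nhds_generateFrom_iff]
  rintro V (⟨L, U, hL, hU, hUs, rfl⟩ | ⟨γ, L, r, U, hA, hne, hr, hrL, hU, hUs, rfl⟩) hmem
  · obtain ⟨ξ, hξ, hall, he⟩ := hmem
    rw [hfz, clOf_of_isAllowed hα] at he
    have hend : α 1 = ξ := by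
      have := congrArg (Surface.proj Ω) he
      simpa [Surface.proj, Surface.cl, segPath_one] using this
    subst hend
    filter_upwards [hf, eventually_clOf_of_cl_eq he hzω,
      eventually_clOf_segPath hL hU hUs hξ hzω, hU.1.mem_nhds hξ] with w h1 h2 h3 h4
    have hw : IsAllowed Ω (segPath ω w) := ⟨L, hL, isAllowedAt_segPath
      (mem_ball_iff_norm.1 (hUs h4).1)
      (disjoint_left.2 fun x hx => (hUs (hU.2.2.segment_subset h4 hx)).2)⟩
    refine ⟨w, h4, hw, ?_⟩
    rw [h1, h2.2, h3, clOf_of_isAllowed hw]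
  · obtain ⟨ξ, hξ, hall, he⟩ := hmem
    rw [hfz, clOf_of_isAllowed hα] at he
    have hend : α 1 = ξ := by
      have := congrArg (Surface.proj Ω) he
      simpa [Surface.proj, Surface.cl, segPath_one, concat_one] using this
    subst hend
    filter_upwards [hf, eventually_clOf_of_cl_eq he hzω,
      eventually_clOf_concat_segPath hA hne hrL hU hUs hξ, hU.1.mem_nhds hξ] with w h1 h2 h3 h4
    have hw : IsAllowed Ω (concat γ (segPath (γ 1) w)) := by
      refine ⟨L, hA.pos, hA.concat_segPath hne (lt_of_le_of_lt ?_ hrL)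
        (disjoint_left.2 fun x hx => (hUs (hU.2.2.segment_subset h4 hx)).2)⟩
      gcongr
      exact (mem_ball_iff_norm.1 (hUs h4).1).le
    refine ⟨w, h4, hw, ?_⟩
    rw [h1, h2.2, h3, clOf_of_isAllowed hw]

theorem continuousOn_clOf_concat_segPath {L r : ℝ} {γ : ℝ → ℂ} {U : Set ℂ}
    (h : IsAllowedAt Ω L γ) (hne : γ 1 ≠ ω)
    (hr : pathLength γ + ENNReal.ofReal r < ENNReal.ofReal L)
    (hU : IsStarDomain (γ 1) U) (hUs : U ⊆ Metric.ball (γ 1) r \ Ω.pts L) {z : ℂ} (hz : z ∈ U) :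
    ContinuousAt (fun w => clOf Ω (concat γ (segPath (γ 1) w))) z := by
  have hz' := hUs hz
  refine continuousAt_clOf_of_eventually (α := concat γ (segPath (γ 1) z)) ?_
    (by rw [concat_one, segPath_one]) (fun he => hz'.2 (he ▸ Ω.center_mem h.pos)) rfl ?_
  · refine ⟨L, h.pos, h.concat_segPath hne (lt_of_le_of_lt ?_ hr)
      (disjoint_left.2 fun x hx => (hUs (hU.2.2.segment_subset hz hx)).2)⟩
    gcongr
    exact (mem_ball_iff_norm.1 hz'.1).le
  · filter_upwards [eventually_clOf_concat_segPath h hne hr hU hUs hz] with w hw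
    exact hw.symm

theorem clOf_segPath_center : clOf Ω (segPath ω ω) = Surface.base Ω := by
  have h := isAllowed_const Ω
  rw [← clOf_congr h (fun s _ => segPath_self ω s), clOf_of_isAllowed h]
  rfl

theorem continuousAt_clOf_segPath {L : ℝ} (hL : 0 < L) (hΩ : Ω.pts L = {ω}) {z : ℂ}
    (hz : z ∈ Metric.ball ω L) : ContinuousAt (fun w => clOf Ω (segPath ω w)) z := by
  have hU : IsStarDomain ω (Metric.ball ω L) := ⟨Metric.isOpen_ball, Metric.mem_ball_self hL,
    (convex_ball ω L).starConvex (Metric.mem_ball_self hL)⟩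
  have hUs : Metric.ball ω L ⊆ Metric.ball ω L \ (Ω.pts L \ {ω}) := by
    simp [hΩ]
  have hall : ∀ w ∈ Metric.ball ω L, IsAllowed Ω (segPath ω w) := fun w hw =>
    ⟨L, hL, isAllowedAt_segPath (mem_ball_iff_norm.1 hw) (by simp [hΩ])⟩
  rcases eq_or_ne z ω with rfl | hne
  · unfold ContinuousAt
    rw [TopologicalSpace.tendsto_nhds_generateFrom_iff]
    rintro V (⟨L', U, hL', hU', hUs', rfl⟩ | ⟨γ, L', r, U, hA, hne, hr, hrL, hU', hUs', rfl⟩) hmem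
    · filter_upwards [hU'.1.mem_nhds hU'.2.1, Metric.ball_mem_nhds z hL] with w hw hwL
      exact ⟨w, hw, hall w hwL, clOf_of_isAllowed (hall w hwL)⟩
    -- A generating set of the second kind misses the base point: it projects into `U`, which avoids
    -- `Ω_{L'}` and therefore the centre.
    · exfalso
      obtain ⟨ξ, hξ, h', he⟩ := hmem
      have := congrArg (Surface.proj Ω) he
      rw [proj_clOf (hall z hz), segPath_one] at this
      have e2 : z = ξ := by
        simpa [Surface.proj, Surface.cl, segPath_one, concat_one] using this
      exact (hUs' hξ).2 (e2 ▸ Ω.center_mem hA.pos)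
  · refine continuousAt_clOf_of_eventually (hall z hz) (segPath_one _ _) hne rfl ?_
    filter_upwards [eventually_clOf_segPath hL hU hUs hz hne] with w hw
    exact hw.symm

end Endless

namespace Endless

variable {ω : ℂ}

/-! ### The margin of a point of `ℝ × ℂ` -/

/-- The set of the pairs `(L, a - ω)` with `a ∈ Ω_L`. -/
def singularSet (Ω : DiscreteFilteredSet ω) : Set (ℝ × ℂ) :=
  {q | 0 < q.1 ∧ ω + q.2 ∈ Ω.pts q.1}

/-- The distance of a point `(ℓ, u)` of `ℝ × ℂ` to the singular set. -/
noncomputable def margin (Ω : DiscreteFilteredSet ω) (q : ℝ × ℂ) : ℝ :=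
  Metric.infDist q (singularSet Ω)

section margin

variable (Ω : DiscreteFilteredSet ω)

theorem mem_singularSet_zero {L : ℝ} (hL : 0 < L) : ((L, 0) : ℝ × ℂ) ∈ singularSet Ω :=
  ⟨hL, by simpa using Ω.center_mem hL⟩

theorem singularSet_nonempty : (singularSet Ω).Nonempty := ⟨_, mem_singularSet_zero Ω one_pos⟩

theorem margin_nonneg (q : ℝ × ℂ) : 0 ≤ margin Ω q := Metric.infDist_nonneg

theorem continuous_margin : Continuous (margin Ω) := Metric.continuous_infDist_pt _

theorem margin_le_add_dist (q q' : ℝ × ℂ) : margin Ω q ≤ margin Ω q' + dist q q' :=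
  Metric.infDist_le_infDist_add_dist

/-- All pairs `(L, 0)` with `L > 0` are singular; the `ε` is there for `ℓ = 0`. -/
theorem margin_le_norm {ℓ : ℝ} (hℓ : 0 ≤ ℓ) (u : ℂ) : margin Ω (ℓ, u) ≤ ‖u‖ := by
  refine le_of_forall_pos_le_add fun ε hε => ?_
  have h := Metric.infDist_le_dist_of_mem (x := ((ℓ, u) : ℝ × ℂ))
    (mem_singularSet_zero Ω (L := ℓ + ε) (by linarith))
  refine h.trans ?_
  rw [Prod.dist_eq, Real.dist_eq, dist_zero_right, sub_add_cancel_left, abs_neg, abs_of_pos hε]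
  exact max_le (by linarith [norm_nonneg u]) (by linarith)

theorem margin_zero : margin Ω 0 = 0 :=
  le_antisymm ((margin_le_norm Ω le_rfl 0).trans_eq norm_zero) (margin_nonneg Ω _)

variable {Ω}

theorem margin_le_of_mem {ℓ r : ℝ} {u a : ℂ} (hr : 0 ≤ r) (hℓ : 0 < ℓ + r)
    (ha : a ∈ Ω.pts (ℓ + r)) : margin Ω (ℓ, u) ≤ max r ‖ω + u - a‖ := by
  have hm : ((ℓ + r, a - ω) : ℝ × ℂ) ∈ singularSet Ω := ⟨hℓ, by simpa using ha⟩
  refine (Metric.infDist_le_dist_of_mem hm).trans ?_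
  rw [Prod.dist_eq, Real.dist_eq, dist_eq_norm, sub_add_cancel_left, abs_neg, abs_of_nonneg hr]
  exact le_of_eq (by congr 2; ring)

/-- A singular point of clock at most `ρ` lies over `0`, at distance at least `‖u‖`. For a clock at
least `ρ`, the clocks alone differ by more than `ρ / 2 > ‖u‖`. -/
theorem norm_le_margin {ρ : ℝ} (hΩ : Ω.pts ρ = {ω}) {ℓ : ℝ} {u : ℂ} (hu : ‖u‖ ≤ ℓ)
    (hℓ : ℓ < ρ / 2) : ‖u‖ ≤ margin Ω (ℓ, u) := by
  refine (Metric.le_infDist (singularSet_nonempty Ω)).2 ?_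
  rintro ⟨L, a⟩ ⟨hL, ha⟩
  rw [Prod.dist_eq]
  rcases le_total L ρ with h | h
  · have := Ω.pts_mono L ρ hL h ha
    rw [hΩ, mem_singleton_iff, add_eq_left] at this
    subst this
    simp
  · refine le_max_of_le_left ?_
    rw [Real.dist_eq, abs_sub_comm]
    refine le_trans ?_ (le_abs_self _)
    linarith

/-- Singular points of clock at most `L` lie over the finite set `Ω_L`, at a positive distance from
`ω + u`; for the others the clock exceeds `ℓ` by at least `L - ℓ`. -/
theorem margin_pos {L ℓ : ℝ} {u : ℂ} (hℓ : ℓ < L) (hL : 0 < L) (hu : ω + u ∉ Ω.pts L) :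
    0 < margin Ω (ℓ, u) := by
  obtain ⟨r, hr, hb⟩ := Metric.mem_nhds_iff.1
    ((Ω.finite_pts L hL).isClosed.isOpen_compl.mem_nhds hu)
  refine lt_of_lt_of_le (lt_min hr (sub_pos.2 hℓ))
    ((Metric.le_infDist (singularSet_nonempty Ω)).2 ?_)
  rintro ⟨L', a⟩ ⟨hL', ha⟩
  rw [Prod.dist_eq]
  rcases le_total L' L with h | h
  · refine (min_le_left _ _).trans (le_max_of_le_right ?_)
    by_contra hcon
    refine hb (Metric.mem_ball.2 ?_) (Ω.pts_mono L' L hL' h ha)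
    rw [dist_add_left, dist_comm]
    exact not_le.1 hcon
  · refine (min_le_right _ _).trans (le_max_of_le_left ?_)
    rw [Real.dist_eq, abs_sub_comm]
    refine le_trans ?_ (le_abs_self _)
    linarith

/-- The sum of a singular point for `Ω` and one for `Ω'` is singular for the fine sum. This is the
only property of the fine sum that the continuation uses. -/
theorem margin_fineSum_le (Ω Ω' : DiscreteFilteredSet ω) (q q' : ℝ × ℂ) :
    margin (Ω.fineSum Ω') (q + q') ≤ margin Ω q + margin Ω' q' := by
  refine le_of_forall_pos_le_add fun ε hε => ?_
  obtain ⟨⟨L, a⟩, ⟨hL, ha⟩, h⟩ := (Metric.infDist_lt_iff (singularSet_nonempty Ω)).1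
    (lt_add_of_pos_right (margin Ω q) (half_pos hε))
  obtain ⟨⟨L', a'⟩, ⟨hL', ha'⟩, h'⟩ := (Metric.infDist_lt_iff (singularSet_nonempty Ω')).1
    (lt_add_of_pos_right (margin Ω' q') (half_pos hε))
  have hm : ((L, a) + (L', a') : ℝ × ℂ) ∈ singularSet (Ω.fineSum Ω') :=
    ⟨add_pos hL hL', L, L', hL, hL', rfl, ω + a, ha, ω + a', ha', by
      simp only [Prod.mk_add_mk]
      ring⟩
  refine (Metric.infDist_le_dist_of_mem hm).trans ?_
  have := dist_add_add_le q q' ((L, a) : ℝ × ℂ) (L', a')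
  linarith

end margin

/-! ### Continuation along chains of discs -/

/-- A chain of `n + 1` points `z k` (relative to the centre) with clock `m k` bounding the length
travelled so far, with all steps at most `r`. -/
structure IsChain (n : ℕ) (z : ℕ → ℂ) (m : ℕ → ℝ) (r : ℝ) : Prop where
  start : ‖z 0‖ ≤ m 0
  step : ∀ k < n, ‖z (k + 1) - z k‖ ≤ m (k + 1) - m k
  small : ∀ k < n, m (k + 1) - m k ≤ r

/-- `F` continues along the chain of discs of radius `R` centred at the points `z k`. -/
def ChainContinues (F : ℂ → ℂ) (R : ℝ) (n : ℕ) (z : ℕ → ℂ) : Prop :=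
  ∃ f : ℕ → ℂ → ℂ, (∀ k ≤ n, AnalyticOnNhd ℂ (f k) (Metric.ball (z k) R)) ∧
    (∀ k < n, EqOn (f k) (f (k + 1)) (Metric.ball (z k) R ∩ Metric.ball (z (k + 1)) R)) ∧
    EqOn (f 0) F (Metric.ball (z 0) R)

theorem eqOn_inter_ball {f g : ℂ → ℂ} {c c' u : ℂ} {R R' : ℝ}
    (hf : AnalyticOnNhd ℂ f (Metric.ball c R)) (hg : AnalyticOnNhd ℂ g (Metric.ball c' R'))
    (hu : u ∈ Metric.ball c R) (hu' : u ∈ Metric.ball c' R') (h : f =ᶠ[𝓝 u] g) :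
    EqOn f g (Metric.ball c R ∩ Metric.ball c' R') :=
  (hf.mono inter_subset_left).eqOn_of_preconnected_of_eventuallyEq (hg.mono inter_subset_right)
    ((convex_ball c R).inter (convex_ball c' R')).isPreconnected ⟨hu, hu'⟩ h

namespace IsChain

variable {n : ℕ} {z : ℕ → ℂ} {m : ℕ → ℝ} {r : ℝ}

theorem norm_le (h : IsChain n z m r) {k : ℕ} (hk : k ≤ n) : ‖z k‖ ≤ m k := by
  induction k with
  | zero => exact h.start
  | succ k ih =>
    have h1 := ih (Nat.le_of_succ_le hk)
    have h2 := h.step k hk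
    have h3 := norm_add_le (z (k + 1) - z k) (z k)
    rw [sub_add_cancel] at h3
    linarith

theorem mono (h : IsChain n z m r) {k j : ℕ} (hkj : k ≤ j) (hj : j ≤ n) : m k ≤ m j := by
  induction j, hkj using Nat.le_induction with
  | base => exact le_rfl
  | succ j hkj ih =>
    have := (norm_nonneg _).trans (h.step j hj)
    linarith [ih (Nat.le_of_succ_le hj)]

theorem tail (h : IsChain n z m r) {k : ℕ} (hk : k ≤ n) :
    IsChain (n - k) (fun i => z (k + i)) (fun i => m (k + i)) r :=
  ⟨h.norm_le hk, fun i hi => h.step (k + i) (by omega), fun i hi => h.small (k + i) (by omega)⟩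

/-- The initial part of a chain, in a disc where `F` is analytic, can be discarded. -/
theorem chainContinues_of_tail (h : IsChain n z m r) {F : ℂ → ℂ} {ρ σ R : ℝ}
    (hF : AnalyticOnNhd ℂ F (Metric.ball 0 ρ)) (hσ : σ + r + R ≤ ρ) (hr : 0 ≤ r) (h0 : m 0 < σ)
    (htail : ∀ k ≤ n, m k ≤ σ + r → (∀ j, k ≤ j → j ≤ n → σ ≤ m j) →
      ChainContinues F R (n - k) (fun i => z (k + i))) : ChainContinues F R n z := by
  have hsub : ∀ k ≤ n, m k ≤ σ + r → Metric.ball (z k) R ⊆ Metric.ball 0 ρ := by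
    intro k hk hmk
    refine Metric.ball_subset_ball' ?_
    rw [dist_zero_right]
    linarith [h.norm_le hk]
  by_cases hall : ∀ k ≤ n, m k < σ
  · exact ⟨fun _ => F, fun k hk => hF.mono (hsub k hk (by linarith [hall k hk])),
      fun _ _ _ _ => rfl, fun _ _ => rfl⟩
  · push Not at hall
    classical
    -- `k₁` is the first index at which the clock reaches `σ`; as the steps are at most `r`, the
    -- clock there is at most `σ + r`, and all earlier discs lie in the disc where `F` is analytic.
    have hk1 := Nat.find_spec hall
    set k₁ := Nat.find hall
    have hlt : ∀ k < k₁, m k < σ := fun k hk => by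
      by_contra hcon
      exact Nat.find_min hall hk ⟨hk.le.trans hk1.1, not_lt.1 hcon⟩
    have hpos : 0 < k₁ := by
      by_contra hcon
      have e : k₁ = 0 := by omega
      rw [e] at hk1
      linarith [hk1.2]
    have hm1 : m k₁ ≤ σ + r := by
      have h1 := hlt (k₁ - 1) (by omega)
      have h2 := h.small (k₁ - 1) (by omega)
      rw [Nat.sub_add_cancel hpos] at h2
      linarith
    obtain ⟨f, hf, hff, hf0⟩ := htail k₁ hk1.1 hm1 fun j hj hjn => hk1.2.trans (h.mono hj hjn)
    refine ⟨fun k => if k < k₁ then F else f (k - k₁), fun k hk => ?_, fun k hk => ?_, ?_⟩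
    · by_cases hkk : k < k₁
      · simp only [if_pos hkk]
        exact hF.mono (hsub k hk (by linarith [hlt k hkk]))
      · simp only [if_neg hkk]
        have := hf (k - k₁) (by omega)
        beta_reduce at this
        rwa [show k₁ + (k - k₁) = k by omega] at this
    · rcases lt_trichotomy (k + 1) k₁ with hkk | hkk | hkk
      · simp only [if_pos hkk, if_pos (show k < k₁ by omega)]
        exact fun _ _ => rfl
      · simp only [if_neg (show ¬ k + 1 < k₁ by omega), if_pos (show k < k₁ by omega)]
        rw [hkk, Nat.sub_self]
        exact fun u hu => (hf0 hu.2).symm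
      · simp only [if_neg (show ¬ k + 1 < k₁ by omega), if_neg (show ¬ k < k₁ by omega)]
        have := hff (k - k₁) (by omega)
        beta_reduce at this
        rwa [show k₁ + (k - k₁) = k by omega, show k₁ + (k - k₁ + 1) = k + 1 by omega,
          show k - k₁ + 1 = k + 1 - k₁ by omega] at this
    · simp only [if_pos hpos]
      exact fun _ _ => rfl

end IsChain

/-- `F` is analytic on the disc of radius `ρ` about `0` and continues along every chain that stays
away from the singular set after leaving a smaller disc. -/
structure ContinuesAlongChains (Ω : DiscreteFilteredSet ω) (ρ : ℝ) (F : ℂ → ℂ) : Prop where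
  pos : 0 < ρ
  pts_eq : Ω.pts ρ = {ω}
  analytic : AnalyticOnNhd ℂ F (Metric.ball 0 ρ)
  continues : ∀ (n : ℕ) (z : ℕ → ℂ) (m : ℕ → ℝ) (r : ℝ), 0 < r → 32 * r ≤ ρ → IsChain n z m r →
    m 0 < ρ / 2 → (∀ k ≤ n, m k < ρ / 2 ∨ 16 * r ≤ margin Ω (m k, z k)) →
    ChainContinues F (8 * r) n z

/-! ### Polygons in general position -/

theorem affineSpan_pair_ne_top (q a : ℂ) : affineSpan ℝ {q, a} ≠ ⊤ := by
  intro h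
  have h1 := collinear_iff_finrank_le_one.1 (collinear_pair ℝ q a)
  rw [← direction_affineSpan, h, AffineSubspace.direction_top, finrank_top,
    Complex.finrank_real_complex] at h1
  norm_num at h1

/-- A bad `p` lies on the affine span of `q` and some `a ∈ A`. Finitely many such spans have measure
zero and cannot cover a disc. -/
theorem exists_segPath_notMem {A : Set ℂ} (hA : A.Finite) (q c : ℂ) {ε : ℝ} (hε : 0 < ε) :
    ∃ p ∈ Metric.ball c ε, ∀ s ∈ Ioc (0 : ℝ) 1, segPath q p s ∉ A := by
  by_contra! hcon
  have hsub : Metric.ball c ε ⊆ ⋃ a ∈ A, (affineSpan ℝ {q, a} : Set ℂ) := by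
    intro p hp
    obtain ⟨s, hs, hm⟩ := hcon p hp
    refine mem_biUnion hm ?_
    have h := AffineMap.lineMap_mem_affineSpan_pair (k := ℝ) s⁻¹ q (segPath q p s)
    have e : AffineMap.lineMap q (segPath q p s) s⁻¹ = p := by
      have hs0 : (s : ℂ) ≠ 0 := by exact_mod_cast hs.1.ne'
      simp [AffineMap.lineMap_apply, segPath, hs0]
    rwa [e] at h
  have h0 : MeasureTheory.volume (⋃ a ∈ A, (affineSpan ℝ {q, a} : Set ℂ)) = 0 :=
    (MeasureTheory.measure_biUnion_null_iff hA.countable).2 fun a _ =>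
      MeasureTheory.Measure.addHaar_affineSubspace _ _ (affineSpan_pair_ne_top q a)
  exact (Metric.measure_ball_pos MeasureTheory.volume c hε).ne'
    (MeasureTheory.measure_mono_null hsub h0)

/-- The polygon with vertices `ω, p 0, …, p k`. -/
noncomputable def polygon (ω : ℂ) (p : ℕ → ℂ) : ℕ → ℝ → ℂ
  | 0 => segPath ω (p 0)
  | k + 1 => concat (polygon ω p k) (segPath (p k) (p (k + 1)))

theorem polygon_one (p : ℕ → ℂ) (k : ℕ) : polygon ω p k 1 = p k := by
  cases k with
  | zero => exact segPath_one _ _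
  | succ k => rw [polygon, concat_one, segPath_one]

theorem polygon_zero (p : ℕ → ℂ) (k : ℕ) : polygon ω p k 0 = ω := by
  induction k with
  | zero => exact segPath_zero _ _
  | succ k ih => rw [polygon, concat_zero, ih]

theorem piecewiseC1_polygon (p : ℕ → ℂ) (k : ℕ) : PiecewiseC1 (polygon ω p k) := by
  induction k with
  | zero => exact piecewiseC1_segPath _ _
  | succ k ih =>
    exact ih.concat (piecewiseC1_segPath _ _) (by rw [polygon_one, segPath_zero])

theorem pathLength_polygon (p : ℕ → ℂ) (k : ℕ) : pathLength (polygon ω p k) ≤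
    ENNReal.ofReal (‖p 0 - ω‖ + ∑ i ∈ Finset.range k, ‖p (i + 1) - p i‖) := by
  induction k with
  | zero => simpa [polygon] using pathLength_segPath ω (p 0)
  | succ k ih =>
    rw [polygon, pathLength_concat (by rw [polygon_one, segPath_zero]), Finset.sum_range_succ,
      ← add_assoc, ENNReal.ofReal_add (by positivity) (norm_nonneg _)]
    exact add_le_add ih (pathLength_segPath _ _)

theorem polygon_notMem {A : Set ℂ} {p : ℕ → ℂ} (h0 : ∀ s ∈ Ioc (0 : ℝ) 1, segPath ω (p 0) s ∉ A)
    (h : ∀ k, ∀ s ∈ Ioc (0 : ℝ) 1, segPath (p k) (p (k + 1)) s ∉ A) (k : ℕ) :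
    ∀ s ∈ Ioc (0 : ℝ) 1, polygon ω p k s ∉ A := by
  induction k with
  | zero => exact h0
  | succ k ih =>
    intro s hs
    rw [polygon]
    rcases le_or_gt s (1 / 2) with h' | h'
    · rw [concat_of_le h']
      exact ih _ ⟨by linarith [hs.1], by linarith⟩
    · rw [concat_of_ge (by rw [polygon_one, segPath_zero]) h'.le]
      exact h k _ ⟨by linarith, by linarith [hs.2]⟩

theorem exists_generic_vertices {A : Set ℂ} (hA : A.Finite) (c : ℕ → ℂ) {ε : ℝ} (hε : 0 < ε) :
    ∃ p : ℕ → ℂ, (∀ k, p k ∈ Metric.ball (c k) ε) ∧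
      ∀ k, ∀ s ∈ Ioc (0 : ℝ) 1, polygon ω p k s ∉ A := by
  choose f hf hfA using fun q x => exists_segPath_notMem hA q x hε
  let p : ℕ → ℂ := fun k => Nat.rec (f ω (c 0)) (fun k q => f q (c (k + 1))) k
  refine ⟨p, fun k => ?_, polygon_notMem (hfA ω (c 0)) fun k => hfA (p k) (c (k + 1))⟩
  cases k with
  | zero => exact hf _ _
  | succ k => exact hf _ _

/-! ### From the surface to chains -/

variable {Ω : DiscreteFilteredSet ω}

theorem analyticAt_of_section {Φ : Surface Ω → ℂ} (hΦ : IsHolomorphicOver (Surface.proj Ω) Φ)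
    {f : ℂ → Surface Ω} {z : ℂ} (hf : ContinuousAt f z)
    (hp : ∀ᶠ w in 𝓝 z, Surface.proj Ω (f w) = w) : AnalyticAt ℂ (fun w => Φ (f w)) z := by
  obtain ⟨g, hg, he⟩ := hΦ (f z)
  rw [hp.self_of_nhds] at hg
  refine hg.congr ?_
  filter_upwards [hf.eventually he, hp] with w h1 h2
  rw [h1, h2]

theorem analyticAt_comp_add {f : ℂ → ℂ} {c u : ℂ} (h : AnalyticAt ℂ f (c + u)) :
    AnalyticAt ℂ (fun x => f (c + x)) u :=
  AnalyticAt.comp (f := fun x => c + x) h (by fun_prop)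

/-- Both functions are analytic on the disc, and they agree near `ω` because the radial section is
continuous at the base point; the identity theorem does the rest. -/
theorem eqOn_of_isHolomorphicOver {Φ : Surface Ω → ℂ} {φ : ℂ → ℂ}
    (hΦ : IsHolomorphicOver (Surface.proj Ω) Φ)
    (hb : ∀ᶠ ξ in 𝓝 (Surface.base Ω), Φ ξ = φ (Surface.proj Ω ξ)) {ρ : ℝ} (hρ : 0 < ρ)
    (hΩ : Ω.pts ρ = {ω}) (hφ : AnalyticOnNhd ℂ φ (Metric.ball ω ρ)) :
    EqOn (fun w => Φ (clOf Ω (segPath ω w))) φ (Metric.ball ω ρ) := by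
  have hall : ∀ w ∈ Metric.ball ω ρ, Surface.proj Ω (clOf Ω (segPath ω w)) = w := fun w hw => by
    rw [proj_clOf ⟨ρ, hρ, isAllowedAt_segPath (mem_ball_iff_norm.1 hw) (by simp [hΩ])⟩, segPath_one]
  have hev : ∀ z ∈ Metric.ball ω ρ, ∀ᶠ w in 𝓝 z,
      Surface.proj Ω (clOf Ω (segPath ω w)) = w := fun z hz => by
    filter_upwards [Metric.isOpen_ball.mem_nhds hz] with w hw
    exact hall w hw
  have hω := Metric.mem_ball_self (x := ω) hρ
  refine AnalyticOnNhd.eqOn_of_preconnected_of_eventuallyEq (fun z hz =>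
    analyticAt_of_section hΦ (continuousAt_clOf_segPath hρ hΩ hz) (hev z hz)) hφ
    (convex_ball ω ρ).isPreconnected hω ?_
  have hc := continuousAt_clOf_segPath hρ hΩ hω
  unfold ContinuousAt at hc
  beta_reduce at hc
  rw [clOf_segPath_center] at hc
  filter_upwards [hc.eventually hb, hev ω hω] with w h1 h2
  rw [h1, h2]

/-- The continuation is read off along a polygon with vertices `p k` close to `ω + z k`, by
prolonging its initial parts by segments. The margin at `z j` only protects against `Ω_L` for `L`
close to `m j`, while being allowed at a later level `m k + 15 * r` requires the earlier edges to
avoid a larger set. A generic perturbation of the vertices achieves this without spoiling the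
lengths. -/
theorem chainContinues_of_surface {Φ : Surface Ω → ℂ} {φ : ℂ → ℂ}
    (hΦ : IsHolomorphicOver (Surface.proj Ω) Φ)
    (hb : ∀ᶠ ξ in 𝓝 (Surface.base Ω), Φ ξ = φ (Surface.proj Ω ξ)) {ρ : ℝ} (hρ : 0 < ρ)
    (hΩ : Ω.pts ρ = {ω}) (hφ : AnalyticOnNhd ℂ φ (Metric.ball ω ρ)) {n : ℕ} {z : ℕ → ℂ}
    {m : ℕ → ℝ} {r : ℝ} (hr : 0 < r) (hrρ : 32 * r ≤ ρ) (hch : IsChain n z m r)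
    (hm0 : m 0 ≤ ρ / 2 + r) (hmar : ∀ k ≤ n, 16 * r ≤ margin Ω (m k, z k)) :
    ChainContinues (fun u => φ (ω + u)) (8 * r) n z := by
  have hm0' : 0 ≤ m 0 := (norm_nonneg _).trans hch.start
  have hmk : ∀ k ≤ n, 0 ≤ m k := fun k hk => hm0'.trans (hch.mono (Nat.zero_le k) hk)
  -- All levels `m k + 15 * r` stay below `m n + 20 * r`, so the vertices need to be generic for one
  -- finite set only. The size of the perturbation is such that the `2 * k + 1` errors made up to
  -- the vertex `k` add up to at most `r`.
  have hΛ : 0 < m n + 20 * r := by linarith [hmk n le_rfl]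
  have hε : 0 < r / (2 * (n + 1)) := by positivity
  obtain ⟨p, hp, hav⟩ := exists_generic_vertices (ω := ω) (Ω.finite_pts _ hΛ) (fun k => ω + z k) hε
  set ε := r / (2 * (n + 1)) with hεdef
  have hεn : (2 * n + 2) * ε = r := by
    rw [hεdef]
    field_simp
  have hεr : 2 * ε ≤ r := by nlinarith [(Nat.cast_nonneg n : (0 : ℝ) ≤ n)]
  have hp' : ∀ k, ‖p k - (ω + z k)‖ < ε := fun k => mem_ball_iff_norm.1 (hp k)
  have hsum : ∀ k ≤ n, ‖p 0 - ω‖ + ∑ i ∈ Finset.range k, ‖p (i + 1) - p i‖ ≤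
      m k + (2 * k + 1) * ε := by
    intro k
    induction k with
    | zero =>
      intro _
      have h1 := norm_add_le (p 0 - (ω + z 0)) (z 0)
      rw [show p 0 - (ω + z 0) + z 0 = p 0 - ω by ring] at h1
      simp only [Finset.range_zero, Finset.sum_empty, add_zero, Nat.cast_zero, mul_zero, zero_add,
        one_mul]
      linarith [hp' 0, hch.start]
    | succ k ih =>
      intro hk
      have h0 := ih (Nat.le_of_succ_le hk)
      have h1 := norm_add₃_le (a := p (k + 1) - (ω + z (k + 1))) (b := z (k + 1) - z k)
        (c := (ω + z k) - p k)
      rw [show p (k + 1) - (ω + z (k + 1)) + (z (k + 1) - z k) + ((ω + z k) - p k) =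
        p (k + 1) - p k by ring, norm_sub_rev (ω + z k)] at h1
      rw [Finset.sum_range_succ]
      push_cast
      linarith [hp' k, hp' (k + 1), hch.step k hk]
  have hlen : ∀ k ≤ n, pathLength (polygon ω p k) ≤ ENNReal.ofReal (m k + r) := by
    intro k hk
    refine (pathLength_polygon p k).trans (ENNReal.ofReal_le_ofReal ((hsum k hk).trans ?_))
    have : (k : ℝ) ≤ n := by exact_mod_cast hk
    nlinarith
  have hall : ∀ k ≤ n, IsAllowedAt Ω (m k + 15 * r) (polygon ω p k) := by
    intro k hk
    refine isAllowedAt_of_notMem (polygon_zero p k) (piecewiseC1_polygon p k)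
      ((hlen k hk).trans_lt ?_) (t₀ := 0) ⟨le_rfl, one_pos⟩ (fun s hs => ?_) fun s hs hmem => ?_
    · exact (ENNReal.ofReal_lt_ofReal_iff (by linarith [hmk k hk])).2 (by linarith)
    · rw [Icc_self, mem_singleton_iff] at hs
      rw [hs, polygon_zero]
    · exact hav k s hs (Ω.pts_mono _ _ (by linarith [hmk k hk])
        (by linarith [hch.mono hk le_rfl]) hmem)
  have hdis : ∀ k ≤ n, Metric.ball (p k) (12 * r) ⊆
      Metric.ball (p k) (12 * r) \ Ω.pts (m k + 15 * r) := by
    refine fun k hk a ha => ⟨ha, fun hmem => ?_⟩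
    have h1 := (hmar k hk).trans
      (margin_le_of_mem (u := z k) (by linarith) (by linarith [hmk k hk]) hmem)
    rcases le_max_iff.1 h1 with h1 | h1
    · linarith
    · have h2 := norm_add_le (p k - a) ((ω + z k) - p k)
      rw [show p k - a + ((ω + z k) - p k) = ω + z k - a by ring, norm_sub_rev (ω + z k) (p k),
        norm_sub_rev (p k) a] at h2
      linarith [hp' k, mem_ball_iff_norm.1 ha]
  have hlen' : ∀ k ≤ n, pathLength (polygon ω p k) + ENNReal.ofReal (12 * r) <
      ENNReal.ofReal (m k + 15 * r) := by
    intro k hk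
    refine (add_le_add (hlen k hk) le_rfl).trans_lt ?_
    rw [← ENNReal.ofReal_add (by linarith [hmk k hk]) (by linarith)]
    exact (ENNReal.ofReal_lt_ofReal_iff (by linarith [hmk k hk])).2 (by linarith)
  have hstar : ∀ k, IsStarDomain (polygon ω p k 1) (Metric.ball (polygon ω p k 1) (12 * r)) :=
    fun k => ⟨Metric.isOpen_ball, Metric.mem_ball_self (by linarith),
      (convex_ball _ _).starConvex (Metric.mem_ball_self (by linarith))⟩
  have hne : ∀ k ≤ n, polygon ω p k 1 ≠ ω := fun k _ he =>
    hav k 1 ⟨one_pos, le_rfl⟩ (by rw [he]; exact Ω.center_mem hΛ)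
  have hdis' : ∀ k ≤ n, Metric.ball (polygon ω p k 1) (12 * r) ⊆
      Metric.ball (polygon ω p k 1) (12 * r) \ Ω.pts (m k + 15 * r) := fun k hk => by
    rw [polygon_one]
    exact hdis k hk
  let f : ℕ → ℂ → ℂ := fun k u => Φ (clOf Ω (concat (polygon ω p k) (segPath (p k) (ω + u))))
  have hball : ∀ k, ∀ u ∈ Metric.ball (z k) (8 * r), ω + u ∈ Metric.ball (p k) (12 * r) := by
    intro k u hu
    rw [mem_ball_iff_norm] at hu ⊢
    have h2 := norm_add_le (u - z k) ((ω + z k) - p k)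
    rw [show u - z k + ((ω + z k) - p k) = ω + u - p k by ring, norm_sub_rev (ω + z k)] at h2
    linarith [hp' k]
  have hf : ∀ k ≤ n, AnalyticOnNhd ℂ (f k) (Metric.ball (z k) (8 * r)) := by
    intro k hk u hu
    have hu' := hball k u hu
    refine analyticAt_comp_add (f := fun w => Φ (clOf Ω (concat (polygon ω p k)
      (segPath (p k) w)))) (analyticAt_of_section hΦ ?_ ?_)
    · have := continuousOn_clOf_concat_segPath (hall k hk) (hne k hk) (hlen' k hk) (hstar k)
        (hdis' k hk) (z := ω + u) (by rwa [polygon_one])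
      rwa [polygon_one] at this
    · filter_upwards [Metric.isOpen_ball.mem_nhds hu'] with w hw
      rw [proj_clOf, concat_one, segPath_one]
      refine ⟨_, (hall k hk).pos, (hall k hk).concat_segPath_of_mem_ball (polygon_one p k) ?_
        (hlen' k hk) (disjoint_left.2 fun x hx => (hdis k hk hx).2) hw⟩
      have := hne k hk
      rwa [polygon_one] at this
  have hadd : ∀ u : ℂ, Tendsto (fun x => ω + x) (𝓝 (u - ω)) (𝓝 u) := fun u => by
    have h : ContinuousAt (fun x => ω + x) (u - ω) := by fun_prop
    simpa [ContinuousAt] using h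
  have hpm : ∀ k, p k - ω ∈ Metric.ball (z k) (8 * r) := fun k => by
    rw [mem_ball_iff_norm, show p k - ω - z k = p k - (ω + z k) by ring]
    linarith [hp' k]
  have hz0 : ‖z 0‖ + 8 * r < ρ := by linarith [hch.start]
  refine ⟨f, hf, fun k hk => ?_, ?_⟩
  -- The polygon of index `k + 1` is that of index `k` followed by `[p k, p (k + 1)]`, so a triangle
  -- homotopy identifies the two sections near `p (k + 1)`.
  · have hpm' : p (k + 1) - ω ∈ Metric.ball (z k) (8 * r) := by
      rw [mem_ball_iff_norm]
      have h1 := norm_add_le (p (k + 1) - (ω + z (k + 1))) (z (k + 1) - z k)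
      rw [show p (k + 1) - (ω + z (k + 1)) + (z (k + 1) - z k) = p (k + 1) - ω - z k by ring] at h1
      linarith [hp' (k + 1), hch.step k hk, hch.small k hk]
    refine eqOn_inter_ball (hf k hk.le) (hf (k + 1) hk) hpm' (hpm (k + 1)) ?_
    have hmem := hball k _ hpm'
    rw [add_sub_cancel] at hmem
    have h := eventually_clOf_concat_segPath (hall k hk.le) (hne k hk.le) (hlen' k hk.le) (hstar k)
        (hdis' k hk.le) (z := p (k + 1)) (by rwa [polygon_one])
    rw [polygon_one] at h
    filter_upwards [(hadd (p (k + 1))).eventually h] with x hx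
    exact congrArg Φ hx.symm
  · have hsub : Metric.ball (z 0) (8 * r) ⊆ Metric.ball 0 ρ := by
      refine Metric.ball_subset_ball' ?_
      rw [dist_zero_right]
      linarith
    have hF : AnalyticOnNhd ℂ (fun u => φ (ω + u)) (Metric.ball 0 ρ) := fun u hu =>
      analyticAt_comp_add (hφ _ (by simpa [mem_ball_iff_norm] using hu))
    have key := eqOn_inter_ball (hf 0 (Nat.zero_le n)) hF (hpm 0) (hsub (hpm 0)) ?_
    · rwa [inter_eq_left.2 hsub] at key
    have hp0 : p 0 ∈ Metric.ball ω ρ := by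
      rw [mem_ball_iff_norm, ← sub_zero (p 0 - ω)]
      exact mem_ball_iff_norm.1 (hsub (hpm 0))
    have hU : IsStarDomain ω (Metric.ball ω ρ) := ⟨Metric.isOpen_ball, Metric.mem_ball_self hρ,
      (convex_ball ω ρ).starConvex (Metric.mem_ball_self hρ)⟩
    have hne0 : p 0 ≠ ω := by
      have := hne 0 (Nat.zero_le n)
      rwa [polygon_one] at this
    have h := eventually_clOf_segPath (Ω := Ω) hρ hU (by simp [hΩ]) hp0 hne0
    filter_upwards [(hadd (p 0)).eventually h,
      (hadd (p 0)).eventually (Metric.isOpen_ball.mem_nhds hp0)] with x hx hxb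
    have e := eqOn_of_isHolomorphicOver hΦ hb hρ hΩ hφ hxb
    exact (congrArg Φ hx).trans e

theorem ContinuesToSurface.eventually_continuesAlongChains {φ : ℂ → ℂ}
    (h : ContinuesToSurface Ω φ) :
    ∀ᶠ ρ in 𝓝[>] 0, ContinuesAlongChains Ω ρ (fun u => φ (ω + u)) := by
  obtain ⟨hφ, Φ, hΦ, hb⟩ := h
  have hpω : Surface.proj Ω (Surface.base Ω) = ω := rfl
  rw [hpω] at hφ
  obtain ⟨R, hR, hball⟩ := Metric.eventually_nhds_iff_ball.1 hφ.eventually_analyticAt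
  filter_upwards [Ω.pts_small, Ioo_mem_nhdsGT hR] with ρ hΩ hρ
  have hφρ : AnalyticOnNhd ℂ φ (Metric.ball ω ρ) := fun z hz =>
    hball z (Metric.ball_subset_ball hρ.2.le hz)
  have hF : AnalyticOnNhd ℂ (fun u => φ (ω + u)) (Metric.ball 0 ρ) := fun u hu =>
    analyticAt_comp_add (hφρ _ (by simpa [mem_ball_iff_norm] using hu))
  refine ⟨hρ.1, hΩ, hF, fun n z m r hr hrρ hch hm0 hmar => ?_⟩
  -- While the clock is below `ρ / 2` no margin is available, but none is needed: the discs lie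
  -- where the germ is analytic. Only the remaining part of the chain is lifted to the surface.
  refine hch.chainContinues_of_tail hF (σ := ρ / 2) (by linarith) hr.le hm0 ?_
  intro k hk hmk hj
  refine chainContinues_of_surface hΦ hb hρ.1 hΩ hφρ hr hrρ (hch.tail hk) hmk fun i hi => ?_
  exact (hmar (k + i) (by omega)).resolve_left (not_lt.2 (hj (k + i) (by omega) (by omega)))

end Endless

namespace Endless

/-! ### Integrals over segments -/

/-- The integral of `k` over the segment from `a` to `b`. -/
noncomputable def segInt (k : ℂ → ℂ) (a b : ℂ) : ℂ :=
  ∫ s in (0 : ℝ)..1, k (segPath a b s) * (b - a)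

theorem segInt_self (k : ℂ → ℂ) (a : ℂ) : segInt k a a = 0 := by simp [segInt]

theorem segInt_congr {k k' : ℂ → ℂ} {a b : ℂ} (h : ∀ η ∈ segment ℝ a b, k η = k' η) :
    segInt k a b = segInt k' a b := by
  refine intervalIntegral.integral_congr fun s hs => ?_
  rw [uIcc_of_le zero_le_one] at hs
  simp only [h _ (segPath_mem_segment a b hs)]

theorem exists_primitive {k : ℂ → ℂ} {c : ℂ} {R : ℝ} (hk : DifferentiableOn ℂ k (Metric.ball c R)) :
    ∃ P : ℂ → ℂ, ∀ a ∈ Metric.ball c R, ∀ b ∈ Metric.ball c R, segInt k a b = P b - P a := by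
  obtain ⟨P, hP⟩ := hk.isExactOn_ball
  refine ⟨P, fun a ha b hb => ?_⟩
  have hmem : ∀ s ∈ uIcc (0 : ℝ) 1, segPath a b s ∈ Metric.ball c R := fun s hs =>
    segPath_mem_ball ha hb (by rwa [uIcc_of_le zero_le_one] at hs)
  have h := intervalIntegral.integral_eq_sub_of_hasDerivAt (a := 0) (b := 1)
    (f := fun s => P (segPath a b s)) (f' := fun s => k (segPath a b s) * (b - a))
    (fun s hs => (hP _ (hmem s hs)).comp s (hasDerivAt_segPath a b s)) ?_
  · rw [segInt, h, segPath_one, segPath_zero]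
  · exact ((hk.continuousOn.comp (continuous_segPath a b).continuousOn hmem).mul
      continuousOn_const).intervalIntegrable

theorem hasDerivAt_integral_of_continuousOn {G G' : ℂ → ℝ → ℂ} {U : Set ℂ} (hU : IsOpen U)
    (hG : ContinuousOn (fun q : ℂ × ℝ => G q.1 q.2) (U ×ˢ Icc 0 1))
    (hG' : ContinuousOn (fun q : ℂ × ℝ => G' q.1 q.2) (U ×ˢ Icc 0 1))
    (hd : ∀ ζ ∈ U, ∀ s ∈ Icc (0 : ℝ) 1, HasDerivAt (fun x => G x s) (G' ζ s) ζ) {ζ : ℂ}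
    (hζ : ζ ∈ U) :
    HasDerivAt (fun x => ∫ s in (0 : ℝ)..1, G x s) (∫ s in (0 : ℝ)..1, G' ζ s) ζ := by
  obtain ⟨ε, hε, hb⟩ := Metric.nhds_basis_closedBall.mem_iff.1 (hU.mem_nhds hζ)
  obtain ⟨C, hC⟩ := ((isCompact_closedBall ζ ε).prod isCompact_Icc).exists_bound_of_continuousOn
    (hG'.mono (prod_mono hb le_rfl))
  have hslice : ∀ {K : ℂ → ℝ → ℂ}, ContinuousOn (fun q : ℂ × ℝ => K q.1 q.2) (U ×ˢ Icc 0 1) →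
      ∀ x ∈ U, ContinuousOn (K x) (uIcc 0 1) := fun hK x hx => by
    rw [uIcc_of_le zero_le_one]
    exact hK.comp (f := fun s : ℝ => (x, s)) (by fun_prop) fun s hs => ⟨hx, hs⟩
  have hmem : ∀ s ∈ uIoc (0 : ℝ) 1, s ∈ Icc (0 : ℝ) 1 := fun s hs => by
    rw [uIoc_of_le zero_le_one] at hs
    exact ⟨hs.1.le, hs.2⟩
  refine (intervalIntegral.hasDerivAt_integral_of_dominated_loc_of_deriv_le (F' := G')
    (bound := fun _ => C) (Metric.closedBall_mem_nhds ζ hε) ?_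
    (hslice hG ζ hζ).intervalIntegrable ?_ ?_ intervalIntegrable_const ?_).2
  · filter_upwards [hU.mem_nhds hζ] with x hx
    exact (hslice hG x hx).intervalIntegrable.def'.aestronglyMeasurable
  · exact (hslice hG' ζ hζ).intervalIntegrable.def'.aestronglyMeasurable
  · exact Eventually.of_forall fun s hs x hx => hC (x, s) ⟨hx, hmem s hs⟩
  · exact Eventually.of_forall fun s hs x hx => hd x (hb hx) s (hmem s hs)

/-- The end point is affine in `ζ` in order to treat at once the edges between fixed vertices (`e =
0`) and the edge that ends at `ζ` (`e = 1`). -/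
theorem analyticOnNhd_segInt {f g : ℂ → ℂ} {D D' U : Set ℂ} (hU : IsOpen U)
    (hf : AnalyticOnNhd ℂ f D) (hg : AnalyticOnNhd ℂ g D') {a β e : ℂ}
    (hm : ∀ ζ ∈ U, ∀ s ∈ Icc (0 : ℝ) 1, segPath a (β + e * ζ) s ∈ D)
    (hm' : ∀ ζ ∈ U, ∀ s ∈ Icc (0 : ℝ) 1, ζ - segPath a (β + e * ζ) s ∈ D') :
    AnalyticOnNhd ℂ (fun ζ => segInt (fun η => f η * g (ζ - η)) a (β + e * ζ)) U := by
  refine DifferentiableOn.analyticOnNhd (fun ζ hζ => ?_) hU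
  let A : ℂ × ℝ → ℂ := fun q => segPath a (β + e * q.1) q.2
  have hA : Continuous A := by
    simp only [A, segPath]
    fun_prop
  have cf : ∀ {k : ℂ → ℂ}, AnalyticOnNhd ℂ k D →
      ContinuousOn (fun q : ℂ × ℝ => k (A q)) (U ×ˢ Icc 0 1) := fun hk =>
    hk.continuousOn.comp hA.continuousOn fun q hq => hm q.1 hq.1 q.2 hq.2
  have cg : ∀ {k : ℂ → ℂ}, AnalyticOnNhd ℂ k D' →
      ContinuousOn (fun q : ℂ × ℝ => k (q.1 - A q)) (U ×ˢ Icc 0 1) := fun hk =>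
    hk.continuousOn.comp (by fun_prop) fun q hq => hm' q.1 hq.1 q.2 hq.2
  have c1 : Continuous fun q : ℂ × ℝ => β + e * q.1 - a := by fun_prop
  refine (hasDerivAt_integral_of_continuousOn hU
    (G := fun ζ s => f (A (ζ, s)) * g (ζ - A (ζ, s)) * (β + e * ζ - a))
    (G' := fun ζ s => (deriv f (A (ζ, s)) * (s * e) * g (ζ - A (ζ, s)) +
      f (A (ζ, s)) * (deriv g (ζ - A (ζ, s)) * (1 - s * e))) * (β + e * ζ - a) +
      f (A (ζ, s)) * g (ζ - A (ζ, s)) * e) ?_ ?_ ?_ hζ).differentiableAt.differentiableWithinAt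
  · exact ((cf hf).mul (cg hg)).mul c1.continuousOn
  · have c2 : Continuous fun q : ℂ × ℝ => (q.2 : ℂ) * e := by fun_prop
    refine ((((cf hf.deriv).mul c2.continuousOn).mul (cg hg)).add
      ((cf hf).mul ((cg hg.deriv).mul ?_))).mul c1.continuousOn |>.add
      (((cf hf).mul (cg hg)).mul continuousOn_const)
    exact (continuous_const.sub c2).continuousOn
  · intro x hx s hs
    have h1 : HasDerivAt (fun x => β + e * x) e x := by
      simpa using ((hasDerivAt_id x).const_mul e).const_add β
    have h2 : HasDerivAt (fun x => A (x, s)) (s * e) x :=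
      ((h1.sub_const a).const_mul (s : ℂ)).const_add a
    have h3 := (hf _ (hm x hx s hs)).differentiableAt.hasDerivAt.comp x h2
    have h4 := (hg _ (hm' x hx s hs)).differentiableAt.hasDerivAt.comp x ((hasDerivAt_id x).sub h2)
    exact (h3.mul h4).mul (h1.sub_const a)

/-! ### Discretised convolution -/

/-- The convolution product of germs at `0`. -/
noncomputable def convZero (f g : ℂ → ℂ) (u : ℂ) : ℂ := segInt (fun η => f η * g (u - η)) 0 u

theorem convolution_add (ω : ℂ) (φ ψ : ℂ → ℂ) (u : ℂ) : convolution ω φ ψ (ω + u) =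
    convZero (fun x => φ (ω + x)) (fun x => ψ (ω + x)) u := by
  unfold convolution convZero segInt
  congr 1
  funext s
  have h : segPath ω (ω + u) s = ω + segPath 0 u s := by simp [segPath]
  rw [h, show ω + u + ω - (ω + segPath 0 u s) = ω + (u - segPath 0 u s) by ring, add_sub_cancel_left,
    sub_zero]

theorem analyticOnNhd_convZero {f g : ℂ → ℂ} {ρ : ℝ} (hf : AnalyticOnNhd ℂ f (Metric.ball 0 ρ))
    (hg : AnalyticOnNhd ℂ g (Metric.ball 0 ρ)) :
    AnalyticOnNhd ℂ (convZero f g) (Metric.ball 0 ρ) := by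
  have h := analyticOnNhd_segInt (a := 0) (β := 0) (e := 1) (U := Metric.ball (0 : ℂ) ρ)
    Metric.isOpen_ball hf hg ?_ ?_
  · simp only [zero_add, one_mul] at h
    exact h
  · intro ζ hζ s hs
    rw [zero_add, one_mul]
    exact segPath_mem_ball (Metric.mem_ball_self (Metric.pos_of_mem_ball hζ)) hζ hs
  · intro ζ hζ s hs
    rw [zero_add, one_mul]
    have := segPath_mem_ball (Metric.mem_ball_self (Metric.pos_of_mem_ball hζ)) hζ
      (t := 1 - s) ⟨by linarith [hs.2], by linarith [hs.1]⟩
    convert this using 1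
    simp [segPath]
    ring

/-- A grid of discs of radius `8 r` centred at `c k j`, `k ≤ n`, `j ≤ N`, with mesh `r`, and
functions on these discs that continue `F` in the direction of `k`. -/
structure GridContinuation (n N : ℕ) (c : ℕ → ℕ → ℂ) (r : ℝ) (F : ℂ → ℂ) (f : ℕ → ℕ → ℂ → ℂ) :
    Prop where
  mesh_left : ∀ k < n, ∀ j ≤ N, ‖c (k + 1) j - c k j‖ ≤ r
  mesh_right : ∀ k ≤ n, ∀ j < N, ‖c k (j + 1) - c k j‖ ≤ r
  analytic : ∀ k ≤ n, ∀ j ≤ N, AnalyticOnNhd ℂ (f k j) (Metric.ball (c k j) (8 * r))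
  eqOn_left : ∀ k < n, ∀ j ≤ N, EqOn (f k j) (f (k + 1) j)
    (Metric.ball (c k j) (8 * r) ∩ Metric.ball (c (k + 1) j) (8 * r))
  eqOn_zero : ∀ j ≤ N, EqOn (f 0 j) F (Metric.ball (c 0 j) (8 * r))

/-- By induction on `k`, starting from `k = 0` where all functions are `F`. In the inductive step `c
(k + 1) j` lies in the four discs involved, and the identity theorem transfers the agreement. -/
theorem GridContinuation.eqOn_right {n N : ℕ} {c : ℕ → ℕ → ℂ} {r : ℝ} {F : ℂ → ℂ}
    {f : ℕ → ℕ → ℂ → ℂ} (h : GridContinuation n N c r F f) (hr : 0 < r) {k : ℕ} (hk : k ≤ n)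
    {j : ℕ} (hj : j < N) : EqOn (f k j) (f k (j + 1))
      (Metric.ball (c k j) (8 * r) ∩ Metric.ball (c k (j + 1)) (8 * r)) := by
  induction k with
  | zero => exact fun u hu => (h.eqOn_zero j hj.le hu.1).trans (h.eqOn_zero (j + 1) hj hu.2).symm
  | succ k ih =>
    have ih := ih (Nat.le_of_succ_le hk)
    have m1 := h.mesh_left k hk j hj.le
    have m2 := h.mesh_right k (Nat.le_of_succ_le hk) j hj
    have m3 := h.mesh_right (k + 1) hk j hj
    have p0 : c (k + 1) j ∈ Metric.ball (c (k + 1) j) (8 * r) :=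
      Metric.mem_ball_self (by linarith)
    have p1 : c (k + 1) j ∈ Metric.ball (c k j) (8 * r) := by
      rw [mem_ball_iff_norm]
      linarith
    have p2 : c (k + 1) j ∈ Metric.ball (c k (j + 1)) (8 * r) := by
      rw [mem_ball_iff_norm]
      have := norm_sub_le (c (k + 1) j - c k j) (c k (j + 1) - c k j)
      rw [sub_sub_sub_cancel_right] at this
      linarith
    have p3 : c (k + 1) j ∈ Metric.ball (c (k + 1) (j + 1)) (8 * r) := by
      rw [mem_ball_iff_norm, norm_sub_rev]
      linarith
    refine eqOn_inter_ball (h.analytic (k + 1) hk j hj.le) (h.analytic (k + 1) hk (j + 1) hj)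
      p0 p3 ?_
    filter_upwards [Metric.isOpen_ball.mem_nhds p0, Metric.isOpen_ball.mem_nhds p1,
      Metric.isOpen_ball.mem_nhds p2, Metric.isOpen_ball.mem_nhds p3] with u h0 h1 h2 h3
    rw [← h.eqOn_left k hk j hj.le ⟨h1, h0⟩, ih ⟨h1, h2⟩, h.eqOn_left k hk (j + 1) hj ⟨h2, h3⟩]

/-- The vertices of the polygon of integration from `0` to `ζ`. -/
noncomputable def vertex (N : ℕ) (h : ℕ → ℂ) (ζ : ℂ) (j : ℕ) : ℂ := if j = N then ζ else h j

/-- Near `z k` the continuation is the integral of `f(η) g(ζ - η)` over the polygon with vertices `h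
k j`, the last of which is replaced by `ζ`. By Cauchy's theorem in each small quadrilateral, passing
from `k` to `k + 1` changes it by a telescoping sum of integrals over transversal edges; the extreme
ones vanish, as all polygons go from `0` to `ζ`. With `ζ` in a disc of radius `2 * r` and `η` in one
of radius `6 * r`, the difference `ζ - η` stays in the disc of radius `8 * r` where `g` is analytic.
-/
theorem chainContinues_convZero {n N : ℕ} {z : ℕ → ℂ} {h : ℕ → ℕ → ℂ} {r ρ : ℝ}
    {φ ψ : ℂ → ℂ} {f g : ℕ → ℕ → ℂ → ℂ} (hr : 0 < r) (hN : 0 < N)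
    (hφ : AnalyticOnNhd ℂ φ (Metric.ball 0 ρ)) (hψ : AnalyticOnNhd ℂ ψ (Metric.ball 0 ρ))
    (hrρ : 32 * r ≤ ρ) (hz0 : ‖z 0‖ ≤ ρ / 8) (hzs : ∀ k < n, ‖z (k + 1) - z k‖ ≤ r)
    (hh0 : ∀ k ≤ n, h k 0 = 0) (hhN : ∀ k ≤ n, h k N = z k) (hh : ∀ j ≤ N, ‖h 0 j‖ ≤ ‖z 0‖)
    (hf : GridContinuation n N h r φ f)
    (hg : GridContinuation n N (fun k j => z k - h k j) r ψ g) :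
    ChainContinues (convZero φ ψ) (2 * r) n z := by
  let e : ℕ → ℂ → ℕ → ℂ := fun k => vertex N (h k)
  have e_lt : ∀ k ζ, ∀ j < N, e k ζ j = h k j := fun k ζ j hj => if_neg hj.ne
  have e_N : ∀ k ζ, e k ζ N = ζ := fun k ζ => if_pos rfl
  let F : ℕ → ℂ → ℂ := fun k ζ => ∑ j ∈ Finset.range N,
    segInt (fun η => f k j η * g k j (ζ - η)) (e k ζ j) (e k ζ (j + 1))
  have hNn : ∀ k ≤ n, ∀ j < N, j + 1 = N → ‖z k - h k j‖ ≤ r := fun k hk j hj hjN => by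
    have := hf.mesh_right k hk j hj
    rwa [hjN, hhN k hk] at this
  have he_mem : ∀ k ≤ n, ∀ ζ ∈ Metric.ball (z k) (2 * r), ∀ j < N,
      e k ζ (j + 1) ∈ Metric.ball (h k j) (6 * r) := by
    intro k hk ζ hζ j hj
    rw [mem_ball_iff_norm] at hζ ⊢
    rcases Nat.lt_or_eq_of_le (Nat.succ_le_of_lt hj) with h1 | h1
    · rw [e_lt k ζ (j + 1) h1]
      linarith [hf.mesh_right k hk j hj]
    · rw [show j + 1 = N from h1, e_N]
      have := norm_add_le (ζ - z k) (z k - h k j)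
      rw [sub_add_sub_cancel] at this
      linarith [hNn k hk j hj h1]
  have hgm : ∀ k, ∀ ζ ∈ Metric.ball (z k) (2 * r), ∀ j, ∀ η ∈ Metric.ball (h k j) (6 * r),
      ζ - η ∈ Metric.ball (z k - h k j) (8 * r) := by
    intro k ζ hζ j η hη
    rw [mem_ball_iff_norm] at hζ hη ⊢
    have := norm_sub_le (ζ - z k) (η - h k j)
    rw [show ζ - z k - (η - h k j) = ζ - η - (z k - h k j) by ring] at this
    linarith
  have hfm : ∀ k j, Metric.ball (h k j) (6 * r) ⊆ Metric.ball (h k j) (8 * r) := fun k j =>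
    Metric.ball_subset_ball (by linarith)
  have hself : ∀ k j, h k j ∈ Metric.ball (h k j) (6 * r) := fun k j =>
    Metric.mem_ball_self (by linarith)
  have hF : ∀ k ≤ n, AnalyticOnNhd ℂ (F k) (Metric.ball (z k) (2 * r)) := by
    intro k hk
    refine Finset.analyticOnNhd_fun_sum _ fun j hj => ?_
    rw [Finset.mem_range] at hj
    have key : ∃ β e₁ : ℂ, ∀ ζ, e k ζ (j + 1) = β + e₁ * ζ := by
      rcases Nat.lt_or_eq_of_le (Nat.succ_le_of_lt hj) with h1 | h1
      · exact ⟨h k (j + 1), 0, fun ζ => by rw [e_lt k ζ (j + 1) h1]; ring⟩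
      · exact ⟨0, 1, fun ζ => by rw [show j + 1 = N from h1, e_N]; ring⟩
    obtain ⟨β, e₁, hβ⟩ := key
    have hseg : ∀ ζ ∈ Metric.ball (z k) (2 * r), ∀ s ∈ Icc (0 : ℝ) 1,
        segPath (h k j) (β + e₁ * ζ) s ∈ Metric.ball (h k j) (6 * r) := by
      intro ζ hζ s hs
      rw [← hβ]
      exact segPath_mem_ball (hself k j) (he_mem k hk ζ hζ j hj) hs
    simp only [hβ, fun ζ => e_lt k ζ j hj]
    exact analyticOnNhd_segInt Metric.isOpen_ball (hf.analytic k hk j hj.le)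
      (hg.analytic k hk j hj.le) (fun ζ hζ s hs => hfm k j (hseg ζ hζ s hs))
      fun ζ hζ s hs => hgm k ζ hζ j _ (hseg ζ hζ s hs)
  have hprim : ∀ k ≤ n, ∀ ζ ∈ Metric.ball (z k) (2 * r), ∀ j < N, ∃ P : ℂ → ℂ,
      ∀ a ∈ Metric.ball (h k j) (6 * r), ∀ b ∈ Metric.ball (h k j) (6 * r),
        segInt (fun η => f k j η * g k j (ζ - η)) a b = P b - P a := by
    intro k hk ζ hζ j hj
    refine exists_primitive fun η hη => DifferentiableAt.differentiableWithinAt ?_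
    have d1 := (hf.analytic k hk j hj.le _ (hfm k j hη)).differentiableAt
    have d2 := (hg.analytic k hk j hj.le _ (hgm k ζ hζ j η hη)).differentiableAt
    exact d1.mul (d2.comp η (f := fun η => ζ - η) (by fun_prop))
  refine ⟨F, hF, fun k hk => ?_, fun ζ hζ => ?_⟩
  · have hzk := hzs k hk
    refine eqOn_inter_ball (hF k hk.le) (hF (k + 1) hk) (u := z (k + 1))
      (by rw [mem_ball_iff_norm]; linarith) (Metric.mem_ball_self (by linarith)) ?_
    filter_upwards [Metric.ball_mem_nhds (z (k + 1)) hr] with ζ hζ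
    have hζ1 : ζ ∈ Metric.ball (z (k + 1)) (2 * r) :=
      Metric.ball_subset_ball (by linarith) hζ
    have hζ0 : ζ ∈ Metric.ball (z k) (2 * r) := by
      rw [mem_ball_iff_norm] at hζ ⊢
      have := norm_add_le (ζ - z (k + 1)) (z (k + 1) - z k)
      rw [sub_add_sub_cancel] at this
      linarith
    -- The integral over the transversal edge joining the two polygons at the vertex `j`.
    let c : ℕ → ℂ := fun j =>
      segInt (fun η => f k j η * g k j (ζ - η)) (e k ζ j) (e (k + 1) ζ j)
    have hstep : ∀ j ∈ Finset.range N,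
        segInt (fun η => f (k + 1) j η * g (k + 1) j (ζ - η)) (e (k + 1) ζ j)
            (e (k + 1) ζ (j + 1)) -
          segInt (fun η => f k j η * g k j (ζ - η)) (e k ζ j) (e k ζ (j + 1)) =
        c (j + 1) - c j := by
      intro j hj
      rw [Finset.mem_range] at hj
      have q0 : e k ζ j ∈ Metric.ball (h k j) (6 * r) := by
        rw [e_lt k ζ j hj]
        exact hself k j
      have q1 := he_mem k hk.le ζ hζ0 j hj
      have hml := hf.mesh_left k hk j hj.le
      have q2 : e (k + 1) ζ j ∈ Metric.ball (h k j) (6 * r) := by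
        rw [e_lt (k + 1) ζ j hj, mem_ball_iff_norm]
        linarith
      have q3 : e (k + 1) ζ (j + 1) ∈ Metric.ball (h k j) (6 * r) := by
        rcases Nat.lt_or_eq_of_le (Nat.succ_le_of_lt hj) with h1 | h1
        · rw [e_lt (k + 1) ζ (j + 1) h1, mem_ball_iff_norm]
          have := norm_add_le (h (k + 1) (j + 1) - h (k + 1) j) (h (k + 1) j - h k j)
          rw [sub_add_sub_cancel] at this
          linarith [hf.mesh_right (k + 1) hk j hj]
        · have := q1
          rw [show j + 1 = N from h1, e_N] at this ⊢
          exact this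
      have q2' : e (k + 1) ζ j ∈ Metric.ball (h (k + 1) j) (6 * r) := by
        rw [e_lt (k + 1) ζ j hj]
        exact hself (k + 1) j
      have q3' := he_mem (k + 1) hk ζ hζ1 j hj
      obtain ⟨P, hP⟩ := hprim k hk.le ζ hζ0 j hj
      have s1 : segInt (fun η => f (k + 1) j η * g (k + 1) j (ζ - η)) (e (k + 1) ζ j)
          (e (k + 1) ζ (j + 1)) =
          segInt (fun η => f k j η * g k j (ζ - η)) (e (k + 1) ζ j) (e (k + 1) ζ (j + 1)) := by
        refine segInt_congr fun η hη => ?_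
        have t0 := (convex_ball (h k j) (6 * r)).segment_subset q2 q3 hη
        have t1 := (convex_ball (h (k + 1) j) (6 * r)).segment_subset q2' q3' hη
        rw [hf.eqOn_left k hk j hj.le ⟨hfm k j t0, hfm (k + 1) j t1⟩,
          hg.eqOn_left k hk j hj.le ⟨hgm k ζ hζ0 j η t0, hgm (k + 1) ζ hζ1 j η t1⟩]
      -- The transversal edge at the vertex `j + 1` borders two quadrilaterals; there the functions
      -- of index `j` and `j + 1` agree by `eqOn_right`, which makes the sum telescope.
      have s2 : c (j + 1) =
          segInt (fun η => f k j η * g k j (ζ - η)) (e k ζ (j + 1)) (e (k + 1) ζ (j + 1)) := by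
        rcases Nat.lt_or_eq_of_le (Nat.succ_le_of_lt hj) with h1 | h1
        · refine segInt_congr fun η hη => ?_
          have t0 := (convex_ball (h k j) (6 * r)).segment_subset q1 q3 hη
          have t1 : η ∈ Metric.ball (h k (j + 1)) (6 * r) := by
            refine (convex_ball (h k (j + 1)) (6 * r)).segment_subset ?_ ?_ hη
            · rw [e_lt k ζ (j + 1) h1]
              exact hself k (j + 1)
            · rw [e_lt (k + 1) ζ (j + 1) h1, mem_ball_iff_norm]
              linarith [hf.mesh_left k hk (j + 1) h1.le]
          rw [hf.eqOn_right hr hk.le hj ⟨hfm k j t0, hfm k (j + 1) t1⟩,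
            hg.eqOn_right hr hk.le hj ⟨hgm k ζ hζ0 j η t0, hgm k ζ hζ0 (j + 1) η t1⟩]
        · simp only [c]
          rw [show j + 1 = N from h1, e_N, e_N, segInt_self, segInt_self]
      rw [s1, s2, hP _ q2 _ q3, hP _ q0 _ q1, hP _ q1 _ q3]
      simp only [c]
      rw [hP _ q0 _ q2]
      ring
    have htel : F (k + 1) ζ - F k ζ = c N - c 0 := by
      simp only [F]
      rw [← Finset.sum_sub_distrib, Finset.sum_congr rfl hstep, Finset.sum_range_sub]
    have hcN : c N = 0 := by
      simp only [c]
      rw [e_N, e_N, segInt_self]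
    have hc0 : c 0 = 0 := by
      simp only [c]
      rw [e_lt k ζ 0 hN, e_lt (k + 1) ζ 0 hN, hh0 k hk.le, hh0 (k + 1) hk, segInt_self]
    rw [hcN, hc0, sub_zero, sub_eq_zero] at htel
    exact htel.symm
  · have h0n := Nat.zero_le n
    have hζn : ‖ζ‖ < ρ / 2 := by
      have := norm_add_le (ζ - z 0) (z 0)
      rw [sub_add_cancel] at this
      linarith [mem_ball_iff_norm.1 hζ]
    -- For `k = 0` the polygon stays in the disc of radius `ρ / 2`, where the integrand has a
    -- primitive, so it can be replaced by the segment from `0` to `ζ`.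
    obtain ⟨P, hP⟩ := exists_primitive (k := fun η => φ η * ψ (ζ - η)) (c := 0) (R := ρ / 2)
      fun η hη => by
        rw [mem_ball_zero_iff] at hη
        have d1 := (hφ η (by rw [mem_ball_zero_iff]; linarith)).differentiableAt
        have d2 := (hψ (ζ - η) (by
          rw [mem_ball_zero_iff]
          linarith [norm_sub_le ζ η])).differentiableAt
        exact (d1.mul (d2.comp η (f := fun η => ζ - η) (by fun_prop))).differentiableWithinAt
    have heb : ∀ j ≤ N, e 0 ζ j ∈ Metric.ball (0 : ℂ) (ρ / 2) := by
      intro j hj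
      rw [mem_ball_zero_iff]
      rcases Nat.lt_or_eq_of_le hj with h1 | h1
      · rw [e_lt 0 ζ j h1]
        linarith [hh j hj]
      · rwa [h1, e_N]
    have hterm : ∀ j ∈ Finset.range N,
        segInt (fun η => f 0 j η * g 0 j (ζ - η)) (e 0 ζ j) (e 0 ζ (j + 1)) =
          P (e 0 ζ (j + 1)) - P (e 0 ζ j) := by
      intro j hj
      rw [Finset.mem_range] at hj
      rw [← hP _ (heb j hj.le) _ (heb (j + 1) hj)]
      refine segInt_congr fun η hη => ?_
      have t0 : η ∈ Metric.ball (h 0 j) (6 * r) := by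
        refine (convex_ball _ _).segment_subset ?_ (he_mem 0 h0n ζ hζ j hj) hη
        rw [e_lt 0 ζ j hj]
        exact hself 0 j
      rw [hf.eqOn_zero j hj.le (hfm 0 j t0), hg.eqOn_zero j hj.le (hgm 0 ζ hζ j η t0)]
    simp only [F, convZero]
    rw [Finset.sum_congr rfl hterm, Finset.sum_range_sub (fun j => P (e 0 ζ j)), ← hP _
      (heb 0 hN.le) _ (heb N le_rfl), e_N, e_lt 0 ζ 0 hN, hh0 0 h0n]

end Endless

namespace Endless

variable {ω : ℂ}

/-! ### The deformation of the path of integration -/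

/-- The explicit Euler scheme that drags the segment from `0` to `q 0` along the points `q k`: the
point `x` follows the motion in proportion to its margin with respect to `Ω`, compared with the
margin of `q k - x` with respect to `Ω'`. -/
noncomputable def eulerFlow (Ω Ω' : DiscreteFilteredSet ω) (q : ℕ → ℝ × ℂ) (s : ℝ) : ℕ → ℝ × ℂ
  | 0 => s • q 0
  | k + 1 => eulerFlow Ω Ω' q s k +
      (margin Ω (eulerFlow Ω Ω' q s k) / (margin Ω (eulerFlow Ω Ω' q s k) +
        margin Ω' (q k - eulerFlow Ω Ω' q s k))) • (q (k + 1) - q k)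

/-- The points `q k = (m k, z k)`, `k ≤ n`, form a chain that keeps the distance `δ` from the
fine sum of the singular sets. -/
structure IsDeepChain (Ω Ω' : DiscreteFilteredSet ω) (n : ℕ) (q : ℕ → ℝ × ℂ) (r δ : ℝ) : Prop where
  chain : IsChain n (fun k => (q k).2) (fun k => (q k).1) r
  pos : 0 < δ
  le_margin : ∀ k ≤ n, ∀ x, δ ≤ margin Ω x + margin Ω' (q k - x)
  small : r ≤ δ / 2

namespace IsDeepChain

variable {Ω Ω' : DiscreteFilteredSet ω} {n : ℕ} {q : ℕ → ℝ × ℂ} {r δ : ℝ}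

theorem symm (h : IsDeepChain Ω Ω' n q r δ) : IsDeepChain Ω' Ω n q r δ :=
  ⟨h.chain, h.pos, fun k hk x => by
    have := h.le_margin k hk (q k - x)
    rw [sub_sub_cancel] at this
    linarith, h.small⟩

/-- The proportions `A / (A + B)` and `B / (A + B)` add up to `1`, so the remainder `q k - x` obeys
the scheme with the two filtered sets exchanged. -/
theorem sub_eulerFlow (h : IsDeepChain Ω Ω' n q r δ) (s : ℝ) {k : ℕ} (hk : k ≤ n) :
    q k - eulerFlow Ω Ω' q s k = eulerFlow Ω' Ω q (1 - s) k := by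
  induction k with
  | zero =>
    simp only [eulerFlow]
    module
  | succ k ih =>
    have ih := ih (Nat.le_of_succ_le hk)
    have hδ := h.le_margin k (Nat.le_of_succ_le hk) (eulerFlow Ω Ω' q s k)
    simp only [eulerFlow]
    rw [← ih, sub_sub_cancel]
    set A := margin Ω (eulerFlow Ω Ω' q s k)
    set B := margin Ω' (q k - eulerFlow Ω Ω' q s k)
    have hAB : 0 < A + B := h.pos.trans_le hδ
    have e : B / (B + A) = 1 - A / (A + B) := by
      rw [add_comm B A, eq_sub_iff_add_eq, ← add_div, add_comm B A, div_self hAB.ne']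
    rw [e]
    module

theorem exists_ratio (h : IsDeepChain Ω Ω' n q r δ) (s : ℝ) {k : ℕ} (hk : k < n) :
    ∃ l : ℝ, 0 ≤ l ∧ l ≤ 1 ∧ l * δ ≤ margin Ω (eulerFlow Ω Ω' q s k) ∧
      eulerFlow Ω Ω' q s (k + 1) = eulerFlow Ω Ω' q s k + l • (q (k + 1) - q k) := by
  have hδ := h.le_margin k hk.le (eulerFlow Ω Ω' q s k)
  have hA := margin_nonneg Ω (eulerFlow Ω Ω' q s k)
  have hB := margin_nonneg Ω' (q k - eulerFlow Ω Ω' q s k)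
  have hAB := h.pos.trans_le hδ
  refine ⟨_, div_nonneg hA hAB.le, (div_le_one hAB).2 (le_add_of_nonneg_right hB), ?_, rfl⟩
  rw [div_mul_eq_mul_div, div_le_iff₀ hAB]
  exact mul_le_mul_of_nonneg_left hδ hA

theorem clock_nonneg (h : IsDeepChain Ω Ω' n q r δ) {k : ℕ} (hk : k ≤ n) : 0 ≤ (q k).1 :=
  (norm_nonneg _).trans (h.chain.norm_le hk)

theorem isChain_eulerFlow (h : IsDeepChain Ω Ω' n q r δ) {s : ℝ} (hs : 0 ≤ s) :
    IsChain n (fun k => (eulerFlow Ω Ω' q s k).2) (fun k => (eulerFlow Ω Ω' q s k).1) r := by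
  refine ⟨?_, fun k hk => ?_, fun k hk => ?_⟩
  · simp only [eulerFlow, Prod.smul_snd, Prod.smul_fst, norm_smul, smul_eq_mul, Real.norm_eq_abs,
      abs_of_nonneg hs]
    exact mul_le_mul_of_nonneg_left h.chain.start hs
  · obtain ⟨l, h0, h1, -, e⟩ := h.exists_ratio s hk
    simp only [e, Prod.snd_add, Prod.fst_add, add_sub_cancel_left, Prod.smul_snd, Prod.smul_fst,
      norm_smul, smul_eq_mul, Real.norm_eq_abs, abs_of_nonneg h0, Prod.snd_sub, Prod.fst_sub]
    exact mul_le_mul_of_nonneg_left (h.chain.step k hk) h0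
  · obtain ⟨l, h0, h1, -, e⟩ := h.exists_ratio s hk
    simp only [e, Prod.fst_add, add_sub_cancel_left, Prod.smul_fst, smul_eq_mul, Prod.fst_sub]
    have := (norm_nonneg _).trans (h.chain.step k hk)
    exact (mul_le_of_le_one_left this h1).trans (h.chain.small k hk)

theorem dist_eulerFlow (h : IsDeepChain Ω Ω' n q r δ) (s : ℝ) {k : ℕ} (hk : k < n) :
    dist (eulerFlow Ω Ω' q s k) (eulerFlow Ω Ω' q s (k + 1)) ≤
      margin Ω (eulerFlow Ω Ω' q s k) * (((q (k + 1)).1 - (q k).1) / δ) := by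
  obtain ⟨l, h0, h1, h2, e⟩ := h.exists_ratio s hk
  have hst := h.chain.step k hk
  have hd := (norm_nonneg _).trans hst
  have hn : ‖q (k + 1) - q k‖ ≤ (q (k + 1)).1 - (q k).1 := by
    rw [Prod.norm_def, Prod.fst_sub, Prod.snd_sub, Real.norm_eq_abs]
    exact max_le (abs_of_nonneg hd).le hst
  rw [e, dist_self_add_right, norm_smul, Real.norm_eq_abs, abs_of_nonneg h0, mul_div_assoc',
    le_div_iff₀ h.pos]
  calc l * ‖q (k + 1) - q k‖ * δ = l * δ * ‖q (k + 1) - q k‖ := by ring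
    _ ≤ _ := mul_le_mul h2 hn (norm_nonneg _) (margin_nonneg _ _)

/-- A discrete Gronwall bound: the margin is `1`-Lipschitz and a step moves the point by at most the
margin times `x`, where `x` is the clock increment of `q` over `δ`. Since `r ≤ δ / 2` forces `x ≤ 1
/ 2`, the factor `1 - x` is at least `exp (-2x)`. -/
theorem margin_eulerFlow (h : IsDeepChain Ω Ω' n q r δ) (s : ℝ) {k : ℕ} (hk : k ≤ n) :
    margin Ω (eulerFlow Ω Ω' q s 0) * Real.exp (-(2 * ((q k).1 - (q 0).1) / δ)) ≤
      margin Ω (eulerFlow Ω Ω' q s k) := by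
  induction k with
  | zero => simp
  | succ k ih =>
    have ih := ih (Nat.le_of_succ_le hk)
    have h1 := margin_le_add_dist Ω (eulerFlow Ω Ω' q s k) (eulerFlow Ω Ω' q s (k + 1))
    have h2 := h.dist_eulerFlow s (k := k) hk
    have hM := margin_nonneg Ω (eulerFlow Ω Ω' q s k)
    set x := ((q (k + 1)).1 - (q k).1) / δ with hx
    have hx0 : 0 ≤ x := div_nonneg ((norm_nonneg _).trans (h.chain.step k hk)) h.pos.le
    have hx1 : x ≤ 1 / 2 := by
      rw [hx, div_le_iff₀ h.pos]
      linarith [h.chain.small k hk, h.small]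
    have hexp : Real.exp (-(2 * x)) ≤ 1 - x := by
      have h3 := Real.add_one_le_exp (2 * x)
      rw [Real.exp_neg, inv_le_comm₀ (Real.exp_pos _) (by linarith)]
      refine le_trans ?_ h3
      rw [inv_le_iff_one_le_mul₀ (by linarith)]
      nlinarith
    have hsplit : -(2 * ((q (k + 1)).1 - (q 0).1) / δ) =
        -(2 * ((q k).1 - (q 0).1) / δ) + -(2 * x) := by
      rw [hx]
      ring
    rw [hsplit, Real.exp_add, ← mul_assoc]
    calc _ ≤ margin Ω (eulerFlow Ω Ω' q s k) * (1 - x) :=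
          mul_le_mul ih hexp (Real.exp_pos _).le hM
      _ ≤ _ := by linarith

/-- The Gronwall bound from above: the margin is at most the norm of the position, hence at most the
clock, so a step multiplies the clock by at most `1 + x`. -/
theorem clock_eulerFlow (h : IsDeepChain Ω Ω' n q r δ) {s : ℝ} (hs : 0 ≤ s) {k : ℕ} (hk : k ≤ n) :
    (eulerFlow Ω Ω' q s k).1 ≤ s * (q 0).1 * Real.exp (((q k).1 - (q 0).1) / δ) := by
  have hch := h.isChain_eulerFlow hs
  induction k with
  | zero => simp [eulerFlow]
  | succ k ih =>
    have hkn := Nat.le_of_succ_le hk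
    have ih := ih hkn
    have h1 := h.dist_eulerFlow s (k := k) hk
    have hpos : 0 ≤ (eulerFlow Ω Ω' q s k).1 := (norm_nonneg _).trans (hch.norm_le hkn)
    have h2 : margin Ω (eulerFlow Ω Ω' q s k) ≤ (eulerFlow Ω Ω' q s k).1 :=
      (margin_le_norm Ω hpos _).trans (hch.norm_le hkn)
    have h3 : (eulerFlow Ω Ω' q s (k + 1)).1 - (eulerFlow Ω Ω' q s k).1 ≤
        dist (eulerFlow Ω Ω' q s k) (eulerFlow Ω Ω' q s (k + 1)) := by
      rw [dist_comm]
      exact (le_abs_self _).trans (le_max_left _ _)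
    set x := ((q (k + 1)).1 - (q k).1) / δ with hx
    have hx0 : 0 ≤ x := div_nonneg ((norm_nonneg _).trans (h.chain.step k hk)) h.pos.le
    have hsplit : ((q (k + 1)).1 - (q 0).1) / δ = ((q k).1 - (q 0).1) / δ + x := by
      rw [hx]
      ring
    rw [hsplit, Real.exp_add, ← mul_assoc]
    calc (eulerFlow Ω Ω' q s (k + 1)).1
        ≤ (eulerFlow Ω Ω' q s k).1 + (eulerFlow Ω Ω' q s k).1 * x := by
          linarith [mul_le_mul_of_nonneg_right h2 hx0]
      _ = (eulerFlow Ω Ω' q s k).1 * (x + 1) := by ring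
      _ ≤ _ := mul_le_mul ih (Real.add_one_le_exp x) (by linarith) (hpos.trans ih)

theorem continuous_eulerFlow (h : IsDeepChain Ω Ω' n q r δ) {k : ℕ} (hk : k ≤ n) :
    Continuous fun s => eulerFlow Ω Ω' q s k := by
  induction k with
  | zero =>
    simp only [eulerFlow]
    fun_prop
  | succ k ih =>
    have ih := ih (Nat.le_of_succ_le hk)
    simp only [eulerFlow]
    have c1 := (continuous_margin Ω).comp ih
    have c2 := (continuous_margin Ω').comp (continuous_const (y := q k) |>.sub ih)
    refine ih.add ((c1.div (c1.add c2) fun s => ?_).smul continuous_const)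
    exact (h.pos.trans_le (h.le_margin k (Nat.le_of_succ_le hk) _)).ne'

theorem eulerFlow_zero (q : ℕ → ℝ × ℂ) (k : ℕ) : eulerFlow Ω Ω' q 0 k = 0 := by
  induction k with
  | zero => simp [eulerFlow]
  | succ k ih => simp [eulerFlow, ih, margin_zero]

theorem eulerFlow_one (h : IsDeepChain Ω Ω' n q r δ) {k : ℕ} (hk : k ≤ n) :
    eulerFlow Ω Ω' q 1 k = q k := by
  have := h.sub_eulerFlow 1 hk
  rw [sub_self, eulerFlow_zero, sub_eq_zero] at this
  exact this.symm

/-- The point is uniformity in `s`. A margin is needed only once the clock of the trajectory is at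
least `ρ / 2`. Since this clock starts below `s * ρ / 8` or at it, that requires `s * exp (Λ / δ) ≥
4`, so `s` is not small. The margin, at least `s * δ` initially, has lost at most the factor `exp
(-2Λ / δ)` and is still at least `16 * r`. -/
theorem chainContinues_eulerFlow (h : IsDeepChain Ω Ω' n q r δ) {ρ Λ : ℝ} {φ : ℂ → ℂ}
    (hφ : ContinuesAlongChains Ω ρ φ) (hr : 0 < r) (hrρ : 32 * r ≤ ρ)
    (hrδ : 4 * r ≤ δ * Real.exp (-(3 * Λ / δ))) (h0 : (q 0).1 ≤ ρ / 8) (hz : δ ≤ ‖(q 0).2‖)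
    (hΛ : (q n).1 ≤ Λ) {s : ℝ} (hs : s ∈ Icc (0 : ℝ) 1) :
    ChainContinues φ (8 * r) n fun k => (eulerFlow Ω Ω' q s k).2 := by
  have hρ := hφ.pos
  have hq0 := h.clock_nonneg (Nat.zero_le n)
  have hlt : s * (q 0).1 < ρ / 2 := by nlinarith [hs.1, hs.2]
  refine hφ.continues n _ _ r hr hrρ (h.isChain_eulerFlow hs.1) (by simpa [eulerFlow] using hlt)
    fun k hk => ?_
  rw [or_iff_not_imp_left, not_lt]
  intro hbig
  have hqk : (q k).1 - (q 0).1 ≤ Λ := by linarith [h.chain.mono hk le_rfl]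
  have e1 : Real.exp (((q k).1 - (q 0).1) / δ) ≤ Real.exp (Λ / δ) :=
    Real.exp_le_exp.2 (div_le_div_of_nonneg_right hqk h.pos.le)
  have e2 : Real.exp (-(2 * Λ / δ)) ≤ Real.exp (-(2 * ((q k).1 - (q 0).1) / δ)) :=
    Real.exp_le_exp.2 (neg_le_neg (div_le_div_of_nonneg_right (by linarith) h.pos.le))
  have c1 := hbig.trans (h.clock_eulerFlow hs.1 hk)
  have c2 : 4 ≤ s * Real.exp (Λ / δ) := by
    have : ρ / 2 ≤ s * (ρ / 8) * Real.exp (Λ / δ) :=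
      c1.trans (mul_le_mul (mul_le_mul_of_nonneg_left h0 hs.1) e1 (Real.exp_pos _).le
        (mul_nonneg hs.1 (by linarith)))
    by_contra hcon
    nlinarith [not_le.1 hcon]
  have c3 : s * δ ≤ margin Ω (eulerFlow Ω Ω' q s 0) := by
    have h1 : ‖s • (q 0).2‖ ≤ s * (q 0).1 := by
      rw [norm_smul, Real.norm_eq_abs, abs_of_nonneg hs.1]
      exact mul_le_mul_of_nonneg_left h.chain.start hs.1
    have h2 := norm_le_margin hφ.pts_eq h1 hlt
    refine le_trans ?_ h2
    rw [norm_smul, Real.norm_eq_abs, abs_of_nonneg hs.1]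
    exact mul_le_mul_of_nonneg_left hz hs.1
  have c4 := h.margin_eulerFlow s hk
  have c5 : s * δ * Real.exp (-(2 * Λ / δ)) ≤ margin Ω (eulerFlow Ω Ω' q s k) :=
    (mul_le_mul c3 e2 (Real.exp_pos _).le (margin_nonneg _ _)).trans c4
  refine le_trans ?_ c5
  -- One factor `exp (Λ / δ)` is paired with `s`, through the lower bound `c2`; this is where the
  -- exponent `3` in the condition on `r` comes from.
  have e3 : Real.exp (-(2 * Λ / δ)) = Real.exp (-(3 * Λ / δ)) * Real.exp (Λ / δ) := by
    rw [← Real.exp_add]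
    congr 1
    ring
  rw [e3]
  calc 16 * r = 4 * (4 * r) := by ring
    _ ≤ (s * Real.exp (Λ / δ)) * (δ * Real.exp (-(3 * Λ / δ))) :=
        mul_le_mul c2 hrδ (by linarith) (by linarith)
    _ = _ := by ring

theorem chainContinues_convZero (h : IsDeepChain Ω Ω' n q r δ) {ρ Λ : ℝ} {φ ψ : ℂ → ℂ}
    (hφ : ContinuesAlongChains Ω ρ φ) (hψ : ContinuesAlongChains Ω' ρ ψ) (hr : 0 < r)
    (hrρ : 32 * r ≤ ρ) (hrδ : 4 * r ≤ δ * Real.exp (-(3 * Λ / δ))) (h0 : (q 0).1 ≤ ρ / 8)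
    (hz : δ ≤ ‖(q 0).2‖) (hΛ : (q n).1 ≤ Λ) :
    ChainContinues (convZero φ ψ) (2 * r) n fun k => (q k).2 := by
  -- `N` comes from uniform continuity in `s` of the finitely many stages. It may depend on the
  -- chain; the radius `r` does not.
  have hmesh : ∃ N : ℕ, 0 < N ∧ ∀ k ≤ n, ∀ j < N,
      ‖(eulerFlow Ω Ω' q (((j + 1 : ℕ) : ℝ) / N) k).2 - (eulerFlow Ω Ω' q ((j : ℝ) / N) k).2‖
        ≤ r := by
    have hc : Continuous fun s => fun k : Fin (n + 1) => (eulerFlow Ω Ω' q s k).2 :=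
      continuous_pi fun k => (h.continuous_eulerFlow (Nat.lt_succ_iff.1 k.2)).snd
    have hu := (isCompact_Icc (a := (0 : ℝ)) (b := 1)).uniformContinuousOn_of_continuous
      hc.continuousOn
    obtain ⟨η, hη, hu⟩ := Metric.uniformContinuousOn_iff.1 hu r hr
    obtain ⟨N, hN⟩ := exists_nat_one_div_lt hη
    refine ⟨N + 1, Nat.succ_pos N, fun k hk j hj => ?_⟩
    have hN0 : (0 : ℝ) < ((N + 1 : ℕ) : ℝ) := by positivity
    have hj' : ((j + 1 : ℕ) : ℝ) ≤ ((N + 1 : ℕ) : ℝ) := by exact_mod_cast hj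
    have hj0 : (j : ℝ) ≤ ((N + 1 : ℕ) : ℝ) := by exact_mod_cast hj.le
    have := hu (((j + 1 : ℕ) : ℝ) / (N + 1 : ℕ)) ⟨by positivity, (div_le_one hN0).2 hj'⟩
      ((j : ℝ) / (N + 1 : ℕ)) ⟨by positivity, (div_le_one hN0).2 hj0⟩ ?_
    · have h3 := (dist_le_pi_dist _ _ (⟨k, Nat.lt_succ_of_le hk⟩ : Fin (n + 1))).trans this.le
      rwa [dist_eq_norm] at h3
    · rw [Real.dist_eq, ← sub_div, Nat.cast_succ j, add_sub_cancel_left, abs_of_pos (by positivity),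
        Nat.cast_succ N]
      exact hN
  obtain ⟨N, hN, hmesh⟩ := hmesh
  have hNR : (0 : ℝ) < N := by exact_mod_cast hN
  have hgrid : ∀ j ≤ N, (j : ℝ) / N ∈ Icc (0 : ℝ) 1 := fun j hj =>
    ⟨by positivity, (div_le_one hNR).2 (by exact_mod_cast hj)⟩
  have hf : ∀ j : ℕ, ∃ f : ℕ → ℂ → ℂ, j ≤ N →
      (∀ k ≤ n, AnalyticOnNhd ℂ (f k)
        (Metric.ball ((eulerFlow Ω Ω' q ((j : ℝ) / N) k).2) (8 * r))) ∧
      (∀ k < n, EqOn (f k) (f (k + 1)) (Metric.ball ((eulerFlow Ω Ω' q ((j : ℝ) / N) k).2) (8 * r) ∩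
        Metric.ball ((eulerFlow Ω Ω' q ((j : ℝ) / N) (k + 1)).2) (8 * r))) ∧
      EqOn (f 0) φ (Metric.ball ((eulerFlow Ω Ω' q ((j : ℝ) / N) 0).2) (8 * r)) := by
    intro j
    by_cases hj : j ≤ N
    · obtain ⟨f, hf⟩ := h.chainContinues_eulerFlow hφ hr hrρ hrδ h0 hz hΛ (hgrid j hj)
      exact ⟨f, fun _ => hf⟩
    · exact ⟨fun _ => φ, fun h => absurd h hj⟩
  choose f hf using hf
  -- The discs needed for `ψ` are centred on the complementary trajectories, which are those of the
  -- exchanged flow with parameter `1 - s`.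
  have hsub : ∀ k ≤ n, ∀ s, (q k).2 - (eulerFlow Ω Ω' q s k).2 =
      (eulerFlow Ω' Ω q (1 - s) k).2 := fun k hk s => by
    rw [← Prod.snd_sub, h.sub_eulerFlow s hk]
  have hg : ∀ j : ℕ, ∃ g : ℕ → ℂ → ℂ, j ≤ N →
      (∀ k ≤ n, AnalyticOnNhd ℂ (g k)
        (Metric.ball ((q k).2 - (eulerFlow Ω Ω' q ((j : ℝ) / N) k).2) (8 * r))) ∧
      (∀ k < n, EqOn (g k) (g (k + 1))
        (Metric.ball ((q k).2 - (eulerFlow Ω Ω' q ((j : ℝ) / N) k).2) (8 * r) ∩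
        Metric.ball ((q (k + 1)).2 - (eulerFlow Ω Ω' q ((j : ℝ) / N) (k + 1)).2) (8 * r))) ∧
      EqOn (g 0) ψ (Metric.ball ((q 0).2 - (eulerFlow Ω Ω' q ((j : ℝ) / N) 0).2) (8 * r)) := by
    intro j
    by_cases hj : j ≤ N
    · have hj1 := hgrid j hj
      obtain ⟨g, h1, h2, h3⟩ := h.symm.chainContinues_eulerFlow hψ hr hrρ hrδ h0 hz hΛ
        (s := 1 - (j : ℝ) / N) ⟨by linarith [hj1.2], by linarith [hj1.1]⟩
      refine ⟨g, fun _ => ⟨fun k hk => ?_, fun k hk => ?_, ?_⟩⟩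
      · rw [hsub k hk]
        exact h1 k hk
      · rw [hsub k hk.le, hsub (k + 1) hk]
        exact h2 k hk
      · rw [hsub 0 (Nat.zero_le n)]
        exact h3
    · exact ⟨fun _ => ψ, fun h => absurd h hj⟩
  choose g hg using hg
  refine Endless.chainContinues_convZero (N := N)
    (h := fun k j => (eulerFlow Ω Ω' q ((j : ℝ) / N) k).2) (f := fun k j => f j k)
    (g := fun k j => g j k) hr hN hφ.analytic hψ.analytic hrρ (h.chain.start.trans h0)
    (fun k hk => (h.chain.step k hk).trans (h.chain.small k hk)) (fun k _ => ?_) (fun k hk => ?_)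
    (fun j hj => ?_) ?_ ?_
  · simp [eulerFlow_zero]
  · simp only [div_self hNR.ne']
    rw [h.eulerFlow_one hk]
  · simp only [eulerFlow, Prod.smul_snd, norm_smul, Real.norm_eq_abs]
    rw [abs_of_nonneg (hgrid j hj).1]
    exact mul_le_of_le_one_left (norm_nonneg _) (hgrid j hj).2
  · refine ⟨fun k hk j hj => ?_, hmesh, fun k hk j hj => (hf j hj).1 k hk,
      fun k hk j hj => (hf j hj).2.1 k hk, fun j hj => (hf j hj).2.2⟩
    have hc := h.isChain_eulerFlow (hgrid j hj).1
    exact (hc.step k hk).trans (hc.small k hk)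
  · refine ⟨fun k hk j hj => ?_, fun k hk j hj => ?_, fun k hk j hj => (hg j hj).1 k hk,
      fun k hk j hj => (hg j hj).2.1 k hk, fun j hj => (hg j hj).2.2⟩
    · have hj1 := hgrid j hj
      have hc := h.symm.isChain_eulerFlow (s := 1 - (j : ℝ) / N) (by linarith [hj1.2])
      simp only [hsub k hk.le, hsub (k + 1) hk]
      exact (hc.step k hk).trans (hc.small k hk)
    · simp only [sub_sub_sub_cancel_left]
      rw [norm_sub_rev]
      exact hmesh k hk j hj

end IsDeepChain

/-- The convolution product continues along all fine chains that avoid the fine sum. -/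
theorem exists_chainContinues_convZero {Ω Ω' : DiscreteFilteredSet ω} {ρ : ℝ} {φ ψ : ℂ → ℂ}
    (hφ : ContinuesAlongChains Ω ρ φ) (hψ : ContinuesAlongChains Ω' ρ ψ) {δ : ℝ} (hδ : 0 < δ)
    (Λ : ℝ) : ∃ r > 0, ∀ (n : ℕ) (z : ℕ → ℂ) (m : ℕ → ℝ), IsChain n z m r → m 0 < ρ / 16 →
      m n ≤ Λ → (∀ k ≤ n, m k < ρ / 16 ∨ δ ≤ margin (Ω.fineSum Ω') (m k, z k)) →
      ChainContinues (convZero φ ψ) (2 * r) n z := by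
  have hρ := hφ.pos
  have hexp := Real.exp_pos (-(3 * Λ / δ))
  -- The bound `ρ / 64` makes the tail start with clock at most `ρ / 16 + r ≤ ρ / 8`, `δ / 2` serves
  -- the Gronwall estimate, and the last bound gives the margin `16 * r` along the trajectories.
  have hr0 : 0 < min (min (ρ / 64) (δ / 2)) (δ * Real.exp (-(3 * Λ / δ)) / 4) :=
    lt_min (lt_min (by linarith) (by linarith)) (by positivity)
  set r := min (min (ρ / 64) (δ / 2)) (δ * Real.exp (-(3 * Λ / δ)) / 4)
  have hr1 : r ≤ ρ / 64 := (min_le_left _ _).trans (min_le_left _ _)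
  have hr2 : r ≤ δ / 2 := (min_le_left _ _).trans (min_le_right _ _)
  have hr3 : r ≤ δ * Real.exp (-(3 * Λ / δ)) / 4 := min_le_right _ _
  refine ⟨r, hr0, fun n z m hch hm0 hmn hmar => ?_⟩
  refine hch.chainContinues_of_tail (analyticOnNhd_convZero hφ.analytic hψ.analytic) (σ := ρ / 16)
    (by linarith) hr0.le hm0 fun k hk hmk hj => ?_
  have hdeep : ∀ j, k ≤ j → j ≤ n → δ ≤ margin (Ω.fineSum Ω') (m j, z j) := fun j hkj hjn =>
    (hmar j hjn).resolve_left (not_lt.2 (hj j hkj hjn))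
  have hm0' : 0 ≤ m k := (norm_nonneg _).trans (hch.norm_le hk)
  have hD : IsDeepChain Ω Ω' (n - k) (fun i => (m (k + i), z (k + i))) r δ := by
    refine ⟨hch.tail hk, hδ, fun i hi x => ?_, hr2⟩
    have h1 := margin_fineSum_le Ω Ω' x ((m (k + i), z (k + i)) - x)
    rw [add_sub_cancel] at h1
    exact (hdeep (k + i) (by omega) (by omega)).trans h1
  refine hD.chainContinues_convZero (Λ := Λ) hφ hψ hr0 (by linarith) (by linarith)
    (by simpa using hmk.trans (by linarith)) ?_ ?_
  · exact (hdeep k le_rfl hk).trans (margin_le_norm _ hm0' _)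
  · simpa [Nat.add_sub_cancel' hk] using hmn

/-! ### Continuation along paths -/

/-- The functions `f t`, `t ∈ [0,1]`, continue `F` along the path `γ`. -/
structure Continuation (F : ℂ → ℂ) (γ : ℝ → ℂ) (f : ℝ → ℂ → ℂ) (r δ : ℝ) : Prop where
  radius_pos : 0 < r
  mesh_pos : 0 < δ
  analytic : ∀ t ∈ Icc (0 : ℝ) 1, AnalyticOnNhd ℂ (f t) (Metric.ball (γ t) r)
  dist_lt : ∀ t ∈ Icc (0 : ℝ) 1, ∀ t' ∈ Icc (0 : ℝ) 1, |t - t'| < δ → dist (γ t) (γ t') < r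
  eqOn : ∀ t ∈ Icc (0 : ℝ) 1, ∀ t' ∈ Icc (0 : ℝ) 1, |t - t'| < δ →
    EqOn (f t) (f t') (Metric.ball (γ t) r ∩ Metric.ball (γ t') r)
  start : f 0 =ᶠ[𝓝 (γ 0)] F

/-- A path (relative to the centre) with a clock `m` that bounds the length travelled so far, which
avoids the singular set once the clock exceeds `σ`. -/
structure IsClocked (Ω : DiscreteFilteredSet ω) (σ : ℝ) (γ : ℝ → ℂ) (m : ℝ → ℝ) : Prop where
  start : γ 0 = 0
  clock_start : m 0 = 0
  clock_continuous : ContinuousOn m (Icc 0 1)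
  dist_le : ∀ s ∈ Icc (0 : ℝ) 1, ∀ t ∈ Icc (0 : ℝ) 1, s ≤ t → ‖γ t - γ s‖ ≤ m t - m s
  avoids : ∀ s ∈ Icc (0 : ℝ) 1, m s < σ ∨ 0 < margin Ω (m s, γ s)

namespace IsClocked

variable {Ω : DiscreteFilteredSet ω} {σ : ℝ} {γ : ℝ → ℂ} {m : ℝ → ℝ}

theorem monotoneOn (h : IsClocked Ω σ γ m) : MonotoneOn m (Icc 0 1) := fun s hs t ht hst => by
  linarith [(norm_nonneg _).trans (h.dist_le s hs t ht hst)]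

theorem norm_sub_le (h : IsClocked Ω σ γ m) {s t : ℝ} (hs : s ∈ Icc (0 : ℝ) 1)
    (ht : t ∈ Icc (0 : ℝ) 1) : ‖γ t - γ s‖ ≤ |m t - m s| := by
  rcases le_total s t with hst | hst
  · exact (h.dist_le s hs t ht hst).trans (le_abs_self _)
  · rw [norm_sub_rev, abs_sub_comm]
    exact (h.dist_le t ht s hs hst).trans (le_abs_self _)

theorem continuousOn (h : IsClocked Ω σ γ m) : ContinuousOn γ (Icc 0 1) := by
  rw [Metric.continuousOn_iff]
  intro s hs ε hε
  obtain ⟨δ, hδ, hd⟩ := Metric.continuousOn_iff.1 h.clock_continuous s hs ε hε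
  refine ⟨δ, hδ, fun t ht hts => ?_⟩
  rw [dist_eq_norm]
  exact (h.norm_sub_le hs ht).trans_lt (hd t ht hts)

/-- The maximum of `σ - m s` and of the margin is continuous and positive on `[0,1]`; its minimum
can be taken as `δ`. -/
theorem exists_margin (h : IsClocked Ω σ γ m) :
    ∃ δ > 0, ∀ s ∈ Icc (0 : ℝ) 1, m s < σ ∨ δ ≤ margin Ω (m s, γ s) := by
  have hc : ContinuousOn (fun s => max (σ - m s) (margin Ω (m s, γ s))) (Icc 0 1) :=
    ContinuousOn.sup (continuousOn_const.sub h.clock_continuous)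
      ((continuous_margin Ω).comp_continuousOn (h.clock_continuous.prodMk h.continuousOn))
  obtain ⟨s₀, hs₀, hmin⟩ := isCompact_Icc.exists_isMinOn ⟨0, le_rfl, zero_le_one⟩ hc
  refine ⟨max (σ - m s₀) (margin Ω (m s₀, γ s₀)), ?_, fun s hs => ?_⟩
  · rcases h.avoids s₀ hs₀ with h' | h'
    · exact lt_max_of_lt_left (sub_pos.2 h')
    · exact lt_max_of_lt_right h'
  · have h0 : max (σ - m s₀) (margin Ω (m s₀, γ s₀)) ≤
        max (σ - m s) (margin Ω (m s, γ s)) := hmin hs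
    rcases le_max_iff.1 h0 with h' | h'
    · rcases h.avoids s₀ hs₀ with h'' | h''
      · left
        linarith [le_max_left (σ - m s₀) (margin Ω (m s₀, γ s₀))]
      · left
        linarith [le_max_right (σ - m s₀) (margin Ω (m s₀, γ s₀))]
    · exact Or.inr h'

/-- Continuation along fine chains yields continuation along paths. -/
theorem exists_continuation (h : IsClocked Ω σ γ m) (hσ : 0 < σ) {F : ℂ → ℂ}
    (hF : ∀ δ > 0, ∀ Λ : ℝ, ∃ r > 0, ∀ (n : ℕ) (z : ℕ → ℂ) (m : ℕ → ℝ), IsChain n z m r →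
      m 0 < σ → m n ≤ Λ → (∀ k ≤ n, m k < σ ∨ δ ≤ margin Ω (m k, z k)) →
      ChainContinues F (2 * r) n z) : ∃ f r δ, Continuation F γ f r δ := by
  obtain ⟨δ, hδ, hmar⟩ := h.exists_margin
  obtain ⟨r, hr, hF⟩ := hF δ hδ (m 1)
  have hu := isCompact_Icc.uniformContinuousOn_of_continuous h.clock_continuous
  obtain ⟨η, hη, hu⟩ := Metric.uniformContinuousOn_iff.1 hu r hr
  obtain ⟨N, hN⟩ := exists_nat_one_div_lt hη
  have hNR : (0 : ℝ) < (N : ℝ) + 1 := by positivity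
  let t : ℕ → ℝ := fun k => (k : ℝ) / (N + 1)
  have ht : ∀ k ≤ N + 1, t k ∈ Icc (0 : ℝ) 1 := fun k hk =>
    ⟨by positivity, (div_le_one hNR).2 (by exact_mod_cast hk)⟩
  have htsucc : ∀ k, t (k + 1) - t k = 1 / (N + 1) := fun k => by
    simp only [t]
    push_cast
    ring
  have hm0 : m (t 0) = 0 := by simp [t, h.clock_start]
  have hch : IsChain (N + 1) (fun k => γ (t k)) (fun k => m (t k)) r := by
    have hle : ∀ k, t k ≤ t (k + 1) := fun k => by
      have := htsucc k
      have : (0 : ℝ) < 1 / (N + 1) := by positivity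
      linarith
    refine ⟨by simp [t, h.start, h.clock_start], fun k hk => ?_, fun k hk => ?_⟩
    · exact h.dist_le _ (ht k hk.le) _ (ht (k + 1) hk) (hle k)
    · have := hu (t (k + 1)) (ht (k + 1) hk) (t k) (ht k hk.le) (by
        rw [Real.dist_eq, htsucc, abs_of_pos (by positivity)]
        exact hN)
      rw [Real.dist_eq] at this
      exact (le_abs_self _).trans this.le
  obtain ⟨f, hf, hff, hf0⟩ := hF (N + 1) _ _ hch (by simpa [hm0] using hσ)
    (h.monotoneOn (ht _ le_rfl) ⟨zero_le_one, le_rfl⟩ (ht _ le_rfl).2) fun k hk => hmar _ (ht k hk)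
  -- At time `s` the function of the last grid time before `s` is used. Reducing the radius from `2
  -- * r` to `r` absorbs the distance travelled since then, and two times closer than the mesh have
  -- equal or consecutive indices.
  let i : ℝ → ℕ := fun s => ⌊s * (N + 1)⌋₊
  have hi : ∀ s ∈ Icc (0 : ℝ) 1, i s ≤ N + 1 := fun s hs => by
    refine Nat.floor_le_of_le ?_
    push_cast
    exact mul_le_of_le_one_left hNR.le hs.2
  have hti : ∀ s ∈ Icc (0 : ℝ) 1, t (i s) ≤ s ∧ s - t (i s) < 1 / (N + 1) := fun s hs => by
    have h1 := Nat.floor_le (mul_nonneg hs.1 hNR.le)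
    have h2 := Nat.lt_floor_add_one (s * ((N : ℝ) + 1))
    constructor
    · exact (div_le_iff₀ hNR).2 h1
    · rw [sub_lt_iff_lt_add, ← add_div, lt_div_iff₀ hNR]
      linarith
  have hclose : ∀ s ∈ Icc (0 : ℝ) 1, ∀ s' ∈ Icc (0 : ℝ) 1, |s - s'| < 1 / (N + 1) →
      dist (γ s) (γ s') < r := fun s hs s' hs' hss' => by
    rw [dist_eq_norm]
    refine (h.norm_sub_le hs' hs).trans_lt ?_
    have := hu s hs s' hs' (by
      rw [Real.dist_eq]
      exact hss'.trans hN)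
    rwa [Real.dist_eq] at this
  have hsub : ∀ s ∈ Icc (0 : ℝ) 1,
      Metric.ball (γ s) r ⊆ Metric.ball (γ (t (i s))) (2 * r) := fun s hs => by
    refine Metric.ball_subset_ball' ?_
    have := hclose s hs _ (ht _ (hi s hs)) (by
      rw [abs_of_nonneg (sub_nonneg.2 (hti s hs).1)]
      exact (hti s hs).2)
    linarith
  have hadj : ∀ s ∈ Icc (0 : ℝ) 1, ∀ s' ∈ Icc (0 : ℝ) 1, s ≤ s' → s' - s < 1 / (N + 1) →
      EqOn (f (i s)) (f (i s')) (Metric.ball (γ s) r ∩ Metric.ball (γ s') r) := by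
    intro s hs s' hs' hle hlt u hu'
    have h1 : i s ≤ i s' := Nat.floor_mono (mul_le_mul_of_nonneg_right hle hNR.le)
    have h2 : i s' ≤ i s + 1 := by
      have h3 := Nat.floor_le (mul_nonneg hs'.1 hNR.le)
      have h4 := Nat.lt_floor_add_one (s * ((N : ℝ) + 1))
      rw [lt_div_iff₀ hNR] at hlt
      have : (i s' : ℝ) < i s + 2 := by
        simp only [i]
        linarith
      have : i s' < i s + 2 := by exact_mod_cast this
      omega
    rcases h1.eq_or_lt with h3 | h3
    · rw [h3]
    · have e : i s' = i s + 1 := by omega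
      have hle' := hi s' hs'
      have m1 := hsub s hs hu'.1
      have m2 := hsub s' hs' hu'.2
      rw [e] at m2 ⊢
      exact hff (i s) (by omega) ⟨m1, m2⟩
  refine ⟨fun s => f (i s), r, 1 / (N + 1), hr, by positivity,
    fun s hs => (hf _ (hi s hs)).mono (hsub s hs), hclose, fun s hs s' hs' hss' => ?_, ?_⟩
  · rcases le_total s s' with hle | hle
    · exact hadj s hs s' hs' hle (by
        rw [abs_sub_comm] at hss'
        exact (le_abs_self _).trans_lt hss')
    · rw [inter_comm]
      exact (hadj s' hs' s hs hle ((le_abs_self _).trans_lt hss')).symm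
  · have i0 : i 0 = 0 := by simp [i]
    have t0 : t 0 = 0 := by simp [t]
    simp only [i0]
    simp only [t0] at hf0
    exact hf0.eventuallyEq_of_mem (Metric.ball_mem_nhds _ (by linarith))

end IsClocked

end Endless

namespace Endless

/-! ### The space of germs of analytic functions -/

/-- The germs of analytic functions of one complex variable. -/
structure AnalyticGerm : Type where
  /-- The point at which a germ lives. -/
  proj : ℂ
  /-- The germ itself. -/
  toGerm : (𝓝 proj).Germ ℂ
  exists_analyticAt : ∃ f : ℂ → ℂ, AnalyticAt ℂ f proj ∧ toGerm = (f : (𝓝 proj).Germ ℂ)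

open Classical in
/-- The germ at `z` of the function `f` (of `0` if `f` is not analytic at `z`). -/
noncomputable def germ (z : ℂ) (f : ℂ → ℂ) : AnalyticGerm :=
  if h : AnalyticAt ℂ f z then ⟨z, f, f, h, rfl⟩
  else ⟨z, ((fun _ => 0 : ℂ → ℂ) : (𝓝 z).Germ ℂ), fun _ => 0, analyticAt_const, rfl⟩

namespace AnalyticGerm

/-- The value of a germ. -/
noncomputable def eval (x : AnalyticGerm) : ℂ := x.toGerm.value

variable {z w : ℂ} {f g : ℂ → ℂ}

theorem germ_def (hf : AnalyticAt ℂ f z) : germ z f = ⟨z, f, f, hf, rfl⟩ := dif_pos hf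

theorem proj_germ (z : ℂ) (f : ℂ → ℂ) : (germ z f).proj = z := by
  unfold germ
  split_ifs <;> rfl

theorem eval_germ (hf : AnalyticAt ℂ f z) : (germ z f).eval = f z := by
  rw [germ_def hf]
  rfl

theorem exists_eq_germ (x : AnalyticGerm) : ∃ f, AnalyticAt ℂ f x.proj ∧ x = germ x.proj f := by
  obtain ⟨z, q, f, hf, rfl⟩ := x
  exact ⟨f, hf, (germ_def hf).symm⟩

theorem germ_eq_iff (hf : AnalyticAt ℂ f z) (hg : AnalyticAt ℂ g z) :
    germ z f = germ z g ↔ f =ᶠ[𝓝 z] g := by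
  rw [germ_def hf, germ_def hg, AnalyticGerm.mk.injEq, heq_eq_eq, Germ.coe_eq]
  exact and_iff_right rfl

theorem germ_congr (hf : AnalyticAt ℂ f z) (h : f =ᶠ[𝓝 z] g) : germ z f = germ z g :=
  (germ_eq_iff hf (hf.congr h)).2 h

/-- A set of germs is open if it contains with the germ of a function at a point its germs at the
nearby points. -/
instance : TopologicalSpace AnalyticGerm where
  IsOpen U := ∀ z f, AnalyticAt ℂ f z → germ z f ∈ U → ∀ᶠ w in 𝓝 z, germ w f ∈ U
  isOpen_univ _ _ _ _ := Eventually.of_forall fun _ => mem_univ _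
  isOpen_inter U V hU hV z f hf h := (hU z f hf h.1).and (hV z f hf h.2)
  isOpen_sUnion S hS z f hf := by
    rintro ⟨U, hU, h⟩
    exact (hS U hU z f hf h).mono fun w hw => ⟨U, hU, hw⟩

/-- Two functions with the same germ at a point have the same germs at all nearby points. -/
theorem isOpen_image_germ {V : Set ℂ} (hV : IsOpen V) (hf : AnalyticOnNhd ℂ f V) :
    IsOpen ((fun w => germ w f) '' V) := by
  rintro z g hg ⟨w, hw, h⟩
  have hwz : w = z := by simpa [proj_germ] using congrArg proj h
  subst hwz
  have := (germ_eq_iff (hf w hw) hg).1 h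
  filter_upwards [hV.mem_nhds hw, this.eventually_nhds] with v hv hfg
  exact ⟨v, hv, germ_congr (hf v hv) hfg⟩

theorem nhds_germ (hf : AnalyticAt ℂ f z) : 𝓝 (germ z f) = map (fun w => germ w f) (𝓝 z) := by
  refine le_antisymm (fun T hT => ?_) (fun T hT => ?_)
  · have h1 : ∀ᶠ w in 𝓝 z, germ w f ∈ T ∧ AnalyticAt ℂ f w :=
      Eventually.and (mem_map.1 hT) hf.eventually_analyticAt
    obtain ⟨V, hV, hVo, hz⟩ := eventually_nhds_iff.1 h1
    refine mem_of_superset ((isOpen_image_germ hVo fun w hw => (hV w hw).2).mem_nhds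
      ⟨z, hz, rfl⟩) ?_
    rintro _ ⟨w, hw, rfl⟩
    exact (hV w hw).1
  · obtain ⟨U, hU, hUo, h⟩ := mem_nhds_iff.1 hT
    exact mem_map.2 ((hUo z f hf h).mono fun w hw => hU hw)

theorem continuousAt_germ (hf : AnalyticAt ℂ f z) : ContinuousAt (fun w => germ w f) z :=
  (nhds_germ hf).ge

theorem map_proj_nhds (x : AnalyticGerm) : map proj (𝓝 x) = 𝓝 x.proj := by
  obtain ⟨f, hf, hx⟩ := x.exists_eq_germ
  conv_lhs => rw [hx]
  rw [nhds_germ hf, map_map]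
  have : proj ∘ (fun w => germ w f) = id := funext fun w => proj_germ w f
  rw [this, map_id]

theorem continuous_proj : Continuous proj :=
  continuous_iff_continuousAt.2 fun x => (map_proj_nhds x).le

theorem isOpenMap_proj : IsOpenMap proj := isOpenMap_iff_nhds_le.2 fun x => (map_proj_nhds x).ge

theorem isLocalHomeomorph_proj : IsLocalHomeomorph proj := by
  rw [isLocalHomeomorph_iff_isOpenEmbedding_restrict]
  intro x
  obtain ⟨f, hf, hx⟩ := x.exists_eq_germ
  obtain ⟨V, hV, hVo, hz⟩ := eventually_nhds_iff.1 hf.eventually_analyticAt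
  have hU := isOpen_image_germ hVo hV
  refine ⟨_, hU.mem_nhds ⟨_, hz, hx.symm⟩, .of_continuous_injective_isOpenMap
    (continuous_proj.comp continuous_subtype_val) ?_ (isOpenMap_proj.domRestrict hU)⟩
  rintro ⟨_, v, hv, rfl⟩ ⟨_, w, hw, rfl⟩ h
  have : v = w := by simpa [proj_germ] using h
  subst this
  rfl

/-- Over distinct points the projection separates. Distinct germs over the same point come from
functions that differ throughout a punctured disc, so their sheets over a small disc have no germ in
common. -/
instance : T2Space AnalyticGerm := by
  refine ⟨fun x y hxy => ?_⟩
  by_cases hp : x.proj = y.proj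
  · obtain ⟨f, hf, hx⟩ := x.exists_eq_germ
    obtain ⟨g, hg, hy⟩ := y.exists_eq_germ
    rw [← hp] at hg hy
    have hne : ¬ ∀ᶠ w in 𝓝 x.proj, f w = g w := fun h => hxy (by
      rw [hx, hy]
      exact germ_congr hf h)
    have h := (hf.eventually_eq_or_eventually_ne hg).resolve_left hne
    rw [eventually_nhdsWithin_iff] at h
    obtain ⟨V, hV, hVo, hz⟩ := eventually_nhds_iff.1
      (h.and (hf.eventually_analyticAt.and hg.eventually_analyticAt))
    refine ⟨_, _, isOpen_image_germ hVo fun w hw => (hV w hw).2.1,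
      isOpen_image_germ hVo fun w hw => (hV w hw).2.2, ⟨_, hz, hx.symm⟩, ⟨_, hz, hy.symm⟩, ?_⟩
    rw [disjoint_left]
    rintro _ ⟨v, hv, rfl⟩ ⟨w, hw, hvw⟩
    have : w = v := by simpa [proj_germ] using congrArg proj hvw
    subst this
    have he := (germ_eq_iff (hV w hw).2.1 (hV w hw).2.2).1 hvw.symm
    by_cases hwz : w = x.proj
    · subst hwz
      exact hne he
    · exact (hV w hw).1 hwz he.self_of_nhds
  · obtain ⟨u, v, hu, hv, hxu, hyv, huv⟩ := t2_separation hp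
    exact ⟨_, _, hu.preimage continuous_proj, hv.preimage continuous_proj, hxu, hyv,
      huv.preimage proj⟩

theorem eventually_eval_eq (x : AnalyticGerm) :
    ∃ f, AnalyticAt ℂ f x.proj ∧ x = germ x.proj f ∧ ∀ᶠ y in 𝓝 x, y.eval = f y.proj := by
  obtain ⟨f, hf, hx⟩ := x.exists_eq_germ
  refine ⟨f, hf, hx, ?_⟩
  have hn : 𝓝 x = map (fun w => germ w f) (𝓝 x.proj) := by
    conv_lhs => rw [hx]
    exact nhds_germ hf
  rw [hn, eventually_map]
  filter_upwards [hf.eventually_analyticAt] with w hw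
  rw [eval_germ hw, proj_germ]

end AnalyticGerm

/-- Paths with values in a Hausdorff space étalé over another one are determined by their
projections and one of their points. -/
theorem eqOn_of_isLocalHomeomorph {X Y : Type*} [TopologicalSpace X] [T2Space X]
    [TopologicalSpace Y] {p : X → Y} (hp : IsLocalHomeomorph p) {Λ Λ' : ℝ → X} {S : Set ℝ}
    (hS : IsPreconnected S) (h : ContinuousOn Λ S) (h' : ContinuousOn Λ' S)
    (he : ∀ s ∈ S, p (Λ s) = p (Λ' s)) {a : ℝ} (ha : a ∈ S) (haa : Λ a = Λ' a) : EqOn Λ Λ' S :=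
  (T2Space.isSeparatedMap p).eqOn_of_comp_eqOn hp.isLocallyInjective hS h h' he ha haa

end Endless

namespace Endless

variable {ω : ℂ}

/-! ### Clocks of paths -/

theorem continuousOn_ite_half {X : Type*} [TopologicalSpace X] {a b : ℝ → X}
    (ha : ContinuousOn a (Icc 0 1)) (hb : ContinuousOn b (Icc 0 1)) (h : a 1 = b 0) :
    ContinuousOn (fun s => if s ≤ 1 / 2 then a (2 * s) else b (2 * s - 1)) (Icc 0 1) := by
  have hu : Icc (0 : ℝ) 1 = Icc 0 (1 / 2) ∪ Icc (1 / 2) 1 :=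
    (Icc_union_Icc_eq_Icc (by norm_num) (by norm_num)).symm
  rw [hu]
  refine ContinuousOn.union_of_isClosed ?_ ?_ isClosed_Icc isClosed_Icc
  · refine (ha.comp (f := fun s => 2 * s) (by fun_prop) fun s hs => ?_).congr
      fun s hs => if_pos hs.2
    exact ⟨by linarith [hs.1], by linarith [hs.2]⟩
  · refine (hb.comp (f := fun s => 2 * s - 1) (by fun_prop) fun s hs => ?_).congr fun s hs => ?_
    · exact ⟨by linarith [hs.1], by linarith [hs.2]⟩
    · rcases hs.1.eq_or_lt with rfl | hs
      · norm_num [h]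
      · exact if_neg (not_le.2 hs)

/-- The length travelled by an allowed path so far. -/
theorem IsAllowedAt.exists_clock {Ω : DiscreteFilteredSet ω} {L : ℝ} {γ : ℝ → ℂ}
    (h : IsAllowedAt Ω L γ) : ∃ ℓ : ℝ → ℝ, ContinuousOn ℓ (Icc 0 1) ∧
      (∀ s ∈ Icc (0 : ℝ) 1, ∀ t ∈ Icc (0 : ℝ) 1, s ≤ t → ‖γ t - γ s‖ ≤ ℓ t - ℓ s) ∧
      (∀ s ∈ Icc (0 : ℝ) 1, ℓ s < L) ∧
      ∀ s ∈ Icc (0 : ℝ) 1, (∀ s' ∈ Icc 0 s, γ s' = ω) → ℓ s = 0 := by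
  obtain ⟨K, hK⟩ := h.piecewiseC1.exists_lipschitzOnWith
  have hfin : ∀ a b : ℝ, 0 ≤ a → b ≤ 1 → eVariationOn γ (Icc a b) ≠ ⊤ := fun a b ha hb =>
    ((eVariationOn.mono γ (Icc_subset_Icc ha hb)).trans_lt
      (h.length_lt.trans ENNReal.ofReal_lt_top)).ne
  have hadd : ∀ s ∈ Icc (0 : ℝ) 1, ∀ t ∈ Icc (0 : ℝ) 1, s ≤ t →
      (eVariationOn γ (Icc 0 t)).toReal - (eVariationOn γ (Icc 0 s)).toReal =
        (eVariationOn γ (Icc s t)).toReal := fun s hs t ht hst => by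
    have h1 := eVariationOn.Icc_add_Icc γ (s := univ) hs.1 hst (mem_univ s)
    simp only [univ_inter] at h1
    rw [← h1, ENNReal.toReal_add (hfin _ _ le_rfl hs.2) (hfin _ _ hs.1 ht.2)]
    ring
  refine ⟨fun s => (eVariationOn γ (Icc 0 s)).toReal, ?_, fun s hs t ht hst => ?_, fun s hs => ?_,
    fun s hs hc => ?_⟩
  · have hle : ∀ s ∈ Icc (0 : ℝ) 1, ∀ t ∈ Icc (0 : ℝ) 1, s ≤ t →
        |(eVariationOn γ (Icc 0 t)).toReal - (eVariationOn γ (Icc 0 s)).toReal| ≤ K * |t - s| :=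
      fun s hs t ht hst => by
        rw [hadd s hs t ht hst, abs_of_nonneg ENNReal.toReal_nonneg,
          abs_of_nonneg (sub_nonneg.2 hst)]
        have := eVariationOn_le_of_lipschitzOnWith (hK.mono (Icc_subset_Icc hs.1 ht.2))
        refine ENNReal.toReal_le_of_le_ofReal (by have := sub_nonneg.2 hst; positivity) ?_
        rwa [ENNReal.ofReal_mul K.coe_nonneg, ENNReal.ofReal_coe_nnreal]
    refine (LipschitzOnWith.of_dist_le_mul (K := K) fun s hs t ht => ?_).continuousOn
    rw [Real.dist_eq, Real.dist_eq]
    rcases le_total s t with hst | hst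
    · rw [abs_sub_comm, abs_sub_comm s]
      exact hle s hs t ht hst
    · exact hle t ht s hs hst
  · rw [hadd s hs t ht hst, ← dist_eq_norm, dist_edist, edist_comm]
    exact ENNReal.toReal_mono (hfin _ _ hs.1 ht.2)
      (eVariationOn.edist_le γ (left_mem_Icc.2 hst) (right_mem_Icc.2 hst))
  · have h1 := (eVariationOn.mono γ (Icc_subset_Icc_right hs.2)).trans_lt h.length_lt
    rw [← ENNReal.toReal_ofReal h.pos.le]
    exact ENNReal.toReal_strict_mono ENNReal.ofReal_ne_top h1
  · have : eVariationOn γ (Icc 0 s) = 0 := eVariationOn.constant_on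
      (subsingleton_singleton.anti (by rintro _ ⟨s', hs', rfl⟩; exact hc s' hs'))
    simp [this]

namespace IsClocked

variable {Ω : DiscreteFilteredSet ω} {σ : ℝ} {γ γ' : ℝ → ℂ} {m m' : ℝ → ℝ}

/-- Allowed paths are clocked. -/
theorem _root_.Endless.IsAllowed.exists_isClocked (h : IsAllowed Ω γ) (hσ : 0 < σ) :
    ∃ m, IsClocked Ω σ (fun s => γ s - ω) m := by
  obtain ⟨L, hL, h⟩ := h
  obtain ⟨ℓ, hc, hd, hlt, h0⟩ := h.exists_clock
  refine ⟨ℓ, by simp [h.start], h0 0 (left_mem_Icc.2 zero_le_one) fun s hs => ?_, hc,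
    fun s hs t ht hst => by simpa using hd s hs t ht hst, fun s hs => ?_⟩
  · rw [Icc_self, mem_singleton_iff] at hs
    rw [hs, h.start]
  -- While the path rests at `ω` its clock is `0`. Afterwards the length travelled is less than `L`
  -- and the point is off `Ω_L`, so `margin_pos` applies.
  · by_cases hs0 : ∀ s' ∈ Icc 0 s, γ s' = ω
    · exact Or.inl ((h0 s hs hs0).trans_lt hσ)
    · right
      rcases h.avoids with ha | ⟨t₀, ht₀, ha, hb⟩
      · exact absurd (fun s' hs' => ha s' ⟨hs'.1, hs'.2.trans hs.2⟩) hs0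
      · have hts : t₀ < s := by
          by_contra hcon
          exact hs0 fun s' hs' => ha s' ⟨hs'.1, hs'.2.trans (not_lt.1 hcon)⟩
        exact margin_pos (hlt s hs) hL (by simpa using (hb s ⟨hts, hs.2⟩).2)

theorem restrict (h : IsClocked Ω σ γ m) {T : ℝ} (hT : T ∈ Icc (0 : ℝ) 1) :
    IsClocked Ω σ (fun s => γ (T * s)) (fun s => m (T * s)) := by
  have hm : MapsTo (fun s => T * s) (Icc (0 : ℝ) 1) (Icc 0 1) := fun s hs =>
    ⟨mul_nonneg hT.1 hs.1, mul_le_one₀ hT.2 hs.1 hs.2⟩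
  refine ⟨by simpa using h.start, by simpa using h.clock_start,
    h.clock_continuous.comp (continuous_const.mul continuous_id).continuousOn hm,
    fun s hs t ht hst => h.dist_le _ (hm hs) _ (hm ht) (mul_le_mul_of_nonneg_left hst hT.1),
    fun s hs => h.avoids _ (hm hs)⟩

/-- The second clock starts at the final value of the first one: the levels of the filtration count
the length from the very beginning. -/
theorem concat (h : IsClocked Ω σ γ m) (h0 : γ' 0 = γ 1) (hm0 : m' 0 = m 1)
    (hc : ContinuousOn m' (Icc 0 1))
    (hd : ∀ s ∈ Icc (0 : ℝ) 1, ∀ t ∈ Icc (0 : ℝ) 1, s ≤ t → ‖γ' t - γ' s‖ ≤ m' t - m' s)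
    (ha : ∀ s ∈ Icc (0 : ℝ) 1, m' s < σ ∨ 0 < margin Ω (m' s, γ' s)) :
    ∃ m'', IsClocked Ω σ (Endless.concat γ γ') m'' := by
  have hmle : ∀ {s : ℝ}, s ≤ 1 / 2 → (if s ≤ 1 / 2 then m (2 * s) else m' (2 * s - 1)) =
      m (2 * s) := fun hs => if_pos hs
  have hmge : ∀ {s : ℝ}, 1 / 2 ≤ s → (if s ≤ 1 / 2 then m (2 * s) else m' (2 * s - 1)) =
      m' (2 * s - 1) := fun {s} hs => by
    rcases hs.eq_or_lt with rfl | hs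
    · norm_num [hm0]
    · exact if_neg (not_le.2 hs)
  have hI : ∀ s ∈ Icc (0 : ℝ) 1, s ≤ 1 / 2 → 2 * s ∈ Icc (0 : ℝ) 1 := fun s hs h' =>
    ⟨by linarith [hs.1], by linarith⟩
  have hI' : ∀ s ∈ Icc (0 : ℝ) 1, 1 / 2 ≤ s → 2 * s - 1 ∈ Icc (0 : ℝ) 1 := fun s hs h' =>
    ⟨by linarith, by linarith [hs.2]⟩
  have h01 : (0 : ℝ) ∈ Icc (0 : ℝ) 1 := left_mem_Icc.2 zero_le_one
  have h11 : (1 : ℝ) ∈ Icc (0 : ℝ) 1 := right_mem_Icc.2 zero_le_one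
  refine ⟨fun s => if s ≤ 1 / 2 then m (2 * s) else m' (2 * s - 1), ?_, ?_, ?_, ?_, ?_⟩
  · rw [concat_of_le (by norm_num), mul_zero, h.start]
  · norm_num [h.clock_start]
  · exact continuousOn_ite_half h.clock_continuous hc hm0.symm
  · intro s hs t ht hst
    rcases le_total t (1 / 2) with ht2 | ht2
    · have hs2 := hst.trans ht2
      simp only [hmle hs2, hmle ht2, concat_of_le hs2, concat_of_le ht2]
      exact h.dist_le _ (hI s hs hs2) _ (hI t ht ht2) (by linarith)
    · rcases le_total s (1 / 2) with hs2 | hs2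
      · simp only [hmle hs2, hmge ht2, concat_of_le hs2, concat_of_ge h0.symm ht2]
        have h1 := h.dist_le _ (hI s hs hs2) _ h11 (hI s hs hs2).2
        have h2 := hd _ h01 _ (hI' t ht ht2) (hI' t ht ht2).1
        have h3 := norm_add_le (γ' (2 * t - 1) - γ' 0) (γ 1 - γ (2 * s))
        rw [h0, sub_add_sub_cancel] at h3
        rw [h0] at h2
        linarith
      · simp only [hmge hs2, hmge ht2, concat_of_ge h0.symm hs2, concat_of_ge h0.symm ht2]
        exact hd _ (hI' s hs hs2) _ (hI' t ht ht2) (by linarith)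
  · intro s hs
    rcases le_total s (1 / 2) with hs2 | hs2
    · simp only [hmle hs2, concat_of_le hs2]
      exact h.avoids _ (hI s hs hs2)
    · simp only [hmge hs2, concat_of_ge h0.symm hs2]
      exact ha _ (hI' s hs hs2)

/-- Near its end, a clocked path can be prolonged freely. -/
theorem exists_prolongation (h : IsClocked Ω σ γ m) : ∃ ε > 0, ∀ (ℓ : ℝ) (u : ℂ), |ℓ - m 1| < ε →
    ‖u - γ 1‖ < ε → ℓ < σ ∨ 0 < margin Ω (ℓ, u) := by
  have hopen : IsOpen {q : ℝ × ℂ | q.1 < σ ∨ 0 < margin Ω q} :=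
    (isOpen_lt continuous_fst continuous_const).union
      (isOpen_lt continuous_const (continuous_margin Ω))
  obtain ⟨ε, hε, hb⟩ := Metric.isOpen_iff.1 hopen (m 1, γ 1)
    (h.avoids 1 (right_mem_Icc.2 zero_le_one))
  refine ⟨ε, hε, fun ℓ u hℓ hu => hb (show (ℓ, u) ∈ _ from ?_)⟩
  rw [Metric.mem_ball, Prod.dist_eq, Real.dist_eq, dist_eq_norm]
  exact max_lt hℓ hu

end IsClocked

/-! ### Germs along a continuation -/

namespace Continuation

variable {Ω : DiscreteFilteredSet ω} {σ r δ : ℝ} {F : ℂ → ℂ} {γ : ℝ → ℂ} {m : ℝ → ℝ}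
  {f : ℝ → ℂ → ℂ}

theorem analyticAt (h : Continuation F γ f r δ) {t : ℝ} (ht : t ∈ Icc (0 : ℝ) 1) :
    AnalyticAt ℂ (f t) (γ t) :=
  h.analytic t ht _ (Metric.mem_ball_self h.radius_pos)

/-- Near the time `t` all these germs are germs of the single function `f t`. -/
theorem continuousOn_germ (h : Continuation F γ f r δ) (hγ : ContinuousOn γ (Icc 0 1)) :
    ContinuousOn (fun t => germ (γ t) (f t)) (Icc 0 1) := by
  intro t ht
  have h1 : ContinuousWithinAt (fun t' => germ (γ t') (f t)) (Icc 0 1) t :=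
    ContinuousAt.comp_continuousWithinAt (g := fun w => germ w (f t))
      (AnalyticGerm.continuousAt_germ (h.analyticAt ht)) (hγ t ht)
  refine h1.congr_of_eventuallyEq ?_ rfl
  have h2 : ∀ᶠ t' in 𝓝[Icc 0 1] t, |t' - t| < δ := by
    refine nhdsWithin_le_nhds ?_
    filter_upwards [Metric.ball_mem_nhds t h.mesh_pos] with t' ht'
    rwa [Metric.mem_ball, Real.dist_eq] at ht'
  filter_upwards [h2, self_mem_nhdsWithin] with t' ht't ht'
  refine AnalyticGerm.germ_congr (h.analyticAt ht') ?_
  have hmem : γ t' ∈ Metric.ball (γ t') r ∩ Metric.ball (γ t) r :=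
    ⟨Metric.mem_ball_self h.radius_pos, Metric.mem_ball.2 (h.dist_lt t' ht' t ht ht't)⟩
  filter_upwards [(Metric.isOpen_ball.inter Metric.isOpen_ball).mem_nhds hmem] with w hw
  exact h.eqOn t' ht' t ht ht't hw

theorem restrict (h : Continuation F γ f r δ) {T : ℝ} (hT : T ∈ Icc (0 : ℝ) 1) :
    Continuation F (fun s => γ (T * s)) (fun s => f (T * s)) r δ := by
  have hm : ∀ s ∈ Icc (0 : ℝ) 1, T * s ∈ Icc (0 : ℝ) 1 := fun s hs =>
    ⟨mul_nonneg hT.1 hs.1, mul_le_one₀ hT.2 hs.1 hs.2⟩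
  have hd : ∀ s s' : ℝ, |s - s'| < δ → |T * s - T * s'| < δ := fun s s' hs => by
    rw [← mul_sub, abs_mul, abs_of_nonneg hT.1]
    exact (mul_le_of_le_one_left (abs_nonneg _) hT.2).trans_lt hs
  exact ⟨h.radius_pos, h.mesh_pos, fun t ht => h.analytic _ (hm t ht),
    fun t ht t' ht' htt => h.dist_lt _ (hm t ht) _ (hm t' ht') (hd _ _ htt),
    fun t ht t' ht' htt => h.eqOn _ (hm t ht) _ (hm t' ht') (hd _ _ htt), by simpa using h.start⟩

end Continuation

end Endless

namespace Endless

variable {ω : ℂ}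

/-! ### The surface of the germs reached by continuation along clocked paths -/

/-- The germs obtained by continuation of `F` along clocked paths. -/
def reachable (Ω : DiscreteFilteredSet ω) (σ : ℝ) (F : ℂ → ℂ) : Set AnalyticGerm :=
  {x | ∃ γ m f r δ, IsClocked Ω σ γ m ∧ Continuation F γ f r δ ∧ x = germ (γ 1) (f 1)}

section reachable

variable {Ω : DiscreteFilteredSet ω} {σ r δ : ℝ} {F : ℂ → ℂ} {γ γ' : ℝ → ℂ} {m m' : ℝ → ℝ}
  {f : ℝ → ℂ → ℂ}

theorem Continuation.germ_mem_reachable (hf : Continuation F γ f r δ) (h : IsClocked Ω σ γ m)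
    {t : ℝ} (ht : t ∈ Icc (0 : ℝ) 1) : germ (γ t) (f t) ∈ reachable Ω σ F :=
  ⟨_, _, _, r, δ, h.restrict ht, hf.restrict ht, by simp⟩

theorem Continuation.germ_zero (hf : Continuation F γ f r δ) (h : IsClocked Ω σ γ m) :
    germ (γ 0) (f 0) = germ 0 F := by
  rw [← h.start]
  exact AnalyticGerm.germ_congr (hf.analyticAt (left_mem_Icc.2 zero_le_one)) hf.start

/-- The clocked prolongations of a path lift to the reachable germs. -/
theorem Continuation.exists_lift (hf : Continuation F γ f r δ) (h : IsClocked Ω σ γ m)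
    (hC : ∀ γ m, IsClocked Ω σ γ m → ∃ f r δ, Continuation F γ f r δ) (h0 : γ' 0 = γ 1)
    (hm0 : m' 0 = m 1) (hc : ContinuousOn m' (Icc 0 1))
    (hd : ∀ s ∈ Icc (0 : ℝ) 1, ∀ t ∈ Icc (0 : ℝ) 1, s ≤ t → ‖γ' t - γ' s‖ ≤ m' t - m' s)
    (ha : ∀ s ∈ Icc (0 : ℝ) 1, m' s < σ ∨ 0 < margin Ω (m' s, γ' s)) :
    ∃ Λ : ℝ → AnalyticGerm, ContinuousOn Λ (Icc 0 1) ∧ Λ 0 = germ (γ 1) (f 1) ∧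
      ∀ s ∈ Icc (0 : ℝ) 1, Λ s ∈ reachable Ω σ F ∧ (Λ s).proj = γ' s := by
  obtain ⟨m'', h''⟩ := h.concat h0 hm0 hc hd ha
  obtain ⟨f'', r'', δ'', hf''⟩ := hC _ _ h''
  have hcont := hf''.continuousOn_germ h''.continuousOn
  have hh : ∀ s ∈ Icc (0 : ℝ) 1, (s + 1) / 2 ∈ Icc (0 : ℝ) 1 := fun s hs =>
    ⟨by linarith [hs.1], by linarith [hs.2]⟩
  have hh' : ∀ s ∈ Icc (0 : ℝ) 1, s / 2 ∈ Icc (0 : ℝ) 1 := fun s hs =>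
    ⟨by linarith [hs.1], by linarith [hs.2]⟩
  have hg : ∀ s ∈ Icc (0 : ℝ) 1, concat γ γ' ((s + 1) / 2) = γ' s := fun s hs => by
    rw [concat_of_ge h0.symm (by linarith [hs.1])]
    congr 1
    ring
  have hg' : ∀ s ∈ Icc (0 : ℝ) 1, concat γ γ' (s / 2) = γ s := fun s hs => by
    rw [concat_of_le (by linarith [hs.2])]
    congr 1
    ring
  refine ⟨fun s => germ (concat γ γ' ((s + 1) / 2)) (f'' ((s + 1) / 2)),
    hcont.comp (by fun_prop) hh, ?_, fun s hs => ⟨hf''.germ_mem_reachable h'' (hh s hs), ?_⟩⟩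
  -- The continuation along the product path is a new choice given by `hC`. On the first half it
  -- agrees with `f`, because both lift the same path from the germ of `F` at `0`.
  · have := eqOn_of_isLocalHomeomorph AnalyticGerm.isLocalHomeomorph_proj isPreconnected_Icc
      (Λ := fun s => germ (concat γ γ' (s / 2)) (f'' (s / 2))) (Λ' := fun s => germ (γ s) (f s))
      (hcont.comp (by fun_prop) hh') (hf.continuousOn_germ h.continuousOn)
      (fun s hs => by simp only [AnalyticGerm.proj_germ, hg' s hs])
      (left_mem_Icc.2 zero_le_one) (by
        have h1 := hf''.germ_zero h''
        have h2 := hf.germ_zero h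
        simp only [zero_div]
        rw [h1, h2])
    have h1 := this (right_mem_Icc.2 zero_le_one)
    norm_num at h1 ⊢
    exact h1
  · rw [AnalyticGerm.proj_germ, hg s hs]

/-- A short segment from `γ 1` to `w`, with clock `m 1 + s * ‖w - γ 1‖`, is a clocked prolongation.
Uniqueness of lifts shows that the germ reached at `w` is that of `g`. -/
theorem isOpen_reachable (hC : ∀ γ m, IsClocked Ω σ γ m → ∃ f r δ, Continuation F γ f r δ) :
    IsOpen (reachable Ω σ F) := by
  rintro z g hg ⟨γ, m, f, r, δ, h, hf, hx⟩
  have hz : z = γ 1 := by simpa [AnalyticGerm.proj_germ] using congrArg AnalyticGerm.proj hx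
  subst hz
  obtain ⟨ε, hε, hgood⟩ := h.exists_prolongation
  obtain ⟨ε', hε', hball⟩ := Metric.eventually_nhds_iff_ball.1 hg.eventually_analyticAt
  filter_upwards [Metric.ball_mem_nhds (γ 1) (lt_min hε hε')] with w hw
  have hw1 : ‖w - γ 1‖ < ε := (mem_ball_iff_norm.1 hw).trans_le (min_le_left _ _)
  have hw2 : w ∈ Metric.ball (γ 1) ε' := Metric.ball_subset_ball (min_le_right _ _) hw
  have hseg : ∀ s t : ℝ, segPath (γ 1) w t - segPath (γ 1) w s = ((t - s : ℝ) : ℂ) * (w - γ 1) :=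
    fun s t => by
      simp only [segPath]
      push_cast
      ring
  obtain ⟨Λ, hΛ, hΛ0, hΛs⟩ := hf.exists_lift h hC (γ' := segPath (γ 1) w)
    (m' := fun s => m 1 + s * ‖w - γ 1‖) (segPath_zero _ _) (by simp) (by fun_prop)
    (fun s hs t ht hst => by
      rw [hseg, norm_mul, Complex.norm_real, Real.norm_eq_abs, abs_of_nonneg (sub_nonneg.2 hst)]
      linarith)
    (fun s hs => by
      refine hgood _ _ ?_ ?_
      · rw [add_sub_cancel_left, abs_of_nonneg (mul_nonneg hs.1 (norm_nonneg _))]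
        exact (mul_le_of_le_one_left (norm_nonneg _) hs.2).trans_lt hw1
      · exact mem_ball_iff_norm.1 (segPath_mem_ball (Metric.mem_ball_self hε)
          (mem_ball_iff_norm.2 hw1) hs))
  have hin : ∀ s ∈ Icc (0 : ℝ) 1, segPath (γ 1) w s ∈ Metric.ball (γ 1) ε' := fun s hs =>
    segPath_mem_ball (Metric.mem_ball_self hε') hw2 hs
  have := eqOn_of_isLocalHomeomorph AnalyticGerm.isLocalHomeomorph_proj isPreconnected_Icc
    (Λ := Λ) (Λ' := fun s => germ (segPath (γ 1) w s) g) hΛ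
    (fun s hs => ContinuousAt.comp_continuousWithinAt (g := fun w => germ w g)
      (AnalyticGerm.continuousAt_germ (hball _ (hin s hs)))
      (continuous_segPath (γ 1) w).continuousWithinAt)
    (fun s hs => by rw [(hΛs s hs).2, AnalyticGerm.proj_germ])
    (left_mem_Icc.2 zero_le_one) (by rw [hΛ0, ← hx, segPath_zero])
  have h1 : Λ 1 = germ w g := by
    simpa [segPath_one] using this (right_mem_Icc.2 zero_le_one)
  rw [← h1]
  exact (hΛs 1 (right_mem_Icc.2 zero_le_one)).1

theorem isConnected_reachable (hσ : 0 < σ)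
    (hC : ∀ γ m, IsClocked Ω σ γ m → ∃ f r δ, Continuation F γ f r δ) :
    germ 0 F ∈ reachable Ω σ F ∧ IsConnected (reachable Ω σ F) := by
  have h0 : germ 0 F ∈ reachable Ω σ F := by
    have h : IsClocked Ω σ (fun _ => 0) (fun _ => 0) :=
      ⟨rfl, rfl, continuousOn_const, fun _ _ _ _ _ => by simp, fun _ _ => Or.inl hσ⟩
    obtain ⟨f, r, δ, hf⟩ := hC _ _ h
    rw [← hf.germ_zero h]
    exact hf.germ_mem_reachable h (left_mem_Icc.2 zero_le_one)
  refine ⟨h0, ⟨_, h0⟩, isPreconnected_of_forall (germ 0 F) ?_⟩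
  rintro _ ⟨γ, m, f, r, δ, h, hf, rfl⟩
  refine ⟨(fun t => germ (γ t) (f t)) '' Icc 0 1, ?_, ⟨0, left_mem_Icc.2 zero_le_one,
    hf.germ_zero h⟩, ⟨1, right_mem_Icc.2 zero_le_one, rfl⟩,
    isPreconnected_Icc.image _ (hf.continuousOn_germ h.continuousOn)⟩
  rintro _ ⟨t, ht, rfl⟩
  exact hf.germ_mem_reachable h ht

end reachable

/-- The filtered set seen from a point at relative position `z` reached with clock `a`. -/
def DiscreteFilteredSet.shift (Ω : DiscreteFilteredSet ω) (z : ℂ) {a ε : ℝ} (ha : 0 ≤ a)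
    (hε : 0 < ε) : DiscreteFilteredSet z where
  pts L := {x | x = z ∨ (ε ≤ L ∧ x ∈ Ω.pts (a + L) ∧ x ∈ Metric.ball z L)}
  finite_pts L hL := by
    refine ((finite_singleton z).union (Ω.finite_pts (a + L) (by linarith))).subset ?_
    rintro x (hx | hx)
    · exact Or.inl hx
    · exact Or.inr hx.2.1
  pts_subset_ball L hL := by
    rintro x (rfl | hx)
    · exact Metric.mem_ball_self hL
    · exact hx.2.2
  pts_mono L M hL hLM := by
    rintro x (hx | ⟨h1, h2, h3⟩)
    · exact Or.inl hx
    · exact Or.inr ⟨h1.trans hLM, Ω.pts_mono _ _ (by linarith) (by linarith) h2,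
        Metric.ball_subset_ball hLM h3⟩
  pts_small := by
    filter_upwards [Ioo_mem_nhdsGT hε] with L hL
    ext x
    simp [not_le.2 hL.2]

/-- If a germ continues along all clocked paths, it continues to an endless Riemann surface, to
which all allowed paths can be lifted. -/
theorem exists_isEndlessRiemannSurface {Ω : DiscreteFilteredSet ω} {σ : ℝ} (hσ : 0 < σ)
    {φ : ℂ → ℂ} (hφ : AnalyticAt ℂ φ ω) (hC : ∀ γ m, IsClocked Ω σ γ m →
      ∃ f r δ, Continuation (fun u => φ (ω + u)) γ f r δ) :
    ∃ (R : Type) (_ : TopologicalSpace R) (p : R → ℂ) (x : R), IsEndlessRiemannSurface p ∧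
      p x = ω ∧ ContinuesTo p x φ ∧ ∀ γ : ℝ → ℂ, IsAllowed Ω γ →
        ∃ Λ : ℝ → R, ContinuousOn Λ (Icc 0 1) ∧ Λ 0 = x ∧ ∀ s ∈ Icc (0 : ℝ) 1, p (Λ s) = γ s := by
  set F : ℂ → ℂ := fun u => φ (ω + u)
  have hF : AnalyticAt ℂ F 0 := by
    refine AnalyticAt.comp (g := φ) (f := fun u => ω + u) ?_ (analyticAt_const.add analyticAt_id)
    simpa using hφ
  obtain ⟨h0, hconn⟩ := isConnected_reachable hσ hC
  have hopen := isOpen_reachable hC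
  let R := reachable Ω σ F
  let p : R → ℂ := fun x => ω + x.1.proj
  have hproj : (germ 0 F).proj = 0 := AnalyticGerm.proj_germ 0 F
  have hx : p ⟨germ 0 F, h0⟩ = ω := by simp [p, hproj]
  have hlift : ∀ Λ : ℝ → AnalyticGerm, ContinuousOn Λ (Icc 0 1) →
      (∀ s ∈ Icc (0 : ℝ) 1, Λ s ∈ R) → ∃ Λ' : ℝ → R, ContinuousOn Λ' (Icc 0 1) ∧
        ∀ s ∈ Icc (0 : ℝ) 1, (Λ' s).1 = Λ s := fun Λ hΛ hmem => by
    classical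
    refine ⟨fun s => if hs : s ∈ Icc (0 : ℝ) 1 then ⟨Λ s, hmem s hs⟩ else ⟨germ 0 F, h0⟩,
      ?_, fun s hs => by simp only [dif_pos hs]⟩
    refine continuousOn_iff_continuous_domRestrict.2 (Continuous.subtype_mk
      (continuousOn_iff_continuous_domRestrict.1 hΛ) (fun s => hmem s.1 s.2) |>.congr fun s => ?_)
    simp only [domRestrict_apply, dif_pos s.2]
  refine ⟨R, inferInstance, p, ⟨germ 0 F, h0⟩, ⟨inferInstance,
    Subtype.connectedSpace hconn, ?_, ?_⟩, hx, ⟨by rwa [hx], fun x => x.1.eval, ?_, ?_⟩, ?_⟩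
  · exact (Homeomorph.addLeft ω).isLocalHomeomorph.comp
      (AnalyticGerm.isLocalHomeomorph_proj.comp hopen.isOpenEmbedding_subtypeVal.isLocalHomeomorph)
  · rintro ⟨_, γ, m, f, r, δ, h, hf, rfl⟩
    obtain ⟨ε, hε, hgood⟩ := h.exists_prolongation
    have hz : p ⟨germ (γ 1) (f 1), γ, m, f, r, δ, h, hf, rfl⟩ = ω + γ 1 := by
      simp [p, AnalyticGerm.proj_germ]
    have ha : 0 ≤ m 1 := by
      have := h.monotoneOn (left_mem_Icc.2 zero_le_one) (right_mem_Icc.2 zero_le_one) zero_le_one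
      rwa [h.clock_start] at this
    -- The levels of the shifted set add the length `m 1` already used. At levels below `ε` only the
    -- centre is kept, since prolongations shorter than `ε` are unrestricted.
    refine ⟨Ω.shift _ ha hε, ?_⟩
    rw [hz]
    rintro μ ⟨L, hL, hμ⟩
    obtain ⟨ℓ, hc, hd, hlt, hℓ0⟩ := hμ.exists_clock
    have hI : (0 : ℝ) ∈ Icc (0 : ℝ) 1 := left_mem_Icc.2 zero_le_one
    have hzero : ℓ 0 = 0 := hℓ0 0 hI fun s hs => by
      rw [Icc_self, mem_singleton_iff] at hs
      rw [hs, hμ.start]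
    have hnear : ∀ s ∈ Icc (0 : ℝ) 1, ℓ s < ε →
        m 1 + ℓ s < σ ∨ 0 < margin Ω (m 1 + ℓ s, μ s - ω) := fun s hs hlε => by
      have h1 := hd 0 hI s hs hs.1
      rw [hzero, sub_zero, hμ.start] at h1
      refine hgood _ _ ?_ ?_
      · rwa [add_sub_cancel_left, abs_of_nonneg ((norm_nonneg _).trans h1)]
      · rw [sub_sub]
        exact h1.trans_lt hlε
    obtain ⟨Λ, hΛ, hΛ0, hΛs⟩ := hf.exists_lift h hC (γ' := fun s => μ s - ω)
      (m' := fun s => m 1 + ℓ s) (by simp [hμ.start]) (by simp [hzero])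
      (continuousOn_const.add hc) (fun s hs t ht hst => by simpa using hd s hs t ht hst)
      (fun s hs => by
        -- Once the clock of `μ` reaches `ε`, the level `L` exceeds `ε`, so the shifted set at `L`
        -- contains the points of `Ω_{m 1 + L}` in the disc; moreover `μ` has left its centre.
        rcases lt_or_ge (ℓ s) ε with hlε | hlε
        · exact hnear s hs hlε
        · right
          have hLε : ε ≤ L := hlε.trans (hlt s hs).le
          have hs0 : ¬ ∀ s' ∈ Icc 0 s, μ s' = ω + γ 1 := fun hcon => by
            rw [hℓ0 s hs hcon] at hlε
            exact absurd hε (not_lt.2 hlε)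
          rcases hμ.avoids with hav | ⟨t₀, ht₀, hav, hb⟩
          · exact absurd (fun s' hs' => hav s' ⟨hs'.1, hs'.2.trans hs.2⟩) hs0
          · have hts : t₀ < s := by
              by_contra hcon
              exact hs0 fun s' hs' => hav s' ⟨hs'.1, hs'.2.trans (not_lt.1 hcon)⟩
            obtain ⟨hb1, hb2⟩ := hb s ⟨hts, hs.2⟩
            refine margin_pos (L := m 1 + L) (by linarith [hlt s hs]) (by linarith) fun hmem => ?_
            rw [add_sub_cancel] at hmem
            exact hb2 (Or.inr ⟨hLε, hmem, hb1⟩))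
    obtain ⟨Λ', hΛ', hΛ's⟩ := hlift Λ hΛ fun s hs => (hΛs s hs).1
    refine ⟨Λ', hΛ', Subtype.ext ((hΛ's 0 hI).trans hΛ0), fun s hs => ?_⟩
    simp only [p, hΛ's s hs, (hΛs s hs).2]
    ring
  · intro x
    obtain ⟨g, hg, -, he⟩ := x.1.eventually_eval_eq
    refine ⟨fun w => g (w - ω), ?_, ?_⟩
    · refine AnalyticAt.comp (g := g) (f := fun w => w - ω) ?_ (analyticAt_id.sub analyticAt_const)
      simpa [p] using hg
    · filter_upwards [continuous_subtype_val.continuousAt.eventually he] with y hy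
      simp only [p, add_sub_cancel_left]
      exact hy
  · have h1 : ∀ᶠ y in 𝓝 (germ 0 F), y.eval = F y.proj := by
      rw [AnalyticGerm.nhds_germ hF, eventually_map]
      filter_upwards [hF.eventually_analyticAt] with w hw
      rw [AnalyticGerm.eval_germ hw, AnalyticGerm.proj_germ]
    exact (continuous_subtype_val.tendsto (⟨germ 0 F, h0⟩ : R)).eventually h1
  · intro γ hγ
    obtain ⟨m, hm⟩ := hγ.exists_isClocked hσ
    obtain ⟨f, r, δ, hf⟩ := hC _ _ hm
    obtain ⟨Λ, hΛ, hΛs⟩ := hlift _ (hf.continuousOn_germ hm.continuousOn)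
      fun s hs => hf.germ_mem_reachable hm hs
    refine ⟨Λ, hΛ, Subtype.ext ((hΛs 0 (left_mem_Icc.2 zero_le_one)).trans (hf.germ_zero hm)),
      fun s hs => ?_⟩
    simp only [p, hΛs s hs, AnalyticGerm.proj_germ]
    ring

end Endless

namespace Endless

variable {ω : ℂ}

/-! ### Lifting of allowed paths implies continuation to the surface of the filtered set -/

theorem _root_.IsLocalHomeomorph.exists_section {X Y : Type*} [TopologicalSpace X]
    [PseudoMetricSpace Y] {p : X → Y} (hp : IsLocalHomeomorph p) {x : X} {W : Set X}
    (hW : W ∈ 𝓝 x) : ∃ s : Y → X, s (p x) = x ∧ ∃ r > 0, ContinuousOn s (Metric.ball (p x) r) ∧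
      ∀ y ∈ Metric.ball (p x) r, p (s y) = y ∧ s y ∈ W := by
  obtain ⟨e, hx, rfl⟩ := hp x
  have h1 : ∀ᶠ y in 𝓝 (e x), e.symm y ∈ W := by
    refine (e.continuousAt_symm (e.map_source hx)).eventually ?_
    rwa [e.left_inv hx]
  obtain ⟨r, hr, h⟩ := Metric.eventually_nhds_iff_ball.1
    (h1.and (e.open_target.mem_nhds (e.map_source hx)))
  exact ⟨e.symm, e.left_inv hx, r, hr, e.continuousOn_symm.mono fun y hy => (h y hy).2,
    fun y hy => ⟨e.right_inv (h y hy).2, (h y hy).1⟩⟩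

theorem isStarDomain_ball {z : ℂ} {r : ℝ} (hr : 0 < r) : IsStarDomain z (Metric.ball z r) :=
  ⟨Metric.isOpen_ball, Metric.mem_ball_self hr,
    (convex_ball z r).starConvex (Metric.mem_ball_self hr)⟩

section lift

variable {Ω : DiscreteFilteredSet ω} {R : Type} [TopologicalSpace R] {p : R → ℂ} {x : R}

/-- `ζ` is the end point of a lift of `γ` from `x`. -/
def IsLiftEnd (p : R → ℂ) (x : R) (γ : ℝ → ℂ) (ζ : R) : Prop :=
  ∃ Λ : ℝ → R, ContinuousOn Λ (Icc 0 1) ∧ Λ 0 = x ∧ (∀ s ∈ Icc (0 : ℝ) 1, p (Λ s) = γ s) ∧ Λ 1 = ζ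

theorem IsLiftEnd.proj {γ : ℝ → ℂ} {ζ : R} (h : IsLiftEnd p x γ ζ) : p ζ = γ 1 := by
  obtain ⟨Λ, -, -, h, rfl⟩ := h
  exact h 1 (right_mem_Icc.2 zero_le_one)

theorem IsLiftEnd.unique [T2Space R] (hp : IsLocalHomeomorph p) {γ : ℝ → ℂ} {ζ ζ' : R}
    (h : IsLiftEnd p x γ ζ) (h' : IsLiftEnd p x γ ζ') : ζ = ζ' := by
  obtain ⟨Λ, hc, h0, h, rfl⟩ := h
  obtain ⟨Λ', hc', h0', h', rfl⟩ := h'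
  exact eqOn_of_isLocalHomeomorph hp isPreconnected_Icc hc hc'
    (fun s hs => (h s hs).trans (h' s hs).symm) (left_mem_Icc.2 zero_le_one) (h0.trans h0'.symm)
    (right_mem_Icc.2 zero_le_one)

theorem IsLiftEnd.concat_segPath {γ : ℝ → ℂ} {ζ : R} (h : IsLiftEnd p x γ ζ) {s : ℂ → R} {r : ℝ}
    (hr : 0 < r) (hsζ : s (p ζ) = ζ) (hc : ContinuousOn s (Metric.ball (p ζ) r))
    (hs : ∀ y ∈ Metric.ball (p ζ) r, p (s y) = y) {ξ : ℂ} (hξ : ξ ∈ Metric.ball (p ζ) r) :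
    IsLiftEnd p x (concat γ (segPath (γ 1) ξ)) (s ξ) := by
  rw [← h.proj]
  have hproj := h.proj
  obtain ⟨Λ, hΛ, h0, h, rfl⟩ := h
  have hin : ∀ t ∈ Icc (0 : ℝ) 1, segPath (p (Λ 1)) ξ t ∈ Metric.ball (p (Λ 1)) r := fun t ht =>
    segPath_mem_ball (Metric.mem_ball_self hr) hξ ht
  refine ⟨_, continuousOn_ite_half hΛ (b := fun t => s (segPath (p (Λ 1)) ξ t))
    (hc.comp (continuous_segPath _ _).continuousOn hin) (by simp [segPath_zero, hsζ]),
    by norm_num [h0], fun t ht => ?_, by norm_num [segPath_one]⟩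
  unfold concat
  split_ifs with htt
  · exact h _ ⟨by linarith [ht.1], by linarith⟩
  · exact hs _ (hin _ ⟨by linarith, by linarith [ht.2]⟩)

theorem isLiftEnd_segPath {s : ℂ → R} {r : ℝ} (hr : 0 < r) (hsx : s (p x) = x)
    (hc : ContinuousOn s (Metric.ball (p x) r)) (hs : ∀ y ∈ Metric.ball (p x) r, p (s y) = y)
    {ξ : ℂ} (hξ : ξ ∈ Metric.ball (p x) r) : IsLiftEnd p x (segPath (p x) ξ) (s ξ) := by
  have hin : ∀ t ∈ Icc (0 : ℝ) 1, segPath (p x) ξ t ∈ Metric.ball (p x) r := fun t ht =>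
    segPath_mem_ball (Metric.mem_ball_self hr) hξ ht
  exact ⟨fun t => s (segPath (p x) ξ t), hc.comp (continuous_segPath _ _).continuousOn hin,
    by simp [segPath_zero, hsx], fun t ht => hs _ (hin t ht), by simp [segPath_one]⟩

/-- All intermediate paths are allowed and hence lift from `x`. The lifts depend continuously on
`(s, t)`, so their end points form a lift of a constant path and do not move. -/
theorem AllowedHomotopic.isLiftEnd_eq [T2Space R] (hp : IsLocalHomeomorph p)
    (hl : ∀ γ : ℝ → ℂ, IsAllowed Ω γ → ∃ ζ, IsLiftEnd p x γ ζ) {γ₀ γ₁ : AllowedPath Ω}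
    (h : AllowedHomotopic Ω γ₀ γ₁) {ζ₀ ζ₁ : R} (h₀ : IsLiftEnd p x γ₀.1 ζ₀)
    (h₁ : IsLiftEnd p x γ₁.1 ζ₁) : ζ₀ = ζ₁ := by
  obtain ⟨H, hH, hH0, hH1, hHe⟩ := h
  have hex : ∀ t : unitInterval, ∃ Λ : ℝ → R, ContinuousOn Λ (Icc 0 1) ∧ Λ 0 = x ∧
      ∀ s ∈ Icc (0 : ℝ) 1, p (Λ s) = H s t := fun t => by
    obtain ⟨ζ, Λ, h1, h2, h3, -⟩ := hl _ (hH.allowed t t.2)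
    exact ⟨Λ, h1, h2, h3⟩
  choose Λ hΛ hΛ0 hΛs using hex
  have hend : ∀ t : unitInterval, IsLiftEnd p x (fun s => H s t) (Λ t 1) := fun t =>
    ⟨Λ t, hΛ t, hΛ0 t, hΛs t, rfl⟩
  have hcongr : ∀ {γ γ' : ℝ → ℂ} {ζ : R}, (∀ s ∈ Icc (0 : ℝ) 1, γ s = γ' s) →
      IsLiftEnd p x γ ζ → IsLiftEnd p x γ' ζ := fun hγ ⟨Λ, a, b, c, d⟩ =>
    ⟨Λ, a, b, fun s hs => (c s hs).trans (hγ s hs), d⟩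
  have e₀ : Λ 0 1 = ζ₀ := IsLiftEnd.unique hp (hcongr (by simpa using hH0) (hend 0)) h₀
  have e₁ : Λ 1 1 = ζ₁ := IsLiftEnd.unique hp (hcongr (by simpa using hH1) (hend 1)) h₁
  let f : C(unitInterval × unitInterval, ℂ) := ⟨fun q => H q.1 q.2,
    hH.continuousOn.comp_continuous (f := fun q : unitInterval × unitInterval => ((q.1 : ℝ), (q.2 : ℝ)))
      (by fun_prop) fun q => ⟨q.1.2, q.2.2⟩⟩
  have hg := hp.continuous_lift (T2Space.isSeparatedMap p) f (g := fun q => Λ q.2 q.1)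
    (funext fun q => hΛs q.2 q.1 q.1.2) (by simpa [hΛ0] using continuous_const)
    (fun t => continuousOn_iff_continuous_domRestrict.1 (hΛ t))
  have hc := (T2Space.isSeparatedMap p).eq_of_comp_eq hp.isLocallyInjective
    (hg.comp (Continuous.prodMk_right (1 : unitInterval))) (continuous_const (y := Λ 0 1))
    (funext fun t => ?_) 0 (by simp)
  · rw [← e₀, ← e₁]
    simpa using (congrFun hc 1).symm
  · have h1 := hΛs t 1 (right_mem_Icc.2 zero_le_one)
    have h2 := hΛs 0 1 (right_mem_Icc.2 zero_le_one)
    rw [hHe t t.2] at h1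
    rw [hHe _ (0 : unitInterval).2] at h2
    simpa using h1.trans h2.symm

/-- If all allowed paths lift to a surface, then the surface of the filtered set maps to it. -/
theorem exists_continuous_surface_lift [T2Space R] (hp : IsLocalHomeomorph p) (hx : p x = ω)
    (hl : ∀ γ : ℝ → ℂ, IsAllowed Ω γ → ∃ ζ, IsLiftEnd p x γ ζ) :
    ∃ E : Surface Ω → R, Continuous E ∧ (∀ y, p (E y) = Surface.proj Ω y) ∧
      E (Surface.base Ω) = x := by
  choose e he using fun γ : AllowedPath Ω => hl γ.1 γ.2
  let E : Surface Ω → R := Quot.lift e fun γ₀ γ₁ h => h.isLiftEnd_eq hp hl (he γ₀) (he γ₁)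
  have hE : ∀ (γ : ℝ → ℂ) (h : IsAllowed Ω γ) (ζ : R), IsLiftEnd p x γ ζ →
      E (Surface.cl Ω ⟨γ, h⟩) = ζ := fun γ h ζ hζ => (he ⟨γ, h⟩).unique hp hζ
  have hbase : E (Surface.base Ω) = x :=
    hE _ _ _ ⟨fun _ => x, continuousOn_const, rfl, fun _ _ => hx, rfl⟩
  refine ⟨E, continuous_iff_continuousAt.2 ?_, ?_, hbase⟩
  · rintro ⟨γ, h⟩
    change ContinuousAt E (Surface.cl Ω ⟨γ, h⟩)
    intro W hW
    rw [mem_map]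
    by_cases hγ : γ 1 = ω
    · have hcl : Surface.cl Ω ⟨γ, h⟩ = Surface.base Ω := by
        rw [← clOf_of_isAllowed h, Surface.base, ← clOf_of_isAllowed (isAllowed_const Ω)]
        obtain ⟨L, hL, hL'⟩ := id h
        exact clOf_congr h fun s hs => (hL'.eq_center hγ s hs).symm
      rw [hcl] at hW ⊢
      rw [hbase] at hW
      obtain ⟨s, hsx, r, hr, hc, hs⟩ := hp.exists_section hW
      obtain ⟨L, hL, hL0, hLr⟩ := (Ω.pts_small.and (Ioo_mem_nhdsGT hr)).exists
      have hopen : IsOpen (baseNhd Ω (Metric.ball ω L)) :=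
        TopologicalSpace.isOpen_generateFrom_of_mem (Or.inl ⟨L, _, hL0, isStarDomain_ball hL0,
          by simp [hL], rfl⟩)
      have hmem : Surface.base Ω ∈ baseNhd Ω (Metric.ball ω L) := by
        have ha : IsAllowed Ω (segPath ω ω) :=
          (isAllowed_const Ω).congr fun s _ => segPath_self ω s
        exact ⟨ω, Metric.mem_ball_self hL0, ha,
          (clOf_segPath_center (Ω := Ω)).symm.trans (clOf_of_isAllowed ha)⟩
      refine mem_of_superset (hopen.mem_nhds hmem) ?_
      rintro _ ⟨ξ, hξ, ha, rfl⟩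
      have hξr : ξ ∈ Metric.ball (p x) r := by
        rw [hx]
        exact Metric.ball_subset_ball hLr.le hξ
      have hlift := isLiftEnd_segPath hr hsx hc (fun y hy => (hs y hy).1) hξr
      rw [hx] at hlift
      rw [mem_preimage, hE _ ha _ hlift]
      exact (hs ξ hξr).2
    · have hζ := he ⟨γ, h⟩
      have hEγ := hE γ h _ hζ
      rw [hEγ] at hW
      obtain ⟨s, hsx, r, hr, hc, hs⟩ := hp.exists_section hW
      obtain ⟨L, hL, hL'⟩ := id h
      have hnot : γ 1 ∉ Ω.pts L := by
        obtain ⟨t₀, ht₀, -, hb⟩ := hL'.exists_of_ne hγ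
        exact hb 1 ⟨ht₀.2, le_rfl⟩
      obtain ⟨ε, hε, hb⟩ := Metric.mem_nhds_iff.1
        ((Ω.finite_pts L hL).isClosed.isOpen_compl.mem_nhds hnot)
      have hfin : pathLength γ ≠ ⊤ := (hL'.length_lt.trans ENNReal.ofReal_lt_top).ne
      have hd : (pathLength γ).toReal < L := by
        have := ENNReal.toReal_strict_mono ENNReal.ofReal_ne_top hL'.length_lt
        rwa [ENNReal.toReal_ofReal hL.le] at this
      -- The radius is bounded by that of the local section, by that of a disc avoiding `Ω_L`, and
      -- by half of the length left, so that the straight prolongations are admissible and lift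
      -- through the section.
      have hr0 : 0 < min (min r ε) ((L - (pathLength γ).toReal) / 2) :=
        lt_min (lt_min hr hε) (by linarith)
      set r' := min (min r ε) ((L - (pathLength γ).toReal) / 2)
      have hr1 : r' ≤ r := (min_le_left _ _).trans (min_le_left _ _)
      have hr2 : r' ≤ ε := (min_le_left _ _).trans (min_le_right _ _)
      have hr3 : r' ≤ (L - (pathLength γ).toReal) / 2 := min_le_right _ _
      have hlen : pathLength γ + ENNReal.ofReal r' < ENNReal.ofReal L := by
        rw [← ENNReal.ofReal_toReal hfin, ← ENNReal.ofReal_add ENNReal.toReal_nonneg hr0.le,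
          ENNReal.ofReal_lt_ofReal_iff hL]
        linarith
      have hopen : IsOpen (pathNhd Ω γ (Metric.ball (γ 1) r')) :=
        TopologicalSpace.isOpen_generateFrom_of_mem (Or.inr ⟨γ, L, r', _, hL', hγ, hr0, hlen,
          isStarDomain_ball hr0, fun w hw => ⟨hw, hb (Metric.ball_subset_ball hr2 hw)⟩, rfl⟩)
      have hmem : Surface.cl Ω ⟨γ, h⟩ ∈ pathNhd Ω γ (Metric.ball (γ 1) r') := by
        have hself : segPath (γ 1) (γ 1) = fun _ => γ 1 := funext fun s => segPath_self _ s
        have ha : IsAllowed Ω (concat γ (segPath (γ 1) (γ 1))) := by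
          rw [hself]
          exact ⟨L, hL, hL'.concat_const⟩
        refine ⟨γ 1, Metric.mem_ball_self hr0, ha, ?_⟩
        rw [← clOf_of_isAllowed h, ← clOf_of_isAllowed ha, hself, clOf_concat_const h]
      refine mem_of_superset (hopen.mem_nhds hmem) ?_
      rintro _ ⟨ξ, hξ, ha, rfl⟩
      have hξr : ξ ∈ Metric.ball (p (e ⟨γ, h⟩)) r := by
        rw [hζ.proj]
        exact Metric.ball_subset_ball hr1 hξ
      rw [mem_preimage, hE _ ha _ (hζ.concat_segPath hr hsx hc (fun y hy => (hs y hy).1) hξr)]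
      exact (hs ξ hξr).2
  · rintro ⟨γ, h⟩
    exact (he ⟨γ, h⟩).proj

end lift

/-- If all allowed paths can be lifted to a surface to which a germ continues, then the germ
continues to the surface of the filtered set. -/
theorem ContinuesTo.continuesToSurface {Ω : DiscreteFilteredSet ω} {R : Type} [TopologicalSpace R]
    [T2Space R] {p : R → ℂ} {x : R} (hp : IsLocalHomeomorph p) (hx : p x = ω)
    (hl : ∀ γ : ℝ → ℂ, IsAllowed Ω γ → ∃ Λ : ℝ → R, ContinuousOn Λ (Icc 0 1) ∧ Λ 0 = x ∧
      ∀ s ∈ Icc (0 : ℝ) 1, p (Λ s) = γ s) {φ : ℂ → ℂ} (hφ : ContinuesTo p x φ) :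
    ContinuesToSurface Ω φ := by
  obtain ⟨E, hEc, hEp, hEb⟩ := exists_continuous_surface_lift (Ω := Ω) hp hx fun γ hγ => by
    obtain ⟨Λ, h1, h2, h3⟩ := hl γ hγ
    exact ⟨Λ 1, Λ, h1, h2, h3, rfl⟩
  obtain ⟨hφa, Φ, hΦ, hΦx⟩ := hφ
  refine ⟨?_, fun y => Φ (E y), fun y => ?_, ?_⟩
  · rwa [← hEp, hEb]
  · obtain ⟨f, hf, he⟩ := hΦ (E y)
    rw [hEp] at hf
    refine ⟨f, hf, ?_⟩
    filter_upwards [hEc.continuousAt.eventually he] with z hz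
    rw [hz, hEp]
  · rw [← hEb] at hΦx
    filter_upwards [hEc.continuousAt.eventually hΦx] with z hz
    rw [hz, hEp]

/-- The convolution product continues along all clocked paths. -/
theorem exists_continuation_convolution {φ ψ : ℂ → ℂ} {Ω Ω' : DiscreteFilteredSet ω}
    (hφ : ContinuesToSurface Ω φ) (hψ : ContinuesToSurface Ω' ψ) :
    ∃ σ > 0, AnalyticAt ℂ (convolution ω φ ψ) ω ∧
      ∀ γ m, IsClocked (Ω.fineSum Ω') σ γ m →
        ∃ f r δ, Continuation (fun u => convolution ω φ ψ (ω + u)) γ f r δ := by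
  obtain ⟨ρ, hρφ, hρψ⟩ :=
    (hφ.eventually_continuesAlongChains.and hψ.eventually_continuesAlongChains).exists
  have hconv : (fun u => convolution ω φ ψ (ω + u)) =
      convZero (fun u => φ (ω + u)) (fun u => ψ (ω + u)) := funext (convolution_add ω φ ψ)
  have hρ := hρφ.pos
  refine ⟨ρ / 16, by linarith, ?_, fun γ m h => ?_⟩
  · have h0 := analyticOnNhd_convZero hρφ.analytic hρψ.analytic 0 (Metric.mem_ball_self hρ)
    rw [← hconv] at h0
    have h1 : AnalyticAt ℂ (fun w => w - ω) ω := analyticAt_id.sub analyticAt_const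
    have h2 := AnalyticAt.comp (g := fun u => convolution ω φ ψ (ω + u)) (f := fun w => w - ω)
      (by simpa using h0) h1
    refine h2.congr (Eventually.of_forall fun w => ?_)
    simp
  · rw [hconv]
    exact h.exists_continuation (by linarith) fun δ hδ Λ =>
      exists_chainContinues_convZero hρφ hρψ hδ Λ

/-- An endlessly continuable germ continues to the surface of some filtered set. -/
theorem EndlesslyContinuable.exists_continuesToSurface {φ : ℂ → ℂ}
    (h : EndlesslyContinuable ω φ) : ∃ Ω : DiscreteFilteredSet ω, ContinuesToSurface Ω φ := by
  obtain ⟨R, _, p, x, hR, rfl, hφ⟩ := h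
  obtain ⟨Ω, hΩ⟩ := hR.endless x
  have := hR.t2
  exact ⟨Ω, hφ.continuesToSurface hR.isLocalHomeomorph rfl hΩ⟩

end Endless

theorem mainTheorem1 (ω : ℂ) (φ ψ : ℂ → ℂ) :
    (Endless.EndlesslyContinuable ω φ → Endless.EndlesslyContinuable ω ψ →
      Endless.EndlesslyContinuable ω (Endless.convolution ω φ ψ)) ∧
    (∀ Ω Ω' : Endless.DiscreteFilteredSet ω,
      Endless.ContinuesToSurface Ω φ → Endless.ContinuesToSurface Ω' ψ →
        Endless.ContinuesToSurface (Ω.fineSum Ω') (Endless.convolution ω φ ψ)) := by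
  refine ⟨fun hφ hψ => ?_, fun Ω Ω' hφ hψ => ?_⟩
  -- The given endless surfaces are replaced by surfaces of filtered sets, which reduces the claim
  -- to continuation along the clocked paths of a fine sum; the germs so reached form the required
  -- endless surface.
  · obtain ⟨Ω, hφ⟩ := hφ.exists_continuesToSurface
    obtain ⟨Ω', hψ⟩ := hψ.exists_continuesToSurface
    obtain ⟨σ, hσ, ha, hC⟩ := Endless.exists_continuation_convolution hφ hψ
    obtain ⟨R, hR, p, x, hp, hx, h, -⟩ := Endless.exists_isEndlessRiemannSurface hσ ha hC
    exact ⟨R, hR, p, x, hp, hx, h⟩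
  · obtain ⟨σ, hσ, ha, hC⟩ := Endless.exists_continuation_convolution hφ hψ
    obtain ⟨R, hR, p, x, hp, hx, h, hl⟩ := Endless.exists_isEndlessRiemannSurface hσ ha hC
    have := hp.t2
    exact h.continuesToSurface hp.isLocalHomeomorph hx hl
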